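/- Let $\mathcal H=\bigoplus_{n\ge1}L^2[0,\frac{\pi}{n}]$ and let $-\Delta$ be the Dirichlet Laplacian on $\mathcal H$: its domain consists of the $\psi=(\psi_n)_n\in\mathcal H$ with $\psi_n\in H^2(0,\frac{\pi}{n})$, $\psi_n(0)=\psi_n(\frac{\pi}{n})=0$ for all $n$ and $\sum_n\|\psi_n''\|^2<\infty$, and $-\Delta\psi=(-\psi_n'')_n$. Let $d(n)$ be the number of positive divisors of $n$, $\gamma$ Euler's constant, and $K_\nu,Y_0$ the usual Bessel functions; $\ln$ and $\sqrt{\cdot}$ on $\mathbb C\setminus\mathbb R_{\le0}$ denote the principal branches. For $k$ with $|\operatorname{Im}k|<\sqrt{1+(\operatorname{Re}k)^2}$ let $\mathcal Z(s,k)$ be the meromorphic continuation to $s\in\mathbb C$ of $\operatorname{Tr}\big((-\Delta+k^2)^{-s}\big)$, $\operatorname{Re}s>\frac12$ (the sum of $(\mu+k^2)^{-s}$ over the eigenvalues $\mu$ of $-\Delta$, with multiplicity); it is analytic at $s=0$. Let $\det(-\Delta+k^2)$ be the entire function of $k\in\mathbb C$ that equals $\exp\big(-\partial_s\mathcal Z(s,k)|_{s=0}\big)$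 for these $k$. For $k>0$ let $$T^{\mathrm{po}}(k)=2\pi\sum_{n=1}^\infty d(n)\int_0^\infty\Big[\tfrac2\pi K_0(4\pi\sqrt{np})-Y_0(4\pi\sqrt{np})\Big]\frac{dp}{p^2+k^2},\qquad Z(s)=\exp\Big(-2\int_s^\infty k\,T^{\mathrm{po}}(k)\,dk\Big)\quad(s>0).$$ These series and integrals converge absolutely, and the following holds. (1) $Z$ extends to an analytic function on $\mathbb C\setminus\mathbb R_{\le0}$, and there $$Z(s)=\frac1{\sqrt s}\exp\big(-\pi s\ln s-(2\gamma-1)\pi s\big)\det(-\Delta+s^2).$$ (2) The zeros of $Z$ in $\mathbb C\setminus\mathbb R_{\le0}$ are exactly the points $\pm i n$, $n=1,2,3,\dots$; in particular they all lie on the line $\operatorname{Re}s=0$ (an analogue of the Riemann hypothesis). They are the points $\pm ik$ with $k>0$ and $k^2$ an eigenvalue of $-\Delta$. The order of the zero at $i n$ and at $-i n$ is $d(n)$, which is the multiplicity of the eigenvalue $n^2$ of $-\Delta$. (3) On the half plane $\operatorname{Re}s>0$ the analytic branch of $\ln Z(s)$ that is real for $s>0$ is given by the absolutely convergent series $$\ln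 Z(s)=-\sqrt{\tfrac2\pi}\,\sqrt s\sum_{n=1}^\infty d(n)\sqrt{\ell_n}\Big[e^{-\frac{i\pi}4}K_1\Big(2(2\pi)^{\frac32}\sqrt{\tfrac{s}{\ell_n}}\,e^{\frac{i\pi}4}\Big)+e^{\frac{i\pi}4}K_1\Big(2(2\pi)^{\frac32}\sqrt{\tfrac{s}{\ell_n}}\,e^{-\frac{i\pi}4}\Big)\Big],\qquad \ell_n=\tfrac{2\pi}{n}.$$ -/

import Mathlib

open Set MeasureTheory

/-! ### The Dirichlet Laplacian of the infinite chain of edges `[0, π / n]`, `n ≥ 1` -/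

/-- The `L²` space of the `n`-th edge, the interval `[0, π / n]`. -/
abbrev EdgeSpace (n : ℕ+) : Type :=
  Lp ℂ 2 ((volume : Measure ℝ).restrict (Icc 0 (Real.pi / (n : ℝ))))

/-- The Hilbert space `⨁ₙ L²[0, π / n]` (Hilbert sum over `n ≥ 1`). -/
abbrev GraphSpace : Type := lp (fun n : ℕ+ => EdgeSpace n) 2

/-- `f ∈ H²(0, π / n)`, `f(0) = f(π / n) = 0` and `g = -f''`. In dimension one, `f ∈ H²` means that
`f` has a representative `u` which is the integral of a function `v = u'`, which is itself the
integral of an `L²` function, the (weak) second derivative; the boundary values are those of the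
continuous representative `u`. -/
def IsEdgeNegLaplacian (n : ℕ+) (f g : EdgeSpace n) : Prop :=
  ∃ u v : ℝ → ℂ,
    (f =ᵐ[(volume : Measure ℝ).restrict (Icc 0 (Real.pi / (n : ℝ)))] u) ∧
    u 0 = 0 ∧ u (Real.pi / (n : ℝ)) = 0 ∧
    ∀ x ∈ Icc (0 : ℝ) (Real.pi / (n : ℝ)),
      u x = u 0 + ∫ y in (0 : ℝ)..x, v y ∧ v x = v 0 - ∫ y in (0 : ℝ)..x, g y

theorem edge_intervalIntegrable (n : ℕ+) (g : EdgeSpace n) {x : ℝ}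
    (hx : x ∈ Icc (0 : ℝ) (Real.pi / (n : ℝ))) : IntervalIntegrable g volume 0 x := by
  have h : IntegrableOn g (Icc 0 (Real.pi / (n : ℝ))) volume :=
    (Lp.memLp g).integrable (by norm_num)
  rw [intervalIntegrable_iff_integrableOn_Ioc_of_le hx.1]
  exact h.mono_set (fun y hy => ⟨hy.1.le, hy.2.trans hx.2⟩)

theorem edge_continuousOn (n : ℕ+) (g : EdgeSpace n) {v : ℝ → ℂ}
    (hv : ∀ x ∈ Icc (0 : ℝ) (Real.pi / (n : ℝ)), v x = v 0 - ∫ y in (0 : ℝ)..x, g y) :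
    ContinuousOn v (Icc 0 (Real.pi / (n : ℝ))) := by
  have h : IntegrableOn g (Icc 0 (Real.pi / (n : ℝ))) volume :=
    (Lp.memLp g).integrable (by norm_num)
  have h2 := intervalIntegral.continuousOn_primitive (μ := volume) (f := g) (a := 0)
    (b := Real.pi / (n : ℝ)) h
  refine (continuousOn_const.sub h2).congr (f := fun x => v 0 - ∫ y in Ioc 0 x, g y) ?_
  intro x hx
  rw [hv x hx, intervalIntegral.integral_of_le hx.1]

theorem edge_continuous_intervalIntegrable (n : ℕ+) (g : EdgeSpace n) {v : ℝ → ℂ}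
    (hv : ∀ x ∈ Icc (0 : ℝ) (Real.pi / (n : ℝ)), v x = v 0 - ∫ y in (0 : ℝ)..x, g y)
    {x : ℝ} (hx : x ∈ Icc (0 : ℝ) (Real.pi / (n : ℝ))) : IntervalIntegrable v volume 0 x := by
  apply ContinuousOn.intervalIntegrable
  rw [uIcc_of_le hx.1]
  exact (edge_continuousOn n g hv).mono (Icc_subset_Icc le_rfl hx.2)

theorem IsEdgeNegLaplacian.add {n : ℕ+} {f₁ g₁ f₂ g₂ : EdgeSpace n}
    (h₁ : IsEdgeNegLaplacian n f₁ g₁) (h₂ : IsEdgeNegLaplacian n f₂ g₂) :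
    IsEdgeNegLaplacian n (f₁ + f₂) (g₁ + g₂) := by
  obtain ⟨u₁, v₁, e₁, a₁, b₁, c₁⟩ := h₁
  obtain ⟨u₂, v₂, e₂, a₂, b₂, c₂⟩ := h₂
  refine ⟨u₁ + u₂, v₁ + v₂, ?_, by simp [a₁, a₂], by simp [b₁, b₂], ?_⟩
  · filter_upwards [e₁, e₂, Lp.coeFn_add f₁ f₂] with x h1 h2 h3
    rw [h3, Pi.add_apply, Pi.add_apply, h1, h2]
  · intro x hx
    have i₁ := edge_continuous_intervalIntegrable n g₁ (fun y hy => (c₁ y hy).2) hx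
    have i₂ := edge_continuous_intervalIntegrable n g₂ (fun y hy => (c₂ y hy).2) hx
    have hg : ∫ y in (0 : ℝ)..x, (g₁ + g₂ : EdgeSpace n) y =
        ∫ y in (0 : ℝ)..x, (g₁ y + g₂ y) := by
      rw [intervalIntegral.integral_of_le hx.1, intervalIntegral.integral_of_le hx.1]
      refine integral_congr_ae ?_
      exact ae_restrict_of_ae_restrict_of_subset
        (fun y (hy : y ∈ Ioc 0 x) => (⟨hy.1.le, hy.2.trans hx.2⟩ :
          y ∈ Icc (0 : ℝ) (Real.pi / (n : ℝ)))) (Lp.coeFn_add g₁ g₂)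
    refine ⟨?_, ?_⟩
    · simp only [Pi.add_apply]
      rw [intervalIntegral.integral_add i₁ i₂, (c₁ x hx).1, (c₂ x hx).1]
      ring
    · rw [hg, intervalIntegral.integral_add (edge_intervalIntegrable n g₁ hx)
        (edge_intervalIntegrable n g₂ hx)]
      simp only [Pi.add_apply]
      rw [(c₁ x hx).2, (c₂ x hx).2]
      ring

theorem IsEdgeNegLaplacian.smul {n : ℕ+} {f g : EdgeSpace n} (c : ℂ)
    (h : IsEdgeNegLaplacian n f g) : IsEdgeNegLaplacian n (c • f) (c • g) := by
  obtain ⟨u, v, e, a, b, d⟩ := h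
  refine ⟨c • u, c • v, ?_, by simp [a], by simp [b], ?_⟩
  · filter_upwards [e, Lp.coeFn_smul c f] with x h1 h2
    rw [h2, Pi.smul_apply, Pi.smul_apply, h1]
  · intro x hx
    have hg : ∫ y in (0 : ℝ)..x, (c • g : EdgeSpace n) y = ∫ y in (0 : ℝ)..x, c • g y := by
      rw [intervalIntegral.integral_of_le hx.1, intervalIntegral.integral_of_le hx.1]
      refine integral_congr_ae ?_
      exact ae_restrict_of_ae_restrict_of_subset
        (fun y (hy : y ∈ Ioc 0 x) => (⟨hy.1.le, hy.2.trans hx.2⟩ :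
          y ∈ Icc (0 : ℝ) (Real.pi / (n : ℝ)))) (Lp.coeFn_smul c g)
    refine ⟨?_, ?_⟩
    · simp only [Pi.smul_apply]
      rw [intervalIntegral.integral_smul, (d x hx).1, smul_add]
    · rw [hg, intervalIntegral.integral_smul]
      simp only [Pi.smul_apply]
      rw [(d x hx).2, smul_sub]

/-- The graph of `-Δ`: all pairs `(ψ, φ)` of vectors of `⨁ₙ L²[0, π / n]` such that, on every edge,
`ψₙ ∈ H²(0, π / n)` satisfies Dirichlet conditions at both ends and `φₙ = -ψₙ''`. -/
def negLaplacianGraph : Submodule ℂ (GraphSpace × GraphSpace) where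
  carrier := {p | ∀ n : ℕ+, IsEdgeNegLaplacian n (p.1 n) (p.2 n)}
  add_mem' := fun h₁ h₂ n => (h₁ n).add (h₂ n)
  zero_mem' := fun n => by
    have h0 : ((0 : GraphSpace) n) = (0 : EdgeSpace n) := rfl
    have hz : ∀ x ∈ Icc (0 : ℝ) (Real.pi / (n : ℝ)),
        ∫ y in (0 : ℝ)..x, (0 : EdgeSpace n) y = 0 := by
      intro x hx
      rw [intervalIntegral.integral_of_le hx.1]
      refine integral_eq_zero_of_ae ?_
      exact ae_restrict_of_ae_restrict_of_subset
        (fun y (hy : y ∈ Ioc 0 x) => (⟨hy.1.le, hy.2.trans hx.2⟩ :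
          y ∈ Icc (0 : ℝ) (Real.pi / (n : ℝ)))) (Lp.coeFn_zero ℂ 2 _)
    refine ⟨0, 0, ?_, rfl, rfl, fun x hx => ⟨by simp, ?_⟩⟩
    · exact Lp.coeFn_zero ℂ 2 _
    · have := hz x hx
      simp only [Prod.snd_zero, h0, this, Pi.zero_apply, sub_zero]
  smul_mem' := fun c _ h n => (h n).smul c

/-- The Dirichlet Laplacian `-Δ` as an (unbounded) linear operator on `⨁ₙ L²[0, π / n]`. -/
noncomputable def negLaplacian : GraphSpace →ₗ.[ℂ] GraphSpace :=
  negLaplacianGraph.toLinearPMap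

theorem ae_eq_zero_of_primitive_eq_zero {L : ℝ} (hL : 0 < L) {f : ℝ → ℂ}
    (hf : IntervalIntegrable f volume 0 L)
    (h : ∀ x ∈ Icc (0 : ℝ) L, ∫ y in (0 : ℝ)..x, f y = 0) :
    f =ᵐ[(volume : Measure ℝ).restrict (Icc 0 L)] 0 := by
  rw [Filter.EventuallyEq, ← restrict_Ioo_eq_restrict_Icc, ae_restrict_iff' measurableSet_Ioo]
  filter_upwards [hf.ae_hasDerivAt_integral] with x hx hxI
  have hx' : x ∈ uIcc 0 L := by
    rw [uIcc_of_le hL.le]; exact ⟨hxI.1.le, hxI.2.le⟩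
  have h1 := hx hx' 0 left_mem_uIcc
  refine (h1.congr_of_eventuallyEq ?_).unique (hasDerivAt_const x (0 : ℂ))
  filter_upwards [Ioo_mem_nhds hxI.1 hxI.2] with y hy
  exact (h y ⟨hy.1.le, hy.2.le⟩).symm

theorem IsEdgeNegLaplacian.eq_zero {n : ℕ+} {g : EdgeSpace n}
    (h : IsEdgeNegLaplacian n 0 g) : g = 0 := by
  obtain ⟨u, v, e, a, b, c⟩ := h
  have hL : 0 < Real.pi / (n : ℝ) := div_pos Real.pi_pos (by exact_mod_cast n.pos)
  have hLm : Real.pi / (n : ℝ) ∈ Icc 0 (Real.pi / (n : ℝ)) := ⟨hL.le, le_rfl⟩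
  have hvc : ContinuousOn v (Icc 0 (Real.pi / (n : ℝ))) :=
    edge_continuousOn n g (fun x hx => (c x hx).2)
  have hvi : IntervalIntegrable v volume 0 (Real.pi / (n : ℝ)) :=
    edge_continuous_intervalIntegrable n g (fun x hx => (c x hx).2) hLm
  have huc : ContinuousOn u (Icc 0 (Real.pi / (n : ℝ))) := by
    have h2 := intervalIntegral.continuousOn_primitive_interval' hvi left_mem_uIcc
    rw [uIcc_of_le hL.le] at h2
    exact (continuousOn_const.add h2).congr (fun x hx => (c x hx).1)
  have hu0 : EqOn u 0 (Icc 0 (Real.pi / (n : ℝ))) := by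
    refine Measure.eqOn_Icc_of_ae_eq volume hL.ne ?_ huc continuousOn_const
    filter_upwards [e, Lp.coeFn_zero ℂ 2
      ((volume : Measure ℝ).restrict (Icc 0 (Real.pi / (n : ℝ))))] with x h1 h2
    rw [← h1, h2]
  have hv0 : EqOn v 0 (Icc 0 (Real.pi / (n : ℝ))) := by
    refine Measure.eqOn_Icc_of_ae_eq volume hL.ne ?_ hvc continuousOn_const
    refine ae_eq_zero_of_primitive_eq_zero hL hvi (fun x hx => ?_)
    have := (c x hx).1
    rw [hu0 hx, a] at this
    simpa using this.symm
  have hg := ae_eq_zero_of_primitive_eq_zero hL (edge_intervalIntegrable n g hLm) (fun x hx => by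
    have := (c x hx).2
    rw [hv0 hx, hv0 ⟨le_rfl, hL.le⟩] at this
    simpa using this.symm)
  exact (Lp.eq_zero_iff_ae_eq_zero).2 hg

theorem negLaplacianGraph_functional :
    ∀ p ∈ negLaplacianGraph, p.1 = 0 → p.2 = 0 := by
  rintro ⟨ψ, φ⟩ hp h0
  have h0' : ψ = 0 := h0
  subst h0'
  refine lp.ext (funext fun n => ?_)
  exact (show IsEdgeNegLaplacian n 0 (φ n) from hp n).eq_zero

theorem graph_negLaplacian : negLaplacian.graph = negLaplacianGraph :=
  Submodule.toLinearPMap_graph_eq _ negLaplacianGraph_functional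

/-- The eigenspace `{ψ ∈ 𝒟(Δ) : -Δ ψ = μ ψ}`. -/
noncomputable def negLaplacianEigenspace (μ : ℂ) : Submodule ℂ GraphSpace :=
  negLaplacian.graph.comap (LinearMap.id.prod (μ • LinearMap.id))

/-- The multiplicity of `μ` as an eigenvalue of `-Δ` (zero if `μ` is not an eigenvalue). -/
noncomputable def eigenMult (μ : ℂ) : ℕ := Module.finrank ℂ (negLaplacianEigenspace μ)

/-! ### The functional determinant `det(-Δ + k²)` -/

/-- `F` is the spectral zeta function `s ↦ Tr((-Δ + k²)^{-s})`: a meromorphic function on `ℂ` that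
for `Re s > 1 / 2` is the (convergent) sum of `(μ + k²)^{-s}` (principal branch) over the
eigenvalues `μ` of `-Δ`, counted with multiplicity. -/
def IsSpectralZeta (k : ℂ) (F : ℂ → ℂ) : Prop :=
  MeromorphicOn F univ ∧
    ∀ s : ℂ, 1 / 2 < s.re →
      HasSum (fun μ : ℂ => (eigenMult μ : ℂ) * (μ + k ^ 2) ^ (-s)) (F s)

/-- `D k = det(-Δ + k²)`: the entire function of `k` which on
`{k : |Im k| < √(1 + (Re k)²)}` is the zeta-regularized determinant `exp(-∂ₛ Tr((-Δ + k²)^{-s})|ₛ₌₀)`,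
where the spectral zeta function is analytic at `s = 0`. -/
def IsSpectralDet (D : ℂ → ℂ) : Prop :=
  Differentiable ℂ D ∧
    ∀ k : ℂ, |k.im| < Real.sqrt (1 + k.re ^ 2) →
      ∃ F : ℂ → ℂ, IsSpectralZeta k F ∧ AnalyticAt ℂ F 0 ∧ D k = Complex.exp (-deriv F 0)

/-! ### The periodic-orbit term and the periodic-orbit zeta function -/

/-- The modified Bessel function `K_ν(z)` for `Re z > 0` (the only arguments at which it is used):
`K_ν(z) = ∫_0^∞ exp(-z cosh t) cosh(ν t) dt`. -/
noncomputable def besselK (ν z : ℂ) : ℂ :=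
  ∫ t in Ioi (0 : ℝ), Complex.exp (-z * Real.cosh t) * Complex.cosh (ν * t)

/-- The Bessel function of the second kind `Y₀(x)` for `x > 0` (the only arguments at which it is
used), by Schläfli's integral
`Y₀(x) = (1/π) ∫_0^π sin(x sin θ) dθ - (2/π) ∫_0^∞ exp(-x sinh t) dt`. -/
noncomputable def besselY0 (x : ℝ) : ℝ :=
  1 / Real.pi * (∫ θ in (0 : ℝ)..Real.pi, Real.sin (x * Real.sin θ)) -
    2 / Real.pi * ∫ t in Ioi (0 : ℝ), Real.exp (-x * Real.sinh t)

/-- The integrand `[(2/π) K₀(4π√(np)) - Y₀(4π√(np))] / (p² + k²)`. -/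
noncomputable def poIntegrand (n : ℕ+) (k p : ℝ) : ℝ :=
  (2 / Real.pi * (besselK 0 ((4 * Real.pi * Real.sqrt (n * p) : ℝ) : ℂ)).re -
    besselY0 (4 * Real.pi * Real.sqrt (n * p))) / (p ^ 2 + k ^ 2)

/-- The `n`-th term `d(n) ∫_0^∞ [(2/π) K₀(4π√(np)) - Y₀(4π√(np))] dp / (p² + k²)`. -/
noncomputable def poTerm (k : ℝ) (n : ℕ+) : ℝ :=
  ((n : ℕ).divisors.card : ℝ) * ∫ p in Ioi (0 : ℝ), poIntegrand n k p

/-- The periodic-orbit term of the trace of the resolvent: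
`T^po(k) = 2π ∑ₙ d(n) ∫_0^∞ [(2/π) K₀(4π√(np)) - Y₀(4π√(np))] dp / (p² + k²)`, `k > 0`. -/
noncomputable def Tpo (k : ℝ) : ℝ := 2 * Real.pi * ∑' n : ℕ+, poTerm k n

/-- The periodic-orbit zeta function `Z(s) = exp(-2 ∫_s^∞ k T^po(k) dk)` for real `s > 0`. -/
noncomputable def Zpo (s : ℝ) : ℝ := Real.exp (-2 * ∫ k in Ioi s, k * Tpo k)

/-- The length `2π / n` of the `n`-th primitive periodic orbit. -/
noncomputable def orbitLength (n : ℕ+) : ℝ := 2 * Real.pi / n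

/-- The `n`-th term of the periodic-orbit series of `ln Z(s)`, `Re s > 0`:
`d(n) √ℓₙ [e^{-iπ/4} K₁(2(2π)^{3/2} √(s/ℓₙ) e^{iπ/4}) + e^{iπ/4} K₁(2(2π)^{3/2} √(s/ℓₙ) e^{-iπ/4})]`
with `ℓₙ = 2π / n` and principal square roots. -/
noncomputable def logZTerm (s : ℂ) (n : ℕ+) : ℂ :=
  let w : ℂ := 2 * ((2 * Real.pi) ^ (3 / 2 : ℝ) : ℝ) * (s / orbitLength n) ^ (1 / 2 : ℂ)
  let ω : ℂ := Complex.exp (Real.pi / 4 * Complex.I)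
  let ω' : ℂ := Complex.exp (-(Real.pi / 4 * Complex.I))
  ((n : ℕ).divisors.card : ℂ) * (Real.sqrt (orbitLength n) : ℂ) *
    (ω' * besselK 1 (w * ω) + ω * besselK 1 (w * ω'))

open Filter Topology

/-! ### The Macdonald functions `K₀` and `K₁` on the right half-plane -/

/-! The Dirichlet eigenvalues on the edge of length π/a are (ab)², b ≥ 1, so m² occurs once for each
factorisation m = ab, that is d(m) times (`eigenMult_sq`). The spectral zeta function is Σ d(m)(m² +
k²)^{-s}. Expanding binomially in k²/m², the leading term ζ(2s)² has derivative log 2π at s = 0, and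
the remainder may be differentiated there term by term. This gives det(-Δ + k²) = (2π)⁻¹ ∏_{a,b} (1
+ k²/(ab)²) (`spectralDet_eq_exp`), from which the zeros and their orders are read off.

The core is a summation formula of Voronoi type for s > 0. Euler's product turns the product over b
into sinh(πs/a)/(πs/a), whose logarithm contains log(1 - e^{-2πs/a}) = -Σ_j e^{-2πsj/a}/j. For fixed
j, the sum over a is compared with an integral by the trapezoidal rule. The error is ½∫ {u}(1 - {u})
(e^{-x/u})'' du with x = 2πsj, and the Fourier series of {u}(1 - {u}) turns it into cosine
transforms of (e^{-x/u})'', which are values of K₁ on the ray of argument π/4 (`hasSum_trapError`).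
Collecting the two indices by their product brings back d(n) and yields the orbit series
(`orbitSum_ofReal`). Harmonic numbers, Stirling's formula and the behaviour of ∫_δ^∞ dt/(t(e^t - 1))
as δ → 0 supply the elementary terms πs ln s + (2γ - 1)πs + ln 2π + ½ ln s
(`tendsto_sum_log_sinh_div`).

Independently, every integral in T^po is a Poisson integral for the right half-plane: K₀(c
e^{iπ/4}√z) has boundary values K₀(c√p) at z = -ip and K₀(ic√p) at z = ip, and the real part of the
latter is -(π/2)Y₀(c√p). So the integral equals (2/k) Re K₀(c e^{iπ/4}√k)
(`integral_besselK_sub_besselY`). Since (vK₁)' = -vK₀, the orbit series has derivative 2kT^po(k) for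
k > 0; it vanishes at infinity, hence equals -2∫_s^∞ kT^po(k) dk (`orbitSum_eq_integral`).

Thus on s > 0 the exponential of the orbit series is both Z(s) and the elementary factor times the
determinant. The identity theorem carries the second equality to Re s > 0, and the determinant side
continues Z to the slit plane. -/

theorem integrableOn_exp_neg_Ioi_zero :
    IntegrableOn (fun t : ℝ => Real.exp (-t)) (Ioi 0) := by
  simpa using integrableOn_exp_neg_Ioi 0

/-- The moments `∫_0^∞ exp(-v cosh t) cosh(t)^j dt`. -/
noncomputable def coshMoment (j : ℕ) (v : ℂ) : ℂ :=
  ∫ t in Ioi (0 : ℝ), Complex.exp (-v * Real.cosh t) * (Real.cosh t : ℂ) ^ j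

theorem inv_cosh_le (t : ℝ) : (Real.cosh t)⁻¹ ≤ 2 * Real.exp (-t) := by
  rw [inv_le_comm₀ (Real.cosh_pos t) (by positivity), Real.cosh_eq, mul_inv, Real.exp_neg, inv_inv]
  have := (Real.exp_pos t); have := inv_pos.2 this
  linarith

/-- From e^y ≥ y^m/m! at y = a cosh t: the surplus of m over j leaves at least one factor 1/cosh t,
which is integrable. The free exponent m measures decay in a; with a of order √n, the choice m = 4
later yields n⁻². -/
theorem exp_neg_mul_cosh_mul_pow_le {a : ℝ} (ha : 0 < a) {j m : ℕ} (hm : j + 1 ≤ m) (t : ℝ) :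
    Real.exp (-a * Real.cosh t) * Real.cosh t ^ j ≤
      m.factorial / a ^ m * (2 * Real.exp (-t)) := by
  have hc := Real.cosh_pos t
  have h1 : (a * Real.cosh t) ^ m / m.factorial ≤ Real.exp (a * Real.cosh t) :=
    Real.pow_div_factorial_le_exp _ (by positivity) m
  have h2 : Real.exp (-a * Real.cosh t) ≤ m.factorial / (a * Real.cosh t) ^ m := by
    rw [neg_mul, Real.exp_neg, ← inv_div]
    exact inv_anti₀ (by positivity) h1
  calc Real.exp (-a * Real.cosh t) * Real.cosh t ^ j
      ≤ m.factorial / (a * Real.cosh t) ^ m * Real.cosh t ^ (m - 1) := by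
        refine mul_le_mul h2 (pow_le_pow_right₀ (Real.one_le_cosh t) (by omega)) (by positivity)
          (by positivity)
    _ = m.factorial / a ^ m * (Real.cosh t)⁻¹ := by
        obtain ⟨l, rfl⟩ : ∃ l, m = l + 1 := ⟨m - 1, by omega⟩
        simp only [Nat.add_sub_cancel, mul_pow, pow_succ]
        field_simp
    _ ≤ _ := by gcongr; exact inv_cosh_le t

theorem norm_coshMoment_integrand (j : ℕ) (v : ℂ) (t : ℝ) :
    ‖Complex.exp (-v * Real.cosh t) * (Real.cosh t : ℂ) ^ j‖ =
      Real.exp (-v.re * Real.cosh t) * Real.cosh t ^ j := by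
  rw [norm_mul, Complex.norm_exp, norm_pow, Complex.norm_real, Real.norm_of_nonneg
    (Real.cosh_pos t).le]
  simp

theorem continuous_coshMoment_integrand (j : ℕ) (v : ℂ) :
    Continuous fun t : ℝ => Complex.exp (-v * Real.cosh t) * (Real.cosh t : ℂ) ^ j := by
  have := Real.continuous_cosh
  fun_prop

theorem integrableOn_coshMoment {v : ℂ} (hv : 0 < v.re) (j : ℕ) :
    IntegrableOn (fun t : ℝ => Complex.exp (-v * Real.cosh t) * (Real.cosh t : ℂ) ^ j)
      (Ioi 0) := by
  refine Integrable.mono' ((integrableOn_exp_neg_Ioi_zero.const_mul 2).const_mul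
    ((j + 1).factorial / v.re ^ (j + 1) : ℝ))
    (continuous_coshMoment_integrand j v).aestronglyMeasurable (Eventually.of_forall fun t => ?_)
  rw [norm_coshMoment_integrand]
  exact exp_neg_mul_cosh_mul_pow_le hv le_rfl t

theorem norm_coshMoment_le {v : ℂ} (hv : 0 < v.re) {j m : ℕ} (hm : j + 1 ≤ m) :
    ‖coshMoment j v‖ ≤ 2 * m.factorial / v.re ^ m := by
  have h := norm_integral_le_of_norm_le ((integrableOn_exp_neg_Ioi_zero.const_mul 2).const_mul
    (m.factorial / v.re ^ m : ℝ)) (Eventually.of_forall fun t => by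
      rw [norm_coshMoment_integrand]
      exact exp_neg_mul_cosh_mul_pow_le hv hm t)
  refine h.trans (le_of_eq ?_)
  rw [integral_const_mul, integral_const_mul, integral_exp_neg_Ioi_zero]
  ring

theorem hasDerivAt_coshMoment {v : ℂ} (hv : 0 < v.re) (j : ℕ) :
    HasDerivAt (coshMoment j) (-coshMoment (j + 1) v) v := by
  have hs : {w : ℂ | v.re / 2 < w.re} ∈ 𝓝 v :=
    (isOpen_lt continuous_const Complex.continuous_re).mem_nhds
      (show v.re / 2 < v.re by linarith)
  have h := hasDerivAt_integral_of_dominated_loc_of_deriv_le (𝕜 := ℂ)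
    (μ := volume.restrict (Ioi (0 : ℝ)))
    (F := fun w t => Complex.exp (-w * Real.cosh t) * (Real.cosh t : ℂ) ^ j)
    (F' := fun w t => -(Complex.exp (-w * Real.cosh t) * (Real.cosh t : ℂ) ^ (j + 1)))
    (bound := fun t => (j + 2).factorial / (v.re / 2) ^ (j + 2) * (2 * Real.exp (-t)))
    hs (Eventually.of_forall fun w => (continuous_coshMoment_integrand j w).aestronglyMeasurable)
    (integrableOn_coshMoment hv j)
    (continuous_coshMoment_integrand (j + 1) v).neg.aestronglyMeasurable
    (Eventually.of_forall fun t w hw => ?_)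
    ((integrableOn_exp_neg_Ioi_zero.const_mul 2).const_mul _)
    (Eventually.of_forall fun t w hw => ?_)
  · refine h.2.congr_deriv ?_
    rw [integral_neg]; rfl
  · rw [norm_neg, norm_coshMoment_integrand]
    refine le_trans ?_ (exp_neg_mul_cosh_mul_pow_le (half_pos hv) (j := j + 1) le_rfl t)
    have hc := Real.cosh_pos t
    have : v.re / 2 < w.re := hw
    gcongr
  · have h1 : HasDerivAt (fun w : ℂ => -w * Real.cosh t) (-1 * Real.cosh t) w :=
      ((hasDerivAt_id w).neg).mul_const _
    refine (h1.cexp.mul_const ((Real.cosh t : ℂ) ^ j)).congr_deriv ?_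
    ring

/-- The function sinh t · exp(-v cosh t) vanishes at 0 and at infinity, so its derivative integrates
to zero; cosh² = sinh² + 1 removes sinh. This is the integration by parts behind (vK₁)' = -vK₀. -/
theorem coshMoment_recurrence {v : ℂ} (hv : 0 < v.re) :
    coshMoment 1 v - v * coshMoment 2 v + v * coshMoment 0 v = 0 := by
  have hd : ∀ t : ℝ, HasDerivAt
      (fun t : ℝ => (Real.sinh t : ℂ) * Complex.exp (-v * Real.cosh t))
      (Complex.exp (-v * Real.cosh t) * (Real.cosh t : ℂ) ^ 1 -
        v * (Complex.exp (-v * Real.cosh t) * (Real.cosh t : ℂ) ^ 2) +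
        v * (Complex.exp (-v * Real.cosh t) * (Real.cosh t : ℂ) ^ 0)) t := by
    intro t
    have h1 : HasDerivAt (fun t : ℝ => (Real.sinh t : ℂ)) (Real.cosh t : ℂ) t :=
      (Real.hasDerivAt_sinh t).ofReal_comp
    have h2 : HasDerivAt (fun t : ℝ => (Real.cosh t : ℂ)) (Real.sinh t : ℂ) t :=
      (Real.hasDerivAt_cosh t).ofReal_comp
    refine (h1.mul ((h2.const_mul (-v)).cexp)).congr_deriv ?_
    have h3 : (Real.cosh t : ℂ) ^ 2 = (Real.sinh t : ℂ) ^ 2 + 1 := by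
      exact_mod_cast Real.cosh_sq t
    linear_combination (v * Complex.exp (-v * Real.cosh t)) * h3
  have i0 := (integrableOn_coshMoment hv 0).const_mul v
  have i1 := integrableOn_coshMoment hv 1
  have i2 := (integrableOn_coshMoment hv 2).const_mul v
  have hlim : Tendsto (fun t : ℝ => (Real.sinh t : ℂ) * Complex.exp (-v * Real.cosh t)) atTop
      (𝓝 0) := by
    have hz : Tendsto (fun t : ℝ => (2 : ℕ).factorial / v.re ^ 2 * (2 * Real.exp (-t))) atTop
        (𝓝 0) := by
      have := (Real.tendsto_exp_neg_atTop_nhds_zero.const_mul 2).const_mul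
        ((2 : ℕ).factorial / v.re ^ 2 : ℝ)
      simpa using this
    refine squeeze_zero_norm' ?_ hz
    filter_upwards [eventually_ge_atTop 0] with t ht
    refine le_trans ?_ (exp_neg_mul_cosh_mul_pow_le hv (j := 1) le_rfl t)
    rw [← norm_coshMoment_integrand, norm_mul, norm_mul, mul_comm]
    gcongr
    rw [pow_one, Complex.norm_real, Complex.norm_real, Real.norm_of_nonneg (Real.cosh_pos t).le,
      Real.norm_of_nonneg (Real.sinh_nonneg_iff.2 ht)]
    exact (Real.sinh_lt_cosh t).le
  have key := integral_Ioi_of_hasDerivAt_of_tendsto' (a := 0) (fun t _ => hd t)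
    ((i1.sub i2).add i0) hlim
  simp only [Real.sinh_zero, Complex.ofReal_zero, zero_mul, sub_zero] at key
  have e1 := integral_add (i1.sub i2) i0
  have e2 := integral_sub i1 i2
  simp only [Pi.sub_apply, integral_const_mul] at e1 e2
  rw [e1, e2] at key
  exact key

theorem besselK_zero_eq (v : ℂ) : besselK 0 v = coshMoment 0 v := by
  simp [besselK, coshMoment]

theorem besselK_one_eq (v : ℂ) : besselK 1 v = coshMoment 1 v := by
  simp [besselK, coshMoment]

theorem norm_besselK_zero_le {v : ℂ} (hv : 0 < v.re) {m : ℕ} (hm : 1 ≤ m) :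
    ‖besselK 0 v‖ ≤ 2 * m.factorial / v.re ^ m := by
  rw [besselK_zero_eq]; exact norm_coshMoment_le hv hm

theorem norm_besselK_one_le {v : ℂ} (hv : 0 < v.re) {m : ℕ} (hm : 2 ≤ m) :
    ‖besselK 1 v‖ ≤ 2 * m.factorial / v.re ^ m := by
  rw [besselK_one_eq]; exact norm_coshMoment_le hv hm

theorem differentiableAt_besselK_zero {v : ℂ} (hv : 0 < v.re) :
    DifferentiableAt ℂ (besselK 0) v := by
  rw [funext besselK_zero_eq]
  exact (hasDerivAt_coshMoment hv 0).differentiableAt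

theorem differentiableAt_besselK_one {v : ℂ} (hv : 0 < v.re) :
    DifferentiableAt ℂ (besselK 1) v := by
  rw [funext besselK_one_eq]
  exact (hasDerivAt_coshMoment hv 1).differentiableAt

/-- `(v K₁(v))' = -v K₀(v)`. -/
theorem hasDerivAt_mul_besselK_one {v : ℂ} (hv : 0 < v.re) :
    HasDerivAt (fun w => w * besselK 1 w) (-(v * besselK 0 v)) v := by
  simp only [besselK_one_eq, besselK_zero_eq]
  refine ((hasDerivAt_id v).mul (hasDerivAt_coshMoment hv 1)).congr_deriv ?_
  simp only [id]
  linear_combination coshMoment_recurrence hv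

/-- For positive s this makes the Bessel terms with e^{iπ/4} and e^{-iπ/4} complex conjugate, so
that the orbit series is real there. -/
theorem besselK_conj (j : ℂ) (hj : (starRingEnd ℂ) j = j) (v : ℂ) :
    besselK j ((starRingEnd ℂ) v) = (starRingEnd ℂ) (besselK j v) := by
  rw [besselK, besselK, ← integral_conj]
  congr 1 with t
  rw [map_mul, ← Complex.exp_conj, ← Complex.cosh_conj, map_mul, map_mul, hj,
    Complex.conj_ofReal, Complex.conj_ofReal, map_neg]

theorem hasSum_pnat_iff_of_zero {α : Type*} [AddCommMonoid α] [TopologicalSpace α] {f : ℕ → α} {a : α}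
    (h0 : f 0 = 0) : HasSum (fun n : ℕ+ => f n) a ↔ HasSum f a := by
  refine Function.Injective.hasSum_iff PNat.coe_injective fun n hn => ?_
  have : n = 0 := by
    by_contra h
    exact hn ⟨⟨n, Nat.pos_of_ne_zero h⟩, rfl⟩
  rw [this, h0]

/-! ### Continuation of `K₀` to the closed first quadrant -/

/-- The continuation of `K₀` from the right to the upper half-plane (Schläfli's integral). -/
noncomputable def besselKUpper (v : ℂ) : ℂ :=
  -Complex.I * (∫ θ in (0 : ℝ)..(Real.pi / 2), Complex.exp (-v * Real.cos θ)) +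
    ∫ t in Ioi (0 : ℝ), Complex.exp (Complex.I * v * Real.sinh t)

/-- `cosh (t - i φ)`. -/
noncomputable def coshShift (φ t : ℝ) : ℂ :=
  Real.cosh t * Real.cos φ - Complex.I * (Real.sinh t * Real.sin φ)

/-- `sinh (t - i φ)`. -/
noncomputable def sinhShift (φ t : ℝ) : ℂ :=
  Real.sinh t * Real.cos φ - Complex.I * (Real.cosh t * Real.sin φ)

theorem continuous_coshShift (φ : ℝ) : Continuous (coshShift φ) := by
  have := Real.continuous_cosh; have := Real.continuous_sinh
  unfold coshShift; fun_prop

theorem continuous_sinhShift (φ : ℝ) : Continuous (sinhShift φ) := by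
  have := Real.continuous_cosh; have := Real.continuous_sinh
  unfold sinhShift; fun_prop

theorem hasDerivAt_coshShift_right (φ t : ℝ) :
    HasDerivAt (coshShift φ) (sinhShift φ t) t := by
  have h1 : HasDerivAt (fun t : ℝ => (Real.sinh t : ℂ)) (Real.cosh t : ℂ) t :=
    (Real.hasDerivAt_sinh t).ofReal_comp
  have h2 : HasDerivAt (fun t : ℝ => (Real.cosh t : ℂ)) (Real.sinh t : ℂ) t :=
    (Real.hasDerivAt_cosh t).ofReal_comp
  exact (h2.mul_const _).sub ((h1.mul_const _).const_mul _)

theorem hasDerivAt_coshShift_left (φ t : ℝ) :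
    HasDerivAt (fun φ => coshShift φ t) (-Complex.I * sinhShift φ t) φ := by
  have h1 : HasDerivAt (fun t : ℝ => (Real.sin t : ℂ)) (Real.cos φ : ℂ) φ :=
    (Real.hasDerivAt_sin φ).ofReal_comp
  have h2 : HasDerivAt (fun t : ℝ => (Real.cos t : ℂ)) (-Real.sin φ : ℂ) φ := by
    have := (Real.hasDerivAt_cos φ).ofReal_comp
    simpa using this
  refine ((h2.const_mul (Real.cosh t : ℂ)).sub
    ((h1.const_mul (Real.sinh t : ℂ)).const_mul Complex.I)).congr_deriv ?_
  rw [sinhShift]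
  linear_combination (-(Real.cosh t : ℂ) * Real.sin φ) * Complex.I_sq

/-- Writing cosh t = sinh t + e^{-t} puts the lower bound m next to sinh t; what remains carries
e^{-t} ≤ 1 and is absorbed by the constant e^{Re v + m}. -/
theorem norm_exp_coshShift_le {v : ℂ} (hr : 0 < v.re) {m φ t : ℝ} (hm : 0 ≤ m)
    (hφ : m ≤ v.re * Real.cos φ + v.im * Real.sin φ) (ht : 0 ≤ t) :
    ‖Complex.exp (-v * coshShift φ t)‖ ≤
      Real.exp (v.re + m) * Real.exp (-m * Real.cosh t) := by
  rw [Complex.norm_exp, ← Real.exp_add, Real.exp_le_exp]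
  have e : (-v * coshShift φ t).re =
      -(v.re * (Real.cosh t * Real.cos φ) + v.im * (Real.sinh t * Real.sin φ)) := by
    simp only [coshShift, Complex.mul_re, Complex.neg_re, Complex.sub_re, Complex.ofReal_re,
      Complex.ofReal_im, Complex.I_re, Complex.I_im, Complex.neg_im, Complex.sub_im,
      Complex.mul_im]
    ring
  have h1 : Real.cosh t = Real.sinh t + Real.exp (-t) := by
    rw [Real.cosh_eq, Real.sinh_eq]; ring
  have h2 : Real.exp (-t) ≤ 1 := Real.exp_le_one_iff.2 (by linarith)
  have h3 := Real.sinh_nonneg_iff.2 ht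
  have h4 := Real.neg_one_le_cos φ
  have h5 := mul_le_mul_of_nonneg_left hφ h3
  have h6 : -v.re ≤ v.re * (Real.exp (-t) * Real.cos φ) := by
    have := Real.exp_pos (-t)
    have : -1 ≤ Real.exp (-t) * Real.cos φ := by nlinarith
    nlinarith
  have h7 : m * Real.exp (-t) ≤ m := by nlinarith
  rw [e, h1]
  nlinarith

theorem norm_sinhShift_le (φ : ℝ) {t : ℝ} (ht : 0 ≤ t) :
    ‖sinhShift φ t‖ ≤ 2 * Real.cosh t := by
  refine (norm_sub_le _ _).trans ?_
  rw [norm_mul, norm_mul, norm_mul, Complex.norm_I, Complex.norm_real, Complex.norm_real,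
    Complex.norm_real, Complex.norm_real, one_mul, Real.norm_of_nonneg (Real.cosh_pos t).le,
    Real.norm_of_nonneg (Real.sinh_nonneg_iff.2 ht), Real.norm_eq_abs, Real.norm_eq_abs]
  have h1 := Real.abs_cos_le_one φ
  have h2 := Real.abs_sin_le_one φ
  have h3 := (Real.sinh_lt_cosh t).le
  have h4 := Real.sinh_nonneg_iff.2 ht
  nlinarith [abs_nonneg (Real.cos φ), abs_nonneg (Real.sin φ), Real.cosh_pos t]

/-- Because cos φ + sin φ ≥ 1 on [0, π/2]. It keeps the decay uniform while the contour is rotated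
through a quarter turn. -/
theorem min_le_re_mul_cos_add {v : ℂ} {φ : ℝ} (hr : 0 < v.re) (hi : 0 < v.im)
    (hφ : φ ∈ Icc 0 (Real.pi / 2)) :
    min v.re v.im ≤ v.re * Real.cos φ + v.im * Real.sin φ := by
  have hc := Real.cos_nonneg_of_mem_Icc (show φ ∈ Icc (-(Real.pi / 2)) (Real.pi / 2) from
    ⟨by linarith [hφ.1, Real.pi_pos], hφ.2⟩)
  have hs := Real.sin_nonneg_of_nonneg_of_le_pi hφ.1 (by linarith [hφ.2, Real.pi_pos])
  have h1 : 1 ≤ Real.cos φ + Real.sin φ := by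
    nlinarith [Real.sin_sq_add_cos_sq φ, mul_nonneg hc hs]
  have h0 : 0 ≤ min v.re v.im := (lt_min hr hi).le
  calc min v.re v.im ≤ min v.re v.im * (Real.cos φ + Real.sin φ) := by nlinarith
    _ = min v.re v.im * Real.cos φ + min v.re v.im * Real.sin φ := by ring
    _ ≤ _ := by gcongr <;> simp

theorem integrableOn_cosh_mul_exp {m : ℝ} (hm : 0 < m) (C : ℝ) (j : ℕ) :
    IntegrableOn (fun t : ℝ => C * (Real.exp (-m * Real.cosh t) * Real.cosh t ^ j)) (Ioi 0) := by
  have h := (integrableOn_coshMoment (v := (m : ℂ)) (by simpa using hm) j).norm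
  simp only [norm_coshMoment_integrand, Complex.ofReal_re] at h
  exact h.const_mul C

/-- The integrand is a function of t - iφ, so its φ-derivative is a t-derivative up to the factor
-i. The integral therefore collapses to a boundary term at t = 0. -/
theorem hasDerivAt_integral_coshShift {v : ℂ} (hr : 0 < v.re) (hi : 0 < v.im) {φ : ℝ}
    (hφ : φ ∈ Icc 0 (Real.pi / 2)) :
    HasDerivAt (fun φ => ∫ t in Ioi (0 : ℝ), Complex.exp (-v * coshShift φ t))
      (Complex.I * Complex.exp (-v * Real.cos φ)) φ := by
  set M := min v.re v.im with hM
  have hM0 : 0 < M := lt_min hr hi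
  have hs : {ψ : ℝ | M / 2 < v.re * Real.cos ψ + v.im * Real.sin ψ} ∈ 𝓝 φ := by
    refine (isOpen_lt continuous_const (by fun_prop)).mem_nhds ?_
    have := min_le_re_mul_cos_add hr hi hφ
    show M / 2 < _
    linarith
  have hint : ∀ ψ : ℝ, M / 2 ≤ v.re * Real.cos ψ + v.im * Real.sin ψ →
      IntegrableOn (fun t => Complex.exp (-v * coshShift ψ t)) (Ioi 0) := by
    intro ψ hψ
    refine Integrable.mono' (integrableOn_cosh_mul_exp (half_pos hM0)
      (Real.exp (v.re + M / 2)) 0)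
      (by have := continuous_coshShift ψ; fun_prop) ?_
    refine (ae_restrict_iff' measurableSet_Ioi).2 (Eventually.of_forall fun t ht => ?_)
    simpa using norm_exp_coshShift_le hr (half_pos hM0).le hψ (le_of_lt ht)
  have hb : ∀ ψ : ℝ, M / 2 ≤ v.re * Real.cos ψ + v.im * Real.sin ψ → ∀ t : ℝ, 0 < t →
      ‖Complex.I * v * sinhShift ψ t * Complex.exp (-v * coshShift ψ t)‖ ≤
        (2 * ‖v‖ * Real.exp (v.re + M / 2)) *
          (Real.exp (-(M / 2) * Real.cosh t) * Real.cosh t ^ 1) := by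
    intro ψ hψ t ht
    have h1 := norm_exp_coshShift_le hr (half_pos hM0).le hψ ht.le
    have h2 := norm_sinhShift_le ψ ht.le
    rw [norm_mul, norm_mul, norm_mul, Complex.norm_I, one_mul, pow_one]
    calc ‖v‖ * ‖sinhShift ψ t‖ * ‖Complex.exp (-v * coshShift ψ t)‖
        ≤ ‖v‖ * (2 * Real.cosh t) * (Real.exp (v.re + M / 2) *
          Real.exp (-(M / 2) * Real.cosh t)) := by gcongr
      _ = _ := by ring
  have h := hasDerivAt_integral_of_dominated_loc_of_deriv_le (𝕜 := ℝ)
    (μ := volume.restrict (Ioi (0 : ℝ)))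
    (F := fun ψ t => Complex.exp (-v * coshShift ψ t))
    (F' := fun ψ t => Complex.I * v * sinhShift ψ t * Complex.exp (-v * coshShift ψ t))
    hs (Eventually.of_forall fun ψ => by have := continuous_coshShift ψ; fun_prop)
    (hint φ (mem_of_mem_nhds hs).le)
    (by have := continuous_coshShift φ; have := continuous_sinhShift φ; fun_prop)
    ((ae_restrict_iff' measurableSet_Ioi).2 (Eventually.of_forall fun t ht ψ hψ =>
      hb ψ (le_of_lt hψ) t ht))
    (integrableOn_cosh_mul_exp (half_pos hM0) _ 1)
    (Eventually.of_forall fun t ψ _ => by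
      refine (((hasDerivAt_coshShift_left ψ t).const_mul (-v)).cexp).congr_deriv ?_
      ring)
  refine h.2.congr_deriv ?_
  have hd : ∀ t ∈ Ici (0 : ℝ), HasDerivAt
      (fun t : ℝ => -Complex.I * Complex.exp (-v * coshShift φ t))
      (Complex.I * v * sinhShift φ t * Complex.exp (-v * coshShift φ t)) t := fun t _ => by
    refine ((((hasDerivAt_coshShift_right φ t).const_mul (-v)).cexp).const_mul
      (-Complex.I)).congr_deriv ?_
    ring
  have hlim : Tendsto (fun t : ℝ => -Complex.I * Complex.exp (-v * coshShift φ t)) atTop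
      (𝓝 0) := by
    have hz : Tendsto (fun t : ℝ => Real.exp (v.re + M / 2) *
        ((1 : ℕ).factorial / (M / 2) ^ 1 * (2 * Real.exp (-t)))) atTop (𝓝 0) := by
      have := ((Real.tendsto_exp_neg_atTop_nhds_zero.const_mul 2).const_mul
        ((1 : ℕ).factorial / (M / 2) ^ 1 : ℝ)).const_mul (Real.exp (v.re + M / 2))
      simpa using this
    refine squeeze_zero_norm' ?_ hz
    filter_upwards [eventually_ge_atTop 0] with t ht
    have h1 := norm_exp_coshShift_le hr (half_pos hM0).le (mem_of_mem_nhds hs).le ht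
    rw [norm_mul, norm_neg, Complex.norm_I, one_mul]
    refine h1.trans ?_
    gcongr
    simpa using exp_neg_mul_cosh_mul_pow_le (half_pos hM0) (j := 0) le_rfl t
  rw [integral_Ioi_of_hasDerivAt_of_tendsto' hd h.1 hlim]
  simp [coshShift]

/-- Shifting the contour t ↦ t - iφ from φ = 0 to φ = π/2, and adding the segment swept out at t =
0, gives an expression with zero φ-derivative. Its two ends are the two integral representations. -/
theorem besselK_zero_eq_besselKUpper {v : ℂ} (hr : 0 < v.re) (hi : 0 < v.im) :
    besselK 0 v = besselKUpper v := by
  set f : ℝ → ℂ := fun φ => -Complex.I * (∫ θ in (0 : ℝ)..φ, Complex.exp (-v * Real.cos θ)) +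
    ∫ t in Ioi (0 : ℝ), Complex.exp (-v * coshShift φ t) with hf
  have hd : ∀ φ ∈ Icc 0 (Real.pi / 2), HasDerivAt f 0 φ := by
    intro φ hφ
    have hc : Continuous fun θ : ℝ => Complex.exp (-v * Real.cos θ) := by fun_prop
    have h1 := (hc.integral_hasStrictDerivAt 0 φ).hasDerivAt.const_mul (-Complex.I)
    refine (h1.add (hasDerivAt_integral_coshShift hr hi hφ)).congr_deriv ?_
    ring
  have hp : (0 : ℝ) ≤ Real.pi / 2 := by positivity
  have h := constant_of_derivWithin_zero (f := f) (a := 0) (b := Real.pi / 2)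
    (fun x hx => (hd x hx).differentiableAt.differentiableWithinAt)
    (fun x hx => (hd x ⟨hx.1, hx.2.le⟩).hasDerivWithinAt.derivWithin
      (uniqueDiffOn_Icc (by positivity) x ⟨hx.1, hx.2.le⟩)) (Real.pi / 2) ⟨hp, le_rfl⟩
  have e0 : f 0 = besselK 0 v := by
    simp [hf, besselK, coshShift]
  have e1 : f (Real.pi / 2) = besselKUpper v := by
    simp only [hf, besselKUpper, coshShift, Real.cos_pi_div_two, Real.sin_pi_div_two]
    congr 2 with t
    congr 1
    push_cast
    ring
  rw [← e0, ← e1, h]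

theorem norm_exp_I_mul_sinh_le {v : ℂ} {m t : ℝ} (hm : 0 ≤ m) (hv : m ≤ v.im) (ht : 0 ≤ t) :
    ‖Complex.exp (Complex.I * v * Real.sinh t)‖ ≤ Real.exp (-m * t) := by
  rw [Complex.norm_exp, Real.exp_le_exp]
  have h1 : t ≤ Real.sinh t := Real.self_le_sinh_iff.2 ht
  have e : (Complex.I * v * Real.sinh t).re = -(v.im * Real.sinh t) := by
    simp [-Complex.ofReal_sinh]
  rw [e]
  nlinarith [mul_le_mul hv h1 ht (hm.trans hv)]

theorem integrableOn_exp_neg_mul {m : ℝ} (hm : 0 < m) :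
    IntegrableOn (fun t : ℝ => Real.exp (-m * t)) (Ioi 0) :=
  integrableOn_exp_mul_Ioi (neg_lt_zero.2 hm) 0

theorem continuousAt_besselKUpper {v : ℂ} (hi : 0 < v.im) : ContinuousAt besselKUpper v := by
  refine ContinuousAt.add (continuousAt_const.mul ?_) ?_
  · exact (intervalIntegral.continuous_parametric_intervalIntegral_of_continuous'
      (f := fun (v : ℂ) (θ : ℝ) => Complex.exp (-v * Real.cos θ)) (by fun_prop) 0
      (Real.pi / 2)).continuousAt
  · refine continuousAt_of_dominated (bound := fun t => Real.exp (-(v.im / 2) * t)) ?_ ?_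
      (integrableOn_exp_neg_mul (half_pos hi)) ?_
    · have := Real.continuous_sinh
      exact Eventually.of_forall fun w => by fun_prop
    · have : ∀ᶠ w : ℂ in 𝓝 v, v.im / 2 < w.im :=
        (isOpen_lt continuous_const Complex.continuous_im).mem_nhds
          (show v.im / 2 < v.im by linarith)
      filter_upwards [this] with w hw
      exact (ae_restrict_iff' measurableSet_Ioi).2 (Eventually.of_forall fun t ht =>
        norm_exp_I_mul_sinh_le (half_pos hi).le hw.le (le_of_lt ht))
    · exact Eventually.of_forall fun t => by fun_prop

/-- The segment integral has integrand of modulus at most 1 over length π/2; the tail uses sinh t ≥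
t. -/
theorem norm_besselKUpper_le {v : ℂ} (hr : 0 ≤ v.re) (hi : 0 < v.im) :
    ‖besselKUpper v‖ ≤ Real.pi / 2 + 1 / v.im := by
  refine (norm_add_le _ _).trans (add_le_add ?_ ?_)
  · rw [norm_mul, norm_neg, Complex.norm_I, one_mul]
    refine (intervalIntegral.norm_integral_le_of_norm_le_const (C := 1) ?_).trans ?_
    · intro θ hθ
      rw [uIoc_of_le (by positivity)] at hθ
      rw [Complex.norm_exp, Real.exp_le_one_iff]
      have hc := Real.cos_nonneg_of_mem_Icc (show θ ∈ Icc (-(Real.pi / 2)) (Real.pi / 2) from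
        ⟨by linarith [hθ.1, Real.pi_pos], hθ.2⟩)
      simp only [Complex.mul_re, Complex.neg_re, Complex.ofReal_re, Complex.ofReal_im, mul_zero,
        sub_zero]
      nlinarith
    · rw [sub_zero, one_mul, abs_of_nonneg (by positivity)]
  · refine (norm_integral_le_of_norm_le (integrableOn_exp_neg_mul hi)
      ((ae_restrict_iff' measurableSet_Ioi).2 (Eventually.of_forall fun t ht =>
        norm_exp_I_mul_sinh_le hi.le le_rfl (le_of_lt ht)))).trans ?_
    rw [integral_exp_mul_Ioi (neg_lt_zero.2 hi)]
    simp [one_div]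

/-- `Y₀(x) = -(2/π) Re K₀(ix)`. -/
theorem besselY0_eq (x : ℝ) :
    besselY0 x = -(2 / Real.pi) * (besselKUpper (Complex.I * x)).re := by
  have h1 : ∫ θ in (0 : ℝ)..Real.pi, Real.sin (x * Real.sin θ) =
      2 * ∫ θ in (0 : ℝ)..(Real.pi / 2), Real.sin (x * Real.cos θ) := by
    have hc : Continuous fun θ : ℝ => Real.sin (x * Real.sin θ) := by fun_prop
    rw [← intervalIntegral.integral_add_adjacent_intervals (b := Real.pi / 2)
      (hc.intervalIntegrable _ _) (hc.intervalIntegrable _ _), two_mul]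
    congr 1
    · have := intervalIntegral.integral_comp_sub_left
        (fun θ => Real.sin (x * Real.sin θ)) (a := 0) (b := Real.pi / 2) (Real.pi / 2)
      simpa [Real.sin_pi_div_two_sub] using this.symm
    · have := intervalIntegral.integral_comp_add_right
        (fun θ => Real.sin (x * Real.sin θ)) (a := 0) (b := Real.pi / 2) (Real.pi / 2)
      simp only [Real.sin_add_pi_div_two, zero_add, add_halves] at this
      exact this.symm
  have h2 : (-Complex.I * (∫ θ in (0 : ℝ)..(Real.pi / 2),
      Complex.exp (-(Complex.I * x) * Real.cos θ))).re =
      -∫ θ in (0 : ℝ)..(Real.pi / 2), Real.sin (x * Real.cos θ) := by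
    rw [← intervalIntegral.integral_const_mul, ← intervalIntegral.integral_neg,
      intervalIntegral.integral_of_le (by positivity), intervalIntegral.integral_of_le
      (by positivity), ← RCLike.re_eq_complex_re, ← integral_re]
    · congr 1 with θ
      have : -(Complex.I * x) * Real.cos θ = ((-(x * Real.cos θ) : ℝ) : ℂ) * Complex.I := by
        push_cast; ring
      rw [this, Complex.exp_mul_I, ← Complex.ofReal_cos, ← Complex.ofReal_sin]
      simp [-Complex.ofReal_cos, -Complex.ofReal_sin, -Complex.ofReal_mul, -Complex.ofReal_neg]
    · have hc : Continuous fun θ : ℝ =>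
        -Complex.I * Complex.exp (-(Complex.I * x) * Real.cos θ) := by fun_prop
      exact (hc.intervalIntegrable 0 (Real.pi / 2)).1
  have h3 : (∫ t in Ioi (0 : ℝ), Complex.exp (Complex.I * (Complex.I * x) * Real.sinh t)).re =
      ∫ t in Ioi (0 : ℝ), Real.exp (-x * Real.sinh t) := by
    have : ∀ t : ℝ, Complex.exp (Complex.I * (Complex.I * x) * Real.sinh t) =
        (Real.exp (-x * Real.sinh t) : ℂ) := by
      intro t
      rw [← mul_assoc, Complex.I_mul_I]
      push_cast
      ring_nf
    simp only [this]
    rw [integral_complex_ofReal, Complex.ofReal_re]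
  rw [besselY0, besselKUpper, Complex.add_re, h2, h3, h1]
  have := Real.pi_ne_zero
  field_simp
  ring

/-! ### The Poisson integral of the right half-plane -/

/-- The Cayley transform `w ↦ k (1 - w) / (1 + w)` of the unit disc onto the right half-plane. -/
noncomputable def cayley (k : ℝ) (w : ℂ) : ℂ := k * ((1 - w) / (1 + w))

theorem one_add_ne_zero_of_norm_lt {w : ℂ} (hw : ‖w‖ < 1) : 1 + w ≠ 0 := by
  intro h
  have : w = -1 := by linear_combination h
  rw [this, norm_neg, norm_one] at hw
  exact lt_irrefl _ hw

theorem cayley_re (k : ℝ) (w : ℂ) :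
    (cayley k w).re = k * ((1 - ‖w‖ ^ 2) / Complex.normSq (1 + w)) := by
  rw [cayley, Complex.re_ofReal_mul, Complex.div_re, ← add_div, ← Complex.normSq_eq_norm_sq]
  congr 2
  simp only [Complex.normSq_apply, Complex.add_re, Complex.sub_re, Complex.one_re, Complex.add_im,
    Complex.sub_im, Complex.one_im]
  ring

/-- Uniformity in the radius r is the point: a singularity |z|^{-1/2} at z = 0 becomes the
integrable majorant |θ|^{-1/2} on all circles at once. Jordan's inequality gives |e^{iθ} - 1| ≥
2|θ|/π, and |e^{iθ} - 1| ≤ 2|1 - re^{iθ}|. -/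
theorem norm_cayley_exp_ge {k : ℝ} (hk : 0 < k) {r θ : ℝ} (hr : 0 ≤ r) (hr1 : r ≤ 1)
    (hθ : |θ| ≤ Real.pi) (hne : 1 + circleMap 0 r θ ≠ 0) :
    k / (2 * Real.pi) * |θ| ≤ ‖cayley k (circleMap 0 r θ)‖ := by
  set e : ℂ := Complex.exp (θ * Complex.I) with he
  have hce : circleMap 0 r θ = r * e := by simp [circleMap, he]
  have hne1 : ‖e‖ = 1 := Complex.norm_exp_ofReal_mul_I θ
  have h1 : 2 / Real.pi * |θ| ≤ ‖e - 1‖ := by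
    rw [he, mul_comm (θ : ℂ), Complex.norm_exp_I_mul_ofReal_sub_one, norm_mul, Real.norm_eq_abs,
      Real.norm_eq_abs, abs_two]
    have := Real.mul_abs_le_abs_sin (x := θ / 2) (by rw [abs_div, abs_two]; linarith)
    rw [abs_div, abs_two] at this
    linarith
  have h2 : ‖e - 1‖ ≤ 2 * ‖1 - r * e‖ := by
    have a1 : ‖e - 1‖ ≤ ‖r * e - 1‖ + (1 - r) := by
      have : e - 1 = (r * e - 1) + ((1 - r : ℝ) : ℂ) * e := by push_cast; ring
      rw [this]
      refine (norm_add_le _ _).trans ?_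
      rw [norm_mul, hne1, mul_one, Complex.norm_real, Real.norm_of_nonneg (by linarith)]
    have a2 : 1 - r ≤ ‖1 - r * e‖ := by
      have := norm_sub_norm_le (1 : ℂ) (r * e)
      rwa [norm_mul, hne1, mul_one, Complex.norm_real, Real.norm_of_nonneg hr, norm_one] at this
    rw [norm_sub_rev] at a2
    rw [norm_sub_rev 1]
    linarith
  have h3 : ‖1 + r * e‖ ≤ 2 := by
    refine (norm_add_le _ _).trans ?_
    rw [norm_mul, hne1, mul_one, Complex.norm_real, Real.norm_of_nonneg hr, norm_one]
    linarith
  rw [hce] at hne ⊢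
  have h4 : 0 < ‖1 + r * e‖ := norm_pos_iff.2 hne
  rw [cayley, norm_mul, norm_div, Complex.norm_real, Real.norm_of_nonneg hk.le, div_mul_eq_mul_div,
    mul_div_assoc]
  refine mul_le_mul_of_nonneg_left ?_ hk.le
  rw [div_le_div_iff₀ (by positivity) h4]
  have h5 := Real.pi_pos
  have h6 : 2 * |θ| ≤ ‖e - 1‖ * Real.pi := by
    rw [div_mul_eq_mul_div, div_le_iff₀ h5] at h1; exact h1
  nlinarith [abs_nonneg θ]

theorem exp_two_arctan (x : ℝ) :
    Complex.exp (((2 * Real.arctan x : ℝ) : ℂ) * Complex.I) =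
      (1 + x * Complex.I) / (1 - x * Complex.I) := by
  have h1 : (1 + (x : ℂ) * Complex.I) ≠ 0 := fun h => by simpa using congrArg Complex.re h
  have h2 : (1 - (x : ℂ) * Complex.I) ≠ 0 := fun h => by simpa using congrArg Complex.re h
  have hs : (Real.sqrt (1 + x ^ 2) : ℂ) ^ 2 = 1 + (x : ℂ) ^ 2 := by
    have := Real.sq_sqrt (show 0 ≤ 1 + x ^ 2 by positivity)
    exact_mod_cast this
  have hs0 : (Real.sqrt (1 + x ^ 2) : ℂ) ≠ 0 := by
    have : (0 : ℝ) < Real.sqrt (1 + x ^ 2) := by positivity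
    exact_mod_cast this.ne'
  have h3 : Complex.exp ((Real.arctan x : ℂ) * Complex.I) =
      (1 + x * Complex.I) / Real.sqrt (1 + x ^ 2) := by
    rw [Complex.exp_mul_I, ← Complex.ofReal_cos, ← Complex.ofReal_sin, Real.cos_arctan,
      Real.sin_arctan]
    push_cast
    field_simp
  have h4 : ((2 * Real.arctan x : ℝ) : ℂ) * Complex.I =
      (Real.arctan x : ℂ) * Complex.I + (Real.arctan x : ℂ) * Complex.I := by push_cast; ring
  rw [h4, Complex.exp_add, h3]
  field_simp
  rw [hs]
  linear_combination (-(x : ℂ) ^ 2) * Complex.I_sq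

theorem cayley_exp_two_arctan {k : ℝ} (hk : 0 < k) (p : ℝ) :
    cayley k (circleMap 0 1 (2 * Real.arctan (p / k))) = -(p * Complex.I) := by
  have hk' : (k : ℂ) ≠ 0 := by exact_mod_cast hk.ne'
  have h2 : (1 - ((p / k : ℝ) : ℂ) * Complex.I) ≠ 0 :=
    fun h => by simpa using congrArg Complex.re h
  have hc : circleMap 0 1 (2 * Real.arctan (p / k)) =
      (1 + ((p / k : ℝ) : ℂ) * Complex.I) / (1 - ((p / k : ℝ) : ℂ) * Complex.I) := by
    rw [← exp_two_arctan]; simp [circleMap]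
  have e1 : 1 - (1 + ((p / k : ℝ) : ℂ) * Complex.I) / (1 - ((p / k : ℝ) : ℂ) * Complex.I) =
      (-2 * ((p / k : ℝ) : ℂ) * Complex.I) / (1 - ((p / k : ℝ) : ℂ) * Complex.I) := by
    field_simp; ring
  have e2 : 1 + (1 + ((p / k : ℝ) : ℂ) * Complex.I) / (1 - ((p / k : ℝ) : ℂ) * Complex.I) =
      2 / (1 - ((p / k : ℝ) : ℂ) * Complex.I) := by
    field_simp; ring
  rw [cayley, hc, e1, e2, div_div_div_cancel_right₀ h2]
  push_cast
  field_simp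

theorem image_two_arctan {k : ℝ} (hk : 0 < k) :
    (fun p : ℝ => 2 * Real.arctan (p / k)) '' univ = Ioo (-Real.pi) Real.pi := by
  ext θ
  simp only [image_univ, mem_range, mem_Ioo]
  constructor
  · rintro ⟨p, rfl⟩
    constructor <;> linarith [Real.neg_pi_div_two_lt_arctan (p / k), Real.arctan_lt_pi_div_two (p / k)]
  · rintro ⟨h1, h2⟩
    refine ⟨k * Real.tan (θ / 2), ?_⟩
    rw [mul_div_cancel_left₀ _ hk.ne', Real.arctan_tan (by linarith) (by linarith)]
    ring

/-- Pull f back to the disc by the Cayley transform, use the mean value property at the centre on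
circles of radius r < 1, and let r → 1 by dominated convergence. The substitution θ = 2 arctan(p/k)
turns dθ into 2k dp/(p² + k²). -/
theorem poisson_integral_rightHalfPlane {f : ℂ → ℂ} {A B k : ℝ} (hk : 0 < k)
    (hB : 0 ≤ B)
    (hd : ∀ z : ℂ, 0 < z.re → DifferentiableAt ℂ f z)
    (hc : ∀ z : ℂ, z ≠ 0 → 0 ≤ z.re → ContinuousWithinAt f {w | 0 ≤ w.re} z)
    (hb : ∀ z : ℂ, z ≠ 0 → 0 ≤ z.re → ‖f z‖ ≤ A + B * ‖z‖ ^ (-(1 / 2) : ℝ)) :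
    Integrable (fun p : ℝ => f (-(p * Complex.I)) / ((p ^ 2 + k ^ 2 : ℝ) : ℂ)) ∧
      ∫ p : ℝ, f (-(p * Complex.I)) / ((p ^ 2 + k ^ 2 : ℝ) : ℂ) = Real.pi / k * f k := by
  have hpi := Real.pi_pos
  -- the mean value property on smaller circles
  have hmean : ∀ r ∈ Ioo (0 : ℝ) 1,
      ∫ θ in (-Real.pi)..Real.pi, f (cayley k (circleMap 0 r θ)) = 2 * Real.pi * f k := by
    intro r hr
    have hball : ∀ w ∈ Metric.closedBall (0 : ℂ) |r|, ‖w‖ < 1 := by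
      intro w hw
      rw [mem_closedBall_zero_iff, abs_of_pos hr.1] at hw
      exact hw.trans_lt hr.2
    have hdiff : ∀ w ∈ Metric.closedBall (0 : ℂ) |r|,
        DifferentiableAt ℂ (fun w => f (cayley k w)) w := by
      intro w hw
      have hw1 := hball w hw
      have hne := one_add_ne_zero_of_norm_lt hw1
      refine DifferentiableAt.comp w (hd _ ?_) ?_
      · rw [cayley_re]
        have : 0 < Complex.normSq (1 + w) := Complex.normSq_pos.2 hne
        have : 0 < 1 - ‖w‖ ^ 2 := by nlinarith [norm_nonneg w]
        positivity
      · unfold cayley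
        fun_prop (disch := exact hne)
    have h1 := circleAverage_of_differentiable_on_off_countable (s := ∅) (c := 0) (R := r)
      (f := fun w => f (cayley k w)) countable_empty
      (fun w hw => (hdiff w hw).continuousAt.continuousWithinAt)
      (fun w hw => hdiff w (Metric.ball_subset_closedBall hw.1))
    rw [Real.circleAverage_eq_integral_add (-Real.pi)] at h1
    have h2 := intervalIntegral.integral_comp_add_right
      (fun θ => f (cayley k (circleMap 0 r θ))) (a := 0) (b := 2 * Real.pi) (-Real.pi)
    rw [h2] at h1
    have e0 : cayley k 0 = k := by simp [cayley]
    rw [e0, show 0 + -Real.pi = -Real.pi by ring, show 2 * Real.pi + -Real.pi = Real.pi by ring]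
      at h1
    rw [← h1, Complex.real_smul, ← mul_assoc]
    push_cast
    rw [mul_inv_cancel₀ (by exact_mod_cast (by positivity : (2 * Real.pi : ℝ) ≠ 0)), one_mul]
  -- domination
  set bound : ℝ → ℝ := fun θ =>
    A + B * ((k / (2 * Real.pi)) ^ (-(1 / 2) : ℝ) * ‖(θ : ℂ) ^ ((-(1 / 2) : ℝ) : ℂ)‖) with hbound
  have hbound_int : IntervalIntegrable bound volume (-Real.pi) Real.pi := by
    refine intervalIntegrable_const.add (((IntervalIntegrable.norm ?_).const_mul _).const_mul _)
    exact intervalIntegral.intervalIntegrable_cpow' (by norm_num)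
  have hfb : ∀ z : ℂ, ∀ θ : ℝ, θ ≠ 0 → 0 ≤ z.re → k / (2 * Real.pi) * |θ| ≤ ‖z‖ →
      ‖f z‖ ≤ bound θ := by
    intro z θ hθ hz h
    have h0 : 0 < k / (2 * Real.pi) * |θ| := by positivity
    refine (hb z (norm_pos_iff.1 (h0.trans_le h)) hz).trans ?_
    have := Real.rpow_le_rpow_of_nonpos h0 h (show (-(1 / 2) : ℝ) ≤ 0 by norm_num)
    rw [Real.mul_rpow (by positivity) (abs_nonneg _)] at this
    simp only [hbound, Complex.norm_cpow_real, Complex.norm_real, Real.norm_eq_abs]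
    gcongr
  -- These angles correspond to z = 0, where f may be singular, and to z = ∞.
  have hae : ∀ᵐ θ : ℝ, θ ≠ 0 ∧ θ ≠ Real.pi := by
    have h1 : ∀ᵐ θ : ℝ, θ ≠ 0 := by simp [ae_iff, measure_singleton]
    have h2 : ∀ᵐ θ : ℝ, θ ≠ Real.pi := by simp [ae_iff, measure_singleton]
    exact h1.and h2
  have hne1 : ∀ θ : ℝ, θ ∈ Ioo (-Real.pi) Real.pi → 1 + circleMap 0 1 θ ≠ 0 := by
    intro θ hθ
    rw [← image_two_arctan hk] at hθ
    obtain ⟨p, -, rfl⟩ := hθ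
    have h2 : (1 - ((p / k : ℝ) : ℂ) * Complex.I) ≠ 0 :=
      fun h => by simpa using congrArg Complex.re h
    have : circleMap 0 1 (2 * Real.arctan (p / k)) =
        (1 + ((p / k : ℝ) : ℂ) * Complex.I) / (1 - ((p / k : ℝ) : ℂ) * Complex.I) := by
      rw [← exp_two_arctan]; simp [circleMap]
    simp only [this]
    have e2 : 1 + (1 + ((p / k : ℝ) : ℂ) * Complex.I) / (1 - ((p / k : ℝ) : ℂ) * Complex.I) =
        2 / (1 - ((p / k : ℝ) : ℂ) * Complex.I) := by
      field_simp; ring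
    rw [e2]
    exact div_ne_zero two_ne_zero h2
  have hnorm : ∀ r : ℝ, 0 ≤ r → ∀ θ : ℝ, ‖circleMap 0 r θ‖ = r := by
    intro r hr θ; rw [norm_circleMap_zero, abs_of_nonneg hr]
  have hre : ∀ r : ℝ, 0 ≤ r → r ≤ 1 → ∀ θ : ℝ, 0 ≤ (cayley k (circleMap 0 r θ)).re := by
    intro r hr hr1 θ
    rw [cayley_re, hnorm r hr]
    have : 0 ≤ 1 - r ^ 2 := by nlinarith
    have := Complex.normSq_nonneg (1 + circleMap 0 r θ)
    positivity
  have hlt : ∀ᶠ r : ℝ in 𝓝[<] 1, r ∈ Ioo (0 : ℝ) 1 := Ioo_mem_nhdsLT one_pos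
  have hpt : ∀ θ : ℝ, θ ≠ 0 → θ ∈ Ioo (-Real.pi) Real.pi →
      Tendsto (fun r : ℝ => f (cayley k (circleMap 0 r θ))) (𝓝[<] 1)
        (𝓝 (f (cayley k (circleMap 0 1 θ)))) := by
    intro θ hθ0 hθ
    have hne := hne1 θ hθ
    have hz : cayley k (circleMap 0 1 θ) ≠ 0 := by
      have := norm_cayley_exp_ge hk zero_le_one le_rfl (abs_le.2 ⟨hθ.1.le, hθ.2.le⟩) hne
      refine norm_pos_iff.1 (lt_of_lt_of_le ?_ this)
      positivity
    have hcont : ContinuousAt (fun r : ℝ => cayley k (circleMap 0 r θ)) 1 := by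
      have : Continuous fun r : ℝ => circleMap 0 r θ := by unfold circleMap; fun_prop
      unfold cayley
      fun_prop (disch := exact hne)
    refine (hc _ hz (hre 1 zero_le_one le_rfl θ)).tendsto.comp ?_
    refine tendsto_nhdsWithin_iff.2 ⟨hcont.tendsto.mono_left nhdsWithin_le_nhds, ?_⟩
    filter_upwards [hlt] with r hr using hre r hr.1.le hr.2.le θ
  have hmeas : ∀ᶠ r : ℝ in 𝓝[<] 1, AEStronglyMeasurable
      (fun θ : ℝ => f (cayley k (circleMap 0 r θ))) (volume.restrict (uIoc (-Real.pi) Real.pi)) := by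
    filter_upwards [hlt] with r hr
    refine Continuous.aestronglyMeasurable (continuous_iff_continuousAt.2 fun θ => ?_)
    have hw : ‖circleMap 0 r θ‖ < 1 := by rw [hnorm r hr.1.le]; exact hr.2
    have hne := one_add_ne_zero_of_norm_lt hw
    have h1 : ContinuousAt (fun θ : ℝ => cayley k (circleMap 0 r θ)) θ := by
      have := continuous_circleMap 0 r
      unfold cayley
      fun_prop (disch := exact hne)
    refine ContinuousAt.comp (g := f) (hd _ ?_).continuousAt h1
    rw [cayley_re]
    have : 0 < Complex.normSq (1 + circleMap 0 r θ) := Complex.normSq_pos.2 hne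
    have : 0 < 1 - ‖circleMap 0 r θ‖ ^ 2 := by nlinarith [norm_nonneg (circleMap 0 r θ)]
    positivity
  have hmem : ∀ θ : ℝ, θ ≠ Real.pi → θ ∈ uIoc (-Real.pi) Real.pi →
      θ ∈ Ioo (-Real.pi) Real.pi := by
    intro θ h1 h2
    rw [uIoc_of_le (by linarith)] at h2
    exact ⟨h2.1, lt_of_le_of_ne h2.2 h1⟩
  have hlim := intervalIntegral.tendsto_integral_filter_of_dominated_convergence
    (μ := volume) (a := -Real.pi) (b := Real.pi) (l := 𝓝[<] (1 : ℝ))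
    (F := fun r θ => f (cayley k (circleMap 0 r θ)))
    (f := fun θ => f (cayley k (circleMap 0 1 θ))) bound hmeas
    (by
      filter_upwards [hlt] with r hr
      filter_upwards [hae] with θ hθ hθm
      have hm := hmem θ hθ.2 hθm
      exact hfb _ θ hθ.1 (hre r hr.1.le hr.2.le θ) (norm_cayley_exp_ge hk hr.1.le hr.2.le
        (abs_le.2 ⟨hm.1.le, hm.2.le⟩) (one_add_ne_zero_of_norm_lt (by
          rw [hnorm r hr.1.le]; exact hr.2))))
    hbound_int
    (by
      filter_upwards [hae] with θ hθ hθm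
      exact hpt θ hθ.1 (hmem θ hθ.2 hθm))
  have hval : ∫ θ in (-Real.pi)..Real.pi, f (cayley k (circleMap 0 1 θ)) =
      2 * Real.pi * f k := by
    refine tendsto_nhds_unique hlim (tendsto_const_nhds.congr' ?_)
    filter_upwards [hlt] with r hr using (hmean r hr).symm
  have hinteg : IntegrableOn (fun θ => f (cayley k (circleMap 0 1 θ)))
      (Ioo (-Real.pi) Real.pi) := by
    have hm : AEStronglyMeasurable (fun θ : ℝ => f (cayley k (circleMap 0 1 θ)))
        (volume.restrict (uIoc (-Real.pi) Real.pi)) := by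
      -- The boundary function is measurable as an a.e. limit along a sequence of radii; shifting by
      -- N skips the radii where measurability is not yet known.
      obtain ⟨u, hu⟩ := exists_seq_tendsto (𝓝[<] (1 : ℝ))
      have hu' := hu.eventually hmeas
      obtain ⟨N, hN⟩ := eventually_atTop.1 hu'
      refine aestronglyMeasurable_of_tendsto_ae atTop (fun n => hN (n + N) (by omega)) ?_
      refine (ae_restrict_iff' measurableSet_uIoc).2 ?_
      filter_upwards [hae] with θ hθ hθm
      exact (hpt θ hθ.1 (hmem θ hθ.2 hθm)).comp (hu.comp (tendsto_add_atTop_nat N))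
    refine IntegrableOn.mono_set (t := uIoc (-Real.pi) Real.pi) ?_ (by
      rw [uIoc_of_le (by linarith)]; exact Ioo_subset_Ioc_self)
    have hbi : IntegrableOn bound (uIoc (-Real.pi) Real.pi) := by
      rw [intervalIntegrable_iff] at hbound_int; exact hbound_int
    refine Integrable.mono' hbi hm ?_
    refine (ae_restrict_iff' measurableSet_uIoc).2 ?_
    filter_upwards [hae] with θ hθ hθm
    have hm := hmem θ hθ.2 hθm
    exact hfb _ θ hθ.1 (hre 1 zero_le_one le_rfl θ) (norm_cayley_exp_ge hk zero_le_one le_rfl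
        (abs_le.2 ⟨hm.1.le, hm.2.le⟩) (hne1 θ hm))
  -- change of variables
  have hderiv : ∀ p ∈ (univ : Set ℝ), HasDerivWithinAt (fun p : ℝ => 2 * Real.arctan (p / k))
      (2 * k / (p ^ 2 + k ^ 2)) univ p := by
    intro p _
    have := ((Real.hasDerivAt_arctan (p / k)).comp p ((hasDerivAt_id p).div_const k)).const_mul 2
    refine (this.congr_deriv ?_).hasDerivWithinAt
    field_simp
    ring
  have hinj : InjOn (fun p : ℝ => 2 * Real.arctan (p / k)) univ := by
    intro p _ q _ h
    have h' : Real.arctan (p / k) = Real.arctan (q / k) := by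
      have : 2 * Real.arctan (p / k) = 2 * Real.arctan (q / k) := h
      linarith
    exact (div_left_inj' hk.ne').1 (Real.arctan_injective h')
  have hfun : (fun p : ℝ => |2 * k / (p ^ 2 + k ^ 2)| •
      f (cayley k (circleMap 0 1 (2 * Real.arctan (p / k))))) =
      fun p : ℝ => (2 * k : ℂ) * (f (-(p * Complex.I)) / ((p ^ 2 + k ^ 2 : ℝ) : ℂ)) := by
    ext p
    rw [cayley_exp_two_arctan hk, abs_of_pos (by positivity), Complex.real_smul]
    push_cast
    ring
  have h2k : (2 * k : ℂ) ≠ 0 := by exact_mod_cast (by positivity : (2 * k : ℝ) ≠ 0)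
  have hk' : (k : ℂ) ≠ 0 := by exact_mod_cast hk.ne'
  constructor
  · have h := (integrableOn_image_iff_integrableOn_abs_deriv_smul MeasurableSet.univ hderiv hinj
      (fun θ => f (cayley k (circleMap 0 1 θ)))).1 (by rw [image_two_arctan hk]; exact hinteg)
    rw [hfun, integrableOn_univ] at h
    exact (integrable_const_mul_iff (IsUnit.mk0 _ h2k) _).1 h
  · have h := integral_image_eq_integral_abs_deriv_smul MeasurableSet.univ hderiv hinj
      (fun θ => f (cayley k (circleMap 0 1 θ)))
    rw [image_two_arctan hk, ← integral_Ioc_eq_integral_Ioo, ← intervalIntegral.integral_of_le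
      (by linarith), hval, hfun, setIntegral_univ, integral_const_mul] at h
    have := mul_left_cancel₀ h2k (h.symm.trans
      (show (2 * Real.pi * f k : ℂ) = 2 * k * (Real.pi / k * f k) by field_simp))
    exact this

/-! ### The Poisson integral of `K₀(c √z)` -/

/-- The closed first quadrant. -/
def closedQuadrant : Set ℂ := {v | 0 ≤ v.re ∧ 0 ≤ v.im}

open Classical in
/-- The continuous extension of `K₀` to the closed first quadrant without the origin. -/
noncomputable def besselKQuadrant (v : ℂ) : ℂ :=
  if 0 < v.re then besselK 0 v else besselKUpper v

theorem besselKQuadrant_of_re_pos {v : ℂ} (hv : 0 < v.re) : besselKQuadrant v = besselK 0 v :=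
  if_pos hv

theorem besselKQuadrant_of_im_pos {v : ℂ} (hr : 0 ≤ v.re) (hi : 0 < v.im) :
    besselKQuadrant v = besselKUpper v := by
  rcases hr.lt_or_eq with h | h
  · rw [besselKQuadrant_of_re_pos h, besselK_zero_eq_besselKUpper h hi]
  · exact if_neg (by rw [← h]; exact lt_irrefl _)

theorem re_pos_or_im_pos {v : ℂ} (hv : v ∈ closedQuadrant) (h0 : v ≠ 0) :
    0 < v.re ∨ 0 < v.im := by
  by_contra! h
  exact h0 (Complex.ext (le_antisymm h.1 hv.1) (le_antisymm h.2 hv.2))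

/-- Away from the origin the quadrant is covered by the open sets Re v > 0 and Im v > 0, and on each
of them a single formula is valid. -/
theorem continuousWithinAt_besselKQuadrant {v : ℂ} (hv : v ∈ closedQuadrant) (h0 : v ≠ 0) :
    ContinuousWithinAt besselKQuadrant closedQuadrant v := by
  rcases re_pos_or_im_pos hv h0 with h | h
  · refine (ContinuousAt.congr (differentiableAt_besselK_zero h).continuousAt
      ?_).continuousWithinAt
    filter_upwards [(isOpen_lt continuous_const Complex.continuous_re).mem_nhds h] with w hw
    exact (besselKQuadrant_of_re_pos hw).symm
  · refine ContinuousWithinAt.congr_of_eventuallyEq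
      (continuousAt_besselKUpper h).continuousWithinAt ?_ (besselKQuadrant_of_im_pos hv.1 h)
    filter_upwards [self_mem_nhdsWithin, mem_nhdsWithin_of_mem_nhds
      ((isOpen_lt continuous_const Complex.continuous_im).mem_nhds h)] with w hw hw'
    exact besselKQuadrant_of_im_pos hw.1 hw'

/-- The larger of Re v and Im v is at least |v|/2. The bound is far from the true logarithmic
singularity, but with v proportional to √z it is only |z|^{-1/2}, which the Poisson formula
tolerates. -/
theorem norm_besselKQuadrant_le {v : ℂ} (hv : v ∈ closedQuadrant) (h0 : v ≠ 0) :
    ‖besselKQuadrant v‖ ≤ Real.pi / 2 + 4 / ‖v‖ := by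
  have hpos : 0 < ‖v‖ := norm_pos_iff.2 h0
  have hle := Complex.norm_le_abs_re_add_abs_im v
  rw [abs_of_nonneg hv.1, abs_of_nonneg hv.2] at hle
  by_cases h : v.im ≤ v.re
  · have hr : 0 < v.re := by linarith
    rw [besselKQuadrant_of_re_pos hr]
    have h1 := norm_besselK_zero_le hr (m := 1) le_rfl
    have h2 : 2 * ((1 : ℕ).factorial : ℝ) / v.re ^ 1 ≤ 4 / ‖v‖ := by
      rw [pow_one, div_le_div_iff₀ hr hpos]
      simp only [Nat.factorial_one, Nat.cast_one]
      linarith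
    linarith [Real.pi_pos]
  · push Not at h
    have hi : 0 < v.im := by linarith [hv.1]
    rw [besselKQuadrant_of_im_pos hv.1 hi]
    have h1 := norm_besselKUpper_le hv.1 hi
    have h2 : 1 / v.im ≤ 4 / ‖v‖ := by
      rw [div_le_div_iff₀ hi hpos]
      linarith
    linarith

/-! ### Square roots rotated by e^{±iπ/4}. -/

/-- The unit complex number of argument `π / 4`. -/
noncomputable def expQuarter : ℂ := Complex.exp (Real.pi / 4 * Complex.I)

theorem expQuarter_eq : expQuarter = (Real.sqrt 2 / 2 : ℝ) * (1 + Complex.I) := by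
  rw [expQuarter, show (Real.pi / 4 * Complex.I : ℂ) = ((Real.pi / 4 : ℝ) : ℂ) * Complex.I by
    push_cast; ring, Complex.exp_mul_I, ← Complex.ofReal_cos, ← Complex.ofReal_sin,
    Real.cos_pi_div_four, Real.sin_pi_div_four]
  ring

theorem norm_expQuarter : ‖expQuarter‖ = 1 := by
  rw [expQuarter, show (Real.pi / 4 * Complex.I : ℂ) = ((Real.pi / 4 : ℝ) : ℂ) * Complex.I by
    push_cast; ring]
  exact Complex.norm_exp_ofReal_mul_I _

theorem expQuarter_ne_zero : expQuarter ≠ 0 := Complex.exp_ne_zero _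

theorem conj_expQuarter : (starRingEnd ℂ) expQuarter = Complex.exp (-(Real.pi / 4 * Complex.I)) := by
  rw [expQuarter, ← Complex.exp_conj]
  congr 1
  rw [map_mul, Complex.conj_I, map_div₀, Complex.conj_ofReal, Complex.conj_ofNat]
  ring

theorem mul_expQuarter_re_im (z : ℂ) :
    (expQuarter * z).re = Real.sqrt 2 / 2 * (z.re - z.im) ∧
      (expQuarter * z).im = Real.sqrt 2 / 2 * (z.re + z.im) := by
  rw [expQuarter_eq, mul_assoc, Complex.re_ofReal_mul, Complex.im_ofReal_mul]
  constructor
  · simp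
  · simp
    ring

theorem sqrt_re_im {z : ℂ} (hz0 : z ≠ 0) :
    (z ^ (1 / 2 : ℂ)).re = Real.sqrt ‖z‖ * Real.cos (z.arg / 2) ∧
      (z ^ (1 / 2 : ℂ)).im = Real.sqrt ‖z‖ * Real.sin (z.arg / 2) := by
  have hn : 0 < ‖z‖ := norm_pos_iff.2 hz0
  have h : z ^ (1 / 2 : ℂ) = (Real.sqrt ‖z‖ : ℂ) *
      Complex.exp (((z.arg / 2 : ℝ) : ℂ) * Complex.I) := by
    rw [Complex.cpow_def_of_ne_zero hz0, Complex.log, Real.sqrt_eq_rpow, Real.rpow_def_of_pos hn]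
    push_cast
    rw [← Complex.exp_add]
    congr 1
    ring
  rw [h, Complex.re_ofReal_mul, Complex.im_ofReal_mul, Complex.exp_ofReal_mul_I_re,
    Complex.exp_ofReal_mul_I_im]
  exact ⟨rfl, rfl⟩

/-- In terms of the half argument, cos(arg z) = cos² - sin², so a sign of Re z compares sine and
cosine. It confines √z to the sector |arg| ≤ π/4, hence e^{iπ/4}√z to the closed first quadrant. -/
theorem abs_sqrt_im_le {z : ℂ} (hz : 0 ≤ z.re) :
    |(z ^ (1 / 2 : ℂ)).im| ≤ (z ^ (1 / 2 : ℂ)).re ∧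
      (0 < z.re → |(z ^ (1 / 2 : ℂ)).im| < (z ^ (1 / 2 : ℂ)).re) := by
  by_cases h0 : z = 0
  · subst h0
    simp
  have hn : 0 < Real.sqrt ‖z‖ := Real.sqrt_pos.2 (norm_pos_iff.2 h0)
  obtain ⟨h1, h2⟩ := sqrt_re_im h0
  have ha : |z.arg| ≤ Real.pi / 2 := Complex.abs_arg_le_pi_div_two_iff.2 hz
  obtain ⟨a1, a2⟩ := abs_le.1 ha
  have hpi := Real.pi_pos
  have hc : 0 < Real.cos (z.arg / 2) :=
    Real.cos_pos_of_mem_Ioo ⟨by linarith, by linarith⟩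
  have hcos : Real.cos z.arg = Real.cos (z.arg / 2) ^ 2 - Real.sin (z.arg / 2) ^ 2 := by
    rw [← Real.cos_two_mul']; congr 1; ring
  rw [h1, h2, abs_mul, abs_of_pos hn]
  constructor
  · gcongr
    refine abs_le_of_sq_le_sq ?_ hc.le
    have : 0 ≤ Real.cos z.arg := Real.cos_nonneg_of_mem_Icc ⟨a1, a2⟩
    linarith
  · intro hz'
    refine mul_lt_mul_of_pos_left ?_ hn
    refine abs_lt_of_sq_lt_sq ?_ hc.le
    have := abs_lt.1 (Complex.abs_arg_lt_pi_div_two_iff.2 (Or.inl hz'))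
    have : 0 < Real.cos z.arg := Real.cos_pos_of_mem_Ioo ⟨this.1, this.2⟩
    linarith

theorem norm_sqrt (z : ℂ) : ‖z ^ (1 / 2 : ℂ)‖ = ‖z‖ ^ (1 / 2 : ℝ) := by
  rw [show (1 / 2 : ℂ) = ((1 / 2 : ℝ) : ℂ) by norm_num, Complex.norm_cpow_real]

theorem mem_slitPlane_of_re_nonneg {z : ℂ} (h0 : z ≠ 0) (hz : 0 ≤ z.re) :
    z ∈ Complex.slitPlane := by
  rw [Complex.mem_slitPlane_iff]
  rcases hz.lt_or_eq with h | h
  · exact Or.inl h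
  · exact Or.inr fun h' => h0 (Complex.ext h.symm h')

theorem ofReal_sqrt_eq {x : ℝ} (hx : 0 ≤ x) : ((x : ℂ)) ^ (1 / 2 : ℂ) = (Real.sqrt x : ℂ) := by
  rw [Real.sqrt_eq_rpow, Complex.ofReal_cpow hx]
  norm_num

theorem expQuarter_sq : expQuarter ^ 2 = Complex.I := by
  rw [expQuarter_eq, mul_pow, ← Complex.ofReal_pow, div_pow, Real.sq_sqrt (by norm_num)]
  push_cast
  linear_combination (1 / 2 : ℂ) * Complex.I_sq

theorem sqrt_ofReal_mul {p : ℝ} (hp : 0 < p) (z : ℂ) :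
    ((p : ℂ) * z) ^ (1 / 2 : ℂ) = Real.sqrt p * z ^ (1 / 2 : ℂ) := by
  by_cases hz : z = 0
  · simp [hz]
  have hp' : (p : ℂ) ≠ 0 := by exact_mod_cast hp.ne'
  rw [← ofReal_sqrt_eq hp.le, Complex.cpow_def_of_ne_zero (mul_ne_zero hp' hz),
    Complex.cpow_def_of_ne_zero hp', Complex.cpow_def_of_ne_zero hz, ← Complex.exp_add,
    Complex.log_ofReal_mul hp hz, ← Complex.ofReal_log hp.le]
  ring_nf

theorem sqrt_I : Complex.I ^ (1 / 2 : ℂ) = expQuarter := by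
  rw [Complex.cpow_def_of_ne_zero Complex.I_ne_zero, Complex.log_I, expQuarter]
  ring_nf

theorem sqrt_neg_I : (-Complex.I) ^ (1 / 2 : ℂ) = (starRingEnd ℂ) expQuarter := by
  rw [Complex.cpow_def_of_ne_zero (neg_ne_zero.2 Complex.I_ne_zero), Complex.log_neg_I,
    conj_expQuarter]
  ring_nf

theorem expQuarter_mul_conj : expQuarter * (starRingEnd ℂ) expQuarter = 1 := by
  rw [Complex.mul_conj, Complex.normSq_eq_norm_sq, norm_expQuarter]
  simp

theorem sqrt_neg_I_mul {p : ℝ} (hp : 0 < p) :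
    expQuarter * (-(p * Complex.I)) ^ (1 / 2 : ℂ) = (Real.sqrt p : ℂ) := by
  rw [show (-(p * Complex.I) : ℂ) = (p : ℂ) * (-Complex.I) by ring, sqrt_ofReal_mul hp, sqrt_neg_I]
  linear_combination (Real.sqrt p : ℂ) * expQuarter_mul_conj

theorem sqrt_I_mul {p : ℝ} (hp : 0 < p) :
    expQuarter * (p * Complex.I) ^ (1 / 2 : ℂ) = Complex.I * (Real.sqrt p : ℂ) := by
  rw [sqrt_ofReal_mul hp, sqrt_I]
  linear_combination (Real.sqrt p : ℂ) * expQuarter_sq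

theorem expQuarter_mul_sqrt_mem {z : ℂ} (hz : 0 ≤ z.re) {c : ℝ} (hc : 0 ≤ c) :
    c * (expQuarter * z ^ (1 / 2 : ℂ)) ∈ closedQuadrant := by
  obtain ⟨h1, h2⟩ := mul_expQuarter_re_im (z ^ (1 / 2 : ℂ))
  obtain ⟨h3, h4⟩ := abs_le.1 (abs_sqrt_im_le hz).1
  constructor
  · rw [Complex.re_ofReal_mul, h1]
    have : 0 ≤ (z ^ (1 / 2 : ℂ)).re - (z ^ (1 / 2 : ℂ)).im := by linarith
    positivity
  · rw [Complex.im_ofReal_mul, h2]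
    have : 0 ≤ (z ^ (1 / 2 : ℂ)).re + (z ^ (1 / 2 : ℂ)).im := by linarith
    positivity

theorem expQuarter_mul_sqrt_re_pos {z : ℂ} (hz : 0 < z.re) {c : ℝ} (hc : 0 < c) :
    0 < (c * (expQuarter * z ^ (1 / 2 : ℂ))).re := by
  obtain ⟨h1, -⟩ := mul_expQuarter_re_im (z ^ (1 / 2 : ℂ))
  obtain ⟨-, h4⟩ := abs_lt.1 ((abs_sqrt_im_le hz.le).2 hz)
  rw [Complex.re_ofReal_mul, h1]
  have : 0 < (z ^ (1 / 2 : ℂ)).re - (z ^ (1 / 2 : ℂ)).im := by linarith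
  positivity

/-- The Poisson formula for z ↦ K₀(c e^{iπ/4}√z), which maps the closed right half-plane into the
closed first quadrant, where K₀ has been extended. -/
theorem integral_besselKQuadrant {c k : ℝ} (hc : 0 < c) (hk : 0 < k) :
    Integrable (fun p : ℝ => besselKQuadrant (c * (expQuarter * (-(p * Complex.I)) ^ (1 / 2 : ℂ))) /
      ((p ^ 2 + k ^ 2 : ℝ) : ℂ)) ∧
    ∫ p : ℝ, besselKQuadrant (c * (expQuarter * (-(p * Complex.I)) ^ (1 / 2 : ℂ))) /
      ((p ^ 2 + k ^ 2 : ℝ) : ℂ) = Real.pi / k * besselK 0 (c * (expQuarter * Real.sqrt k)) := by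
  have hc' : (c : ℂ) ≠ 0 := by exact_mod_cast hc.ne'
  have hne : ∀ z : ℂ, z ≠ 0 → c * (expQuarter * z ^ (1 / 2 : ℂ)) ≠ 0 := fun z hz =>
    mul_ne_zero hc' (mul_ne_zero expQuarter_ne_zero (by simp [Complex.cpow_eq_zero_iff, hz]))
  have hcont : ∀ z : ℂ, z ∈ Complex.slitPlane →
      DifferentiableAt ℂ (fun z : ℂ => c * (expQuarter * z ^ (1 / 2 : ℂ))) z := fun z hz =>
    ((differentiableAt_id.cpow_const hz).const_mul _).const_mul _
  have h := poisson_integral_rightHalfPlane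
    (f := fun z => besselKQuadrant (c * (expQuarter * z ^ (1 / 2 : ℂ))))
    (A := Real.pi / 2) (B := 4 / c) hk (by positivity) ?_ ?_ ?_
  · refine ⟨h.1, h.2.trans ?_⟩
    have hre := expQuarter_mul_sqrt_re_pos (z := (k : ℂ)) (by simpa using hk) hc
    rw [besselKQuadrant_of_re_pos hre, ofReal_sqrt_eq hk.le]
  · intro z hz
    have hre := expQuarter_mul_sqrt_re_pos hz hc
    have h1 : DifferentiableAt ℂ (fun z : ℂ => besselK 0 (c * (expQuarter * z ^ (1 / 2 : ℂ)))) z :=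
      DifferentiableAt.comp z (g := besselK 0) (differentiableAt_besselK_zero hre)
        (hcont z (Or.inl hz))
    refine h1.congr_of_eventuallyEq ?_
    filter_upwards [(isOpen_lt continuous_const Complex.continuous_re).mem_nhds hz] with w hw
    exact besselKQuadrant_of_re_pos (expQuarter_mul_sqrt_re_pos hw hc)
  · intro z hz0 hz
    exact ContinuousWithinAt.comp (f := fun z : ℂ => c * (expQuarter * z ^ (1 / 2 : ℂ)))
      (continuousWithinAt_besselKQuadrant (expQuarter_mul_sqrt_mem hz hc.le) (hne z hz0))
      (hcont z (mem_slitPlane_of_re_nonneg hz0 hz)).continuousAt.continuousWithinAt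
      (fun w hw => expQuarter_mul_sqrt_mem hw hc.le)
  · intro z hz0 hz
    refine (norm_besselKQuadrant_le (expQuarter_mul_sqrt_mem hz hc.le) (hne z hz0)).trans ?_
    rw [norm_mul, norm_mul, norm_expQuarter, one_mul, norm_sqrt, Complex.norm_real,
      Real.norm_of_nonneg hc.le, Real.rpow_neg (norm_nonneg z), div_mul_eq_div_div,
      div_eq_mul_inv (4 / c)]

/-- Take the real part of the Poisson integral and fold the line at p = 0. At z = -ip the rotated
root is √p and gives K₀; at z = ip it is i√p and gives -(π/2)Y₀. -/
theorem integral_besselK_sub_besselY {c k : ℝ} (hc : 0 < c) (hk : 0 < k) :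
    IntegrableOn (fun p : ℝ => (2 / Real.pi * (besselK 0 ((c * Real.sqrt p : ℝ) : ℂ)).re -
      besselY0 (c * Real.sqrt p)) / (p ^ 2 + k ^ 2)) (Ioi 0) ∧
    ∫ p in Ioi (0 : ℝ), (2 / Real.pi * (besselK 0 ((c * Real.sqrt p : ℝ) : ℂ)).re -
      besselY0 (c * Real.sqrt p)) / (p ^ 2 + k ^ 2) =
      2 / k * (besselK 0 (c * (expQuarter * Real.sqrt k))).re := by
  obtain ⟨hi, hv⟩ := integral_besselKQuadrant hc hk
  set F : ℝ → ℂ := fun p => besselKQuadrant (c * (expQuarter * (-(p * Complex.I)) ^ (1 / 2 : ℂ))) /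
      ((p ^ 2 + k ^ 2 : ℝ) : ℂ) with hF
  have hpi := Real.pi_pos
  have hpos : ∀ p : ℝ, 0 < p → (F p).re = (besselK 0 ((c * Real.sqrt p : ℝ) : ℂ)).re /
      (p ^ 2 + k ^ 2) := by
    intro p hp
    have : 0 < ((c * Real.sqrt p : ℝ) : ℂ).re := by
      rw [Complex.ofReal_re]; positivity
    simp only [hF]
    rw [sqrt_neg_I_mul hp, ← Complex.ofReal_mul, besselKQuadrant_of_re_pos this,
      Complex.div_ofReal_re]
  have hneg : ∀ p : ℝ, 0 < p → (F (-p)).re = -(Real.pi / 2) * besselY0 (c * Real.sqrt p) /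
      (p ^ 2 + k ^ 2) := by
    intro p hp
    have him : 0 < (Complex.I * ((c * Real.sqrt p : ℝ) : ℂ)).im := by
      rw [Complex.I_mul_im, Complex.ofReal_re]; positivity
    have hre : 0 ≤ (Complex.I * ((c * Real.sqrt p : ℝ) : ℂ)).re := by
      rw [Complex.I_mul_re, Complex.ofReal_im, neg_zero]
    simp only [hF]
    rw [show (-(((-p : ℝ) : ℂ) * Complex.I)) = p * Complex.I by push_cast; ring, sqrt_I_mul hp,
      show (c : ℂ) * (Complex.I * (Real.sqrt p : ℂ)) =
        Complex.I * ((c * Real.sqrt p : ℝ) : ℂ) by push_cast; ring,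
      besselKQuadrant_of_im_pos hre him, Complex.div_ofReal_re, besselY0_eq]
    field_simp
  have hir : Integrable (fun p => (F p).re) := hi.re
  have hir' : Integrable (fun p => (F (-p)).re) := hir.comp_neg
  have hEq : EqOn (fun p : ℝ => (2 / Real.pi * (besselK 0 ((c * Real.sqrt p : ℝ) : ℂ)).re -
      besselY0 (c * Real.sqrt p)) / (p ^ 2 + k ^ 2))
      (fun p => 2 / Real.pi * ((F p).re + (F (-p)).re)) (Ioi 0) := by
    intro p hp
    simp only
    rw [hpos p hp, hneg p hp]
    field_simp
    ring
  refine ⟨IntegrableOn.congr_fun ((hir.integrableOn.add hir'.integrableOn).const_mul (2 / Real.pi))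
    hEq.symm measurableSet_Ioi, ?_⟩
  rw [setIntegral_congr_fun measurableSet_Ioi hEq, integral_const_mul,
    integral_add hir.integrableOn hir'.integrableOn,
    integral_comp_neg_Ioi (f := fun p => (F p).re), neg_zero, add_comm,
    intervalIntegral.integral_Iic_add_Ioi hir.integrableOn hir.integrableOn]
  have : ∫ p, (F p).re = (∫ p, F p).re := by
    have := integral_re hi
    simpa using this
  rw [this, hv, show ((Real.pi : ℂ) / k) = ((Real.pi / k : ℝ) : ℂ) by push_cast; ring,
    Complex.re_ofReal_mul]
  field_simp

/-! ### The Laplace transform of the second derivative of `exp (-1 / u)` -/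

theorem eqOn_re_pos_of_eq_ofReal {f h : ℂ → ℂ} (hf : ∀ z : ℂ, 0 < z.re → DifferentiableAt ℂ f z)
    (hh : ∀ z : ℂ, 0 < z.re → DifferentiableAt ℂ h z) (heq : ∀ x : ℝ, 0 < x → f x = h x) {z : ℂ}
    (hz : 0 < z.re) : f z = h z := by
  have hU : IsOpen {z : ℂ | 0 < z.re} := isOpen_lt continuous_const Complex.continuous_re
  have hf' : AnalyticOnNhd ℂ f {z : ℂ | 0 < z.re} :=
    DifferentiableOn.analyticOnNhd (fun z hz => (hf z hz).differentiableWithinAt) hU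
  have hh' : AnalyticOnNhd ℂ h {z : ℂ | 0 < z.re} :=
    DifferentiableOn.analyticOnNhd (fun z hz => (hh z hz).differentiableWithinAt) hU
  refine hf'.eqOn_of_preconnected_of_frequently_eq hh' (convex_halfSpace_re_gt 0).isPreconnected
    (z₀ := 1) (by simp) ?_ hz
  -- Real points accumulating at 1 but different from it are enough for the identity theorem.
  have hu : Tendsto (fun n : ℕ => ((1 + 1 / ((n : ℝ) + 1) : ℝ) : ℂ)) atTop (𝓝[≠] 1) := by
    refine tendsto_nhdsWithin_iff.2 ⟨?_, Eventually.of_forall fun n => ?_⟩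
    · have := (tendsto_one_div_add_atTop_nhds_zero_nat (𝕜 := ℝ)).const_add 1
      rw [add_zero] at this
      exact (Complex.continuous_ofReal.tendsto 1).comp this
    · have : (0 : ℝ) < 1 / ((n : ℝ) + 1) := by positivity
      intro h
      have h' := Complex.ofReal_injective ((mem_singleton_iff.1 h).trans Complex.ofReal_one.symm)
      linarith
  refine hu.frequently (Frequently.of_forall fun n => heq _ (by positivity))

/-- The first derivative of `expNegInvGlue`. -/
noncomputable def glueDeriv (u : ℝ) : ℝ := u⁻¹ ^ 2 * expNegInvGlue u

/-- The second derivative of `expNegInvGlue`. -/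
noncomputable def glueDeriv2 (u : ℝ) : ℝ := (u⁻¹ ^ 4 - 2 * u⁻¹ ^ 3) * expNegInvGlue u

/-- The extension of e^{-1/u} by zero is smooth on all of ℝ, so every boundary term at u = 0
vanishes without a limiting argument. -/
theorem hasDerivAt_expNegInvGlue (u : ℝ) : HasDerivAt expNegInvGlue (glueDeriv u) u := by
  have := expNegInvGlue.hasDerivAt_polynomial_eval_inv_mul 1 u
  simpa [glueDeriv] using this

theorem hasDerivAt_glueDeriv (u : ℝ) : HasDerivAt glueDeriv (glueDeriv2 u) u := by
  have := expNegInvGlue.hasDerivAt_polynomial_eval_inv_mul (Polynomial.X ^ 2) u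
  simp only [Polynomial.eval_mul, Polynomial.eval_sub, Polynomial.eval_pow, Polynomial.eval_X,
    Polynomial.derivative_X_pow, Polynomial.eval_C] at this
  refine this.congr_deriv ?_
  rw [glueDeriv2]
  push_cast
  ring

theorem continuous_glueDeriv2 : Continuous glueDeriv2 := by
  have := expNegInvGlue.continuous_polynomial_eval_inv_mul
    (Polynomial.X ^ 4 - 2 * Polynomial.X ^ 3)
  refine this.congr fun x => ?_
  simp [glueDeriv2]

theorem continuous_expNegInvGlue : Continuous expNegInvGlue :=
  continuous_iff_continuousAt.2 fun u => (hasDerivAt_expNegInvGlue u).continuousAt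

theorem expNegInvGlue_le_one (u : ℝ) : expNegInvGlue u ≤ 1 := by
  unfold expNegInvGlue
  split_ifs with h
  · norm_num
  · push Not at h
    rw [Real.exp_le_one_iff]
    have := inv_pos.2 h
    linarith

theorem expNegInvGlue_of_pos {u : ℝ} (hu : 0 < u) : expNegInvGlue u = Real.exp (-u⁻¹) :=
  if_neg (not_le.2 hu)

theorem integrableOn_glueDeriv2 : IntegrableOn glueDeriv2 (Ioi 0) := by
  rw [← Ioc_union_Ioi_eq_Ioi zero_le_one]
  refine IntegrableOn.union ?_ ?_
  · exact (continuous_glueDeriv2.integrableOn_Icc (a := 0) (b := 1)).mono_set Ioc_subset_Icc_self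
  · have h : IntegrableOn (fun u : ℝ => 3 * u ^ (-2 : ℝ)) (Ioi 1) :=
      (integrableOn_Ioi_rpow_of_lt (by norm_num) one_pos).const_mul 3
    refine Integrable.mono' h continuous_glueDeriv2.aestronglyMeasurable
      ((ae_restrict_iff' measurableSet_Ioi).2 (Eventually.of_forall fun u hu => ?_))
    have hu' : 1 < u := hu
    have hi : 0 < u⁻¹ := inv_pos.2 (by linarith)
    have hi1 : u⁻¹ ≤ 1 := inv_le_one_of_one_le₀ hu'.le
    rw [Real.rpow_neg (by linarith), Real.rpow_two, ← inv_pow, glueDeriv2, norm_mul,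
      Real.norm_of_nonneg (expNegInvGlue.nonneg u)]
    have h1 : ‖u⁻¹ ^ 4 - 2 * u⁻¹ ^ 3‖ ≤ 3 * u⁻¹ ^ 2 := by
      have e4 : u⁻¹ ^ 4 ≤ u⁻¹ ^ 2 := pow_le_pow_of_le_one hi.le hi1 (by norm_num)
      have e3 : u⁻¹ ^ 3 ≤ u⁻¹ ^ 2 := pow_le_pow_of_le_one hi.le hi1 (by norm_num)
      have p4 := pow_pos hi 4
      have p3 := pow_pos hi 3
      rw [Real.norm_eq_abs, abs_le]
      constructor <;> linarith
    calc _ ≤ 3 * u⁻¹ ^ 2 * 1 := by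
          exact mul_le_mul h1 (expNegInvGlue_le_one u) (expNegInvGlue.nonneg u) (by positivity)
      _ = _ := mul_one _

theorem tendsto_glueDeriv_atTop : Tendsto glueDeriv atTop (𝓝 0) := by
  have h : Tendsto (fun u : ℝ => u⁻¹ ^ 2) atTop (𝓝 0) := by
    have := (tendsto_inv_atTop_zero (𝕜 := ℝ)).pow 2
    simpa using this
  refine squeeze_zero (fun u => ?_) (fun u => ?_) h
  · exact mul_nonneg (by positivity) (expNegInvGlue.nonneg u)
  · exact mul_le_of_le_one_right (by positivity) (expNegInvGlue_le_one u)

/-- The first derivative vanishes at both ends. This later removes the constant mode of the Fourier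
series in the trapezoidal error. -/
theorem integral_glueDeriv2 : ∫ u in Ioi (0 : ℝ), glueDeriv2 u = 0 := by
  rw [integral_Ioi_of_hasDerivAt_of_tendsto' (fun u _ => hasDerivAt_glueDeriv u)
    integrableOn_glueDeriv2 tendsto_glueDeriv_atTop]
  simp [glueDeriv]

theorem norm_exp_neg_mul_le_one {z : ℂ} (hz : 0 ≤ z.re) {u : ℝ} (hu : 0 ≤ u) :
    ‖Complex.exp (-z * u)‖ ≤ 1 := by
  rw [Complex.norm_exp, Real.exp_le_one_iff]
  simp only [Complex.mul_re, Complex.neg_re, Complex.ofReal_re, Complex.ofReal_im, mul_zero,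
    sub_zero]
  nlinarith

theorem integrableOn_exp_mul_expNegInvGlue {z : ℂ} (hz : 0 < z.re) :
    IntegrableOn (fun u : ℝ => Complex.exp (-z * u) * (expNegInvGlue u : ℂ)) (Ioi 0) := by
  have := continuous_expNegInvGlue
  refine Integrable.mono' (integrableOn_exp_neg_mul hz) (by fun_prop) ?_
  refine Eventually.of_forall fun u => ?_
  rw [norm_mul, Complex.norm_exp, Complex.norm_real, Real.norm_of_nonneg (expNegInvGlue.nonneg u)]
  refine (mul_le_of_le_one_right (Real.exp_pos _).le (expNegInvGlue_le_one u)).trans (le_of_eq ?_)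
  simp

theorem norm_exp_mul_glueDeriv2_le {z : ℂ} (hz : 0 ≤ z.re) {u : ℝ} (hu : 0 ≤ u) :
    ‖Complex.exp (-z * u) * (glueDeriv2 u : ℂ)‖ ≤ ‖glueDeriv2 u‖ := by
  rw [norm_mul, Complex.norm_real]
  exact mul_le_of_le_one_left (norm_nonneg _) (norm_exp_neg_mul_le_one hz hu)

theorem integrableOn_exp_mul_glueDeriv2 {z : ℂ} (hz : 0 ≤ z.re) :
    IntegrableOn (fun u : ℝ => Complex.exp (-z * u) * (glueDeriv2 u : ℂ)) (Ioi 0) := by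
  have := continuous_glueDeriv2
  refine Integrable.mono' integrableOn_glueDeriv2.norm (by fun_prop) ?_
  exact (ae_restrict_iff' measurableSet_Ioi).2 (Eventually.of_forall fun u hu =>
    norm_exp_mul_glueDeriv2_le hz (le_of_lt hu))

/-- The Laplace transform of the second derivative of `exp (-1 / u)`. -/
noncomputable def glueLaplace (z : ℂ) : ℂ :=
  ∫ u in Ioi (0 : ℝ), Complex.exp (-z * u) * (glueDeriv2 u : ℂ)

/-- Two integrations by parts, performed at once with the primitive e^{-zu}(g' + zg). -/
theorem glueLaplace_eq {z : ℂ} (hz : 0 < z.re) :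
    glueLaplace z = z ^ 2 * ∫ u in Ioi (0 : ℝ), Complex.exp (-z * u) * (expNegInvGlue u : ℂ) := by
  have hd : ∀ u ∈ Ici (0 : ℝ), HasDerivAt
      (fun u : ℝ => Complex.exp (-z * u) * ((glueDeriv u : ℂ) + z * (expNegInvGlue u : ℂ)))
      (Complex.exp (-z * u) * (glueDeriv2 u : ℂ) -
        z ^ 2 * (Complex.exp (-z * u) * (expNegInvGlue u : ℂ))) u := by
    intro u _
    have h1 : HasDerivAt (fun u : ℝ => (u : ℂ)) 1 u := Complex.ofRealCLM.hasDerivAt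
    have h2 := (hasDerivAt_glueDeriv u).ofReal_comp
    have h3 := (hasDerivAt_expNegInvGlue u).ofReal_comp
    refine ((h1.const_mul (-z)).cexp.mul (h2.add (h3.const_mul z))).congr_deriv ?_
    simp only [Pi.add_apply]
    ring
  have i1 := integrableOn_exp_mul_glueDeriv2 hz.le
  have i2 := (integrableOn_exp_mul_expNegInvGlue hz).const_mul (z ^ 2)
  have hlim : Tendsto (fun u : ℝ => Complex.exp (-z * u) *
      ((glueDeriv u : ℂ) + z * (expNegInvGlue u : ℂ))) atTop (𝓝 0) := by
    have h0 : Tendsto (fun u : ℝ => Real.exp (-(z.re * u)) * (1 + ‖z‖)) atTop (𝓝 0) := by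
      have := (Real.tendsto_exp_neg_atTop_nhds_zero.comp
        (tendsto_id.const_mul_atTop hz)).mul_const (1 + ‖z‖)
      simpa using this
    refine squeeze_zero_norm' ?_ h0
    have h1 : ∀ᶠ u in atTop, glueDeriv u < 1 :=
      tendsto_glueDeriv_atTop.eventually_lt_const one_pos
    filter_upwards [h1] with u hu
    rw [norm_mul, Complex.norm_exp]
    have e : (-z * u).re = -(z.re * u) := by simp
    rw [e]
    gcongr
    refine (norm_add_le _ _).trans (add_le_add ?_ ?_)
    · rw [Complex.norm_real, Real.norm_of_nonneg (show 0 ≤ glueDeriv u from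
        mul_nonneg (by positivity) (expNegInvGlue.nonneg u))]
      exact hu.le
    · rw [norm_mul, Complex.norm_real, Real.norm_of_nonneg (expNegInvGlue.nonneg u)]
      exact mul_le_of_le_one_right (norm_nonneg _) (expNegInvGlue_le_one u)
  have h := integral_Ioi_of_hasDerivAt_of_tendsto' hd (i1.sub i2) hlim
  rw [integral_sub i1 i2, integral_const_mul] at h
  simp only [glueDeriv, expNegInvGlue.zero] at h
  simp only [mul_zero, Complex.ofReal_zero, add_zero, sub_zero] at h
  exact sub_eq_zero.1 h

/-- Here lies the reason for transforming the second derivative: it is absolutely integrable, so the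
transform extends continuously to the imaginary axis, whereas e^{-1/u} itself tends to 1. -/
theorem continuousWithinAt_glueLaplace {z : ℂ} :
    ContinuousWithinAt glueLaplace {w | 0 ≤ w.re} z := by
  have := continuous_glueDeriv2
  refine continuousWithinAt_of_dominated (bound := fun u => ‖glueDeriv2 u‖)
    (Eventually.of_forall fun w => by fun_prop) ?_ integrableOn_glueDeriv2.norm
    (Eventually.of_forall fun u => by fun_prop)
  filter_upwards [self_mem_nhdsWithin] with w hw
  exact (ae_restrict_iff' measurableSet_Ioi).2 (Eventually.of_forall fun u hu =>
    norm_exp_mul_glueDeriv2_le hw (le_of_lt hu))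

theorem mul_exp_neg_mul_le {m : ℝ} (hm : 0 < m) (u : ℝ) :
    u * Real.exp (-m * u) ≤ 1 / m := by
  rw [neg_mul, Real.exp_neg, ← div_eq_mul_inv, div_le_div_iff₀ (Real.exp_pos _) hm, one_mul]
  have := Real.add_one_le_exp (m * u)
  linarith [mul_comm m u]

theorem differentiableAt_glueLaplace {z : ℂ} (hz : 0 < z.re) :
    DifferentiableAt ℂ glueLaplace z := by
  have hc := continuous_glueDeriv2
  have hs : {w : ℂ | z.re / 2 < w.re} ∈ 𝓝 z :=
    (isOpen_lt continuous_const Complex.continuous_re).mem_nhds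
      (show z.re / 2 < z.re by linarith)
  have h := hasDerivAt_integral_of_dominated_loc_of_deriv_le (𝕜 := ℂ)
    (μ := volume.restrict (Ioi (0 : ℝ)))
    (F := fun w u => Complex.exp (-w * u) * (glueDeriv2 u : ℂ))
    (F' := fun w u => Complex.exp (-w * u) * (-1 * u) * (glueDeriv2 u : ℂ))
    (bound := fun u => 1 / (z.re / 2) * ‖glueDeriv2 u‖)
    hs (Eventually.of_forall fun w => by fun_prop) (integrableOn_exp_mul_glueDeriv2 hz.le)
    (by fun_prop)
    ((ae_restrict_iff' measurableSet_Ioi).2 (Eventually.of_forall fun u hu w hw => ?_))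
    (integrableOn_glueDeriv2.norm.const_mul _)
    (Eventually.of_forall fun u w hw => ?_)
  · exact h.2.differentiableAt
  · have hu' : 0 < u := hu
    have hw' : z.re / 2 < w.re := hw
    rw [norm_mul, norm_mul, Complex.norm_exp, norm_mul, norm_neg, norm_one, one_mul,
      Complex.norm_real, Complex.norm_real, Real.norm_of_nonneg hu'.le]
    gcongr
    have e : (-w * u).re = -w.re * u := by simp
    rw [e, mul_comm]
    refine le_trans ?_ (mul_exp_neg_mul_le (half_pos hz) u)
    gcongr
  · have h1 : HasDerivAt (fun w : ℂ => -w * u) (-1 * u) w := ((hasDerivAt_id w).neg).mul_const _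
    exact h1.cexp.mul_const _

/-! ### Identification of the Laplace transform with K₁. -/

theorem integrable_exp_neg_cosh_mul_exp {x : ℝ} (hx : 0 < x) :
    Integrable (fun t : ℝ => Real.exp (-x * Real.cosh t) * Real.exp t) := by
  have hc := Real.continuous_cosh
  have hpos : IntegrableOn (fun t : ℝ => Real.exp (-x * Real.cosh t) * Real.exp t) (Ioi 0) := by
    refine Integrable.mono' (integrableOn_cosh_mul_exp hx 2 1) (by fun_prop)
      (Eventually.of_forall fun t => ?_)
    rw [Real.norm_of_nonneg (by positivity), Real.cosh_eq]
    have := Real.exp_pos (-x * ((Real.exp t + Real.exp (-t)) / 2))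
    have := Real.exp_pos (-t)
    have : Real.exp t ≤ 2 * ((Real.exp t + Real.exp (-t)) / 2) := by linarith
    calc _ ≤ Real.exp (-x * ((Real.exp t + Real.exp (-t)) / 2)) *
          (2 * ((Real.exp t + Real.exp (-t)) / 2)) := by gcongr
      _ = _ := by ring
  have hneg : IntegrableOn (fun t : ℝ => Real.exp (-x * Real.cosh t) * Real.exp t) (Iic 0) := by
    rw [← integrableOn_Ici_iff_integrableOn_Ioi] at hpos
    have h2 : IntegrableOn (fun t : ℝ => Real.exp (-x * Real.cosh t) * Real.exp (-t)) (Ici 0) := by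
      refine Integrable.mono' hpos (by fun_prop)
        ((ae_restrict_iff' measurableSet_Ici).2 (Eventually.of_forall fun t ht => ?_))
      have ht' : (0 : ℝ) ≤ t := ht
      rw [Real.norm_of_nonneg (by positivity)]
      gcongr
      linarith
    have h3 := (IntegrableOn.comp_neg (s := Ici (0 : ℝ)) h2)
    simpa using h3
  rw [← integrableOn_univ, ← Iic_union_Ioi (a := (0 : ℝ))]
  exact hneg.union hpos

theorem integral_exp_neg_cosh_mul_exp {x : ℝ} (hx : 0 < x) :
    ∫ t : ℝ, Real.exp (-x * Real.cosh t) * Real.exp t =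
      2 * ∫ t in Ioi (0 : ℝ), Real.exp (-x * Real.cosh t) * Real.cosh t := by
  have hi := integrable_exp_neg_cosh_mul_exp hx
  rw [← intervalIntegral.integral_Iic_add_Ioi (b := 0) hi.integrableOn hi.integrableOn]
  have h1 := integral_comp_neg_Ioi (c := 0)
    (f := fun t => Real.exp (-x * Real.cosh t) * Real.exp t)
  rw [neg_zero] at h1
  rw [← h1, ← integral_const_mul, ← integral_add hi.comp_neg.integrableOn hi.integrableOn]
  congr 1 with t
  rw [Real.cosh_neg, Real.cosh_eq]
  ring

/-- The substitution u = e^t/√x symmetrises the exponent: xu + 1/u = 2√x cosh t. -/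
theorem integral_exp_mul_expNegInvGlue {x : ℝ} (hx : 0 < x) :
    ∫ u in Ioi (0 : ℝ), Real.exp (-x * u) * expNegInvGlue u =
      2 / Real.sqrt x * ∫ t in Ioi (0 : ℝ), Real.exp (-(2 * Real.sqrt x) * Real.cosh t) *
        Real.cosh t := by
  have hs : 0 < Real.sqrt x := Real.sqrt_pos.2 hx
  have hss : Real.sqrt x * Real.sqrt x = x := Real.mul_self_sqrt hx.le
  have himg : (fun t : ℝ => Real.exp t / Real.sqrt x) '' univ = Ioi 0 := by
    ext u
    simp only [image_univ, mem_range, mem_Ioi]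
    constructor
    · rintro ⟨t, rfl⟩; positivity
    · intro hu
      exact ⟨Real.log (u * Real.sqrt x), by rw [Real.exp_log (by positivity)]; field_simp⟩
  have h := integral_image_eq_integral_abs_deriv_smul MeasurableSet.univ
    (f := fun t : ℝ => Real.exp t / Real.sqrt x) (f' := fun t => Real.exp t / Real.sqrt x)
    (fun t _ => ((Real.hasDerivAt_exp t).div_const _).hasDerivWithinAt)
    (fun s _ t _ hst => Real.exp_injective ((div_left_inj' hs.ne').1 hst))
    (fun u => Real.exp (-x * u) * expNegInvGlue u)
  rw [himg, setIntegral_univ] at h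
  have e : ∀ t : ℝ, |Real.exp t / Real.sqrt x| • (Real.exp (-x * (Real.exp t / Real.sqrt x)) *
      expNegInvGlue (Real.exp t / Real.sqrt x)) =
      1 / Real.sqrt x * (Real.exp (-(2 * Real.sqrt x) * Real.cosh t) * Real.exp t) := by
    intro t
    have hp : 0 < Real.exp t / Real.sqrt x := by positivity
    have e1 : -x * (Real.exp t / Real.sqrt x) + -(Real.exp t / Real.sqrt x)⁻¹ =
        -(2 * Real.sqrt x) * Real.cosh t := by
      rw [Real.cosh_eq, Real.exp_neg, inv_div]
      field_simp
      nlinarith [hss]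
    rw [abs_of_pos hp, expNegInvGlue_of_pos hp, ← Real.exp_add, e1, smul_eq_mul]
    ring
  simp only [e] at h
  rw [h, integral_const_mul, integral_exp_neg_cosh_mul_exp (by positivity)]
  ring

theorem two_mul_sqrt_re_pos {z : ℂ} (hz : 0 ≤ z.re) (h0 : z ≠ 0) :
    0 < (2 * z ^ (1 / 2 : ℂ)).re := by
  obtain ⟨h1, -⟩ := abs_sqrt_im_le hz
  have h2 : z ^ (1 / 2 : ℂ) ≠ 0 := by simp [Complex.cpow_eq_zero_iff, h0]
  have h3 : 0 < (z ^ (1 / 2 : ℂ)).re := by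
    refine lt_of_le_of_ne ((abs_nonneg _).trans h1) fun h => h2 ?_
    rw [← h] at h1
    exact Complex.ext h.symm (abs_eq_zero.1 (le_antisymm h1 (abs_nonneg _)))
  have : (2 * z ^ (1 / 2 : ℂ)).re = 2 * (z ^ (1 / 2 : ℂ)).re := by simp
  rw [this]
  positivity

/-- `2 z^{3/2} K₁(2 √z)`. -/
noncomputable def besselKLaplace (z : ℂ) : ℂ :=
  2 * z * z ^ (1 / 2 : ℂ) * besselK 1 (2 * z ^ (1 / 2 : ℂ))

theorem differentiableAt_besselKLaplace {z : ℂ} (hz : 0 ≤ z.re) (h0 : z ≠ 0) :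
    DifferentiableAt ℂ besselKLaplace z := by
  have hs : DifferentiableAt ℂ (fun z : ℂ => z ^ (1 / 2 : ℂ)) z :=
    differentiableAt_id.cpow_const (mem_slitPlane_of_re_nonneg h0 hz)
  have h1 : DifferentiableAt ℂ (fun z : ℂ => besselK 1 (2 * z ^ (1 / 2 : ℂ))) z :=
    DifferentiableAt.comp z (g := besselK 1)
      (differentiableAt_besselK_one (two_mul_sqrt_re_pos hz h0)) (hs.const_mul 2)
  exact ((differentiableAt_id.const_mul 2).mul hs).mul h1

theorem glueLaplace_ofReal {x : ℝ} (hx : 0 < x) : glueLaplace x = besselKLaplace x := by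
  have hs : 0 < Real.sqrt x := Real.sqrt_pos.2 hx
  have hss : Real.sqrt x * Real.sqrt x = x := Real.mul_self_sqrt hx.le
  rw [glueLaplace_eq (by simpa using hx), besselKLaplace, ofReal_sqrt_eq hx.le, besselK_one_eq]
  have h1 : ∫ u in Ioi (0 : ℝ), Complex.exp (-(x : ℂ) * u) * (expNegInvGlue u : ℂ) =
      ((∫ u in Ioi (0 : ℝ), Real.exp (-x * u) * expNegInvGlue u : ℝ) : ℂ) := by
    rw [← integral_complex_ofReal]
    congr 1 with u
    push_cast
    rfl
  have h2 : coshMoment 1 (2 * (Real.sqrt x : ℂ)) =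
      ((∫ t in Ioi (0 : ℝ), Real.exp (-(2 * Real.sqrt x) * Real.cosh t) * Real.cosh t : ℝ) : ℂ) := by
    rw [← integral_complex_ofReal, coshMoment]
    congr 1 with t
    push_cast
    rw [pow_one]
  rw [h1, h2, integral_exp_mul_expNegInvGlue hx]
  set J := ∫ t in Ioi (0 : ℝ), Real.exp (-(2 * Real.sqrt x) * Real.cosh t) * Real.cosh t
  have : x ^ 2 * (2 / Real.sqrt x * J) = 2 * x * Real.sqrt x * J := by
    field_simp
    linear_combination (-J) * hss
  exact_mod_cast this

/-- Equality on the positive axis spreads to the open half-plane by the identity theorem, and to the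
imaginary axis by approaching z through z + 1/(n + 1). -/
theorem glueLaplace_eq_besselKLaplace {z : ℂ} (hz : 0 ≤ z.re) (h0 : z ≠ 0) :
    glueLaplace z = besselKLaplace z := by
  have hopen : ∀ w : ℂ, 0 < w.re → glueLaplace w = besselKLaplace w := fun w hw =>
    eqOn_re_pos_of_eq_ofReal (fun z hz => differentiableAt_glueLaplace hz)
      (fun z hz => differentiableAt_besselKLaplace hz.le (by rintro rfl; simp at hz))
      (fun x hx => glueLaplace_ofReal hx) hw
  have hu : Tendsto (fun n : ℕ => z + ((1 / ((n : ℝ) + 1) : ℝ) : ℂ)) atTop (𝓝 z) := by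
    have := (Complex.continuous_ofReal.tendsto 0).comp
      (tendsto_one_div_add_atTop_nhds_zero_nat (𝕜 := ℝ))
    simpa using (this.const_add z)
  have hre : ∀ n : ℕ, 0 < (z + ((1 / ((n : ℝ) + 1) : ℝ) : ℂ)).re := by
    intro n
    rw [Complex.add_re, Complex.ofReal_re]
    positivity
  have h1 : Tendsto (fun n : ℕ => glueLaplace (z + ((1 / ((n : ℝ) + 1) : ℝ) : ℂ))) atTop
      (𝓝 (glueLaplace z)) :=
    continuousWithinAt_glueLaplace.tendsto.comp
      (tendsto_nhdsWithin_iff.2 ⟨hu, Eventually.of_forall fun n => (hre n).le⟩)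
  have h2 : Tendsto (fun n : ℕ => besselKLaplace (z + ((1 / ((n : ℝ) + 1) : ℝ) : ℂ))) atTop
      (𝓝 (besselKLaplace z)) :=
    (differentiableAt_besselKLaplace hz h0).continuousAt.tendsto.comp hu
  exact tendsto_nhds_unique h1 (h2.congr fun n => (hopen _ (hre n)).symm)

/-! ### The trapezoidal rule and its error term -/

/-- The periodic function `{u} (1 - {u})`. -/
noncomputable def fractParabola (u : ℝ) : ℝ := Int.fract u * (1 - Int.fract u)

theorem fractParabola_nonneg (u : ℝ) : 0 ≤ fractParabola u :=
  mul_nonneg (Int.fract_nonneg u) (sub_nonneg.2 (Int.fract_lt_one u).le)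

theorem fractParabola_le_one (u : ℝ) : fractParabola u ≤ 1 := by
  have h1 := Int.fract_nonneg u
  have h2 := (Int.fract_lt_one u).le
  unfold fractParabola
  nlinarith

theorem measurable_fractParabola : Measurable fractParabola :=
  measurable_fract.mul (measurable_const.sub measurable_fract)

/-- The right endpoint is included because the parabola vanishes at both ends, which is what makes
its periodic extension continuous. -/
theorem fractParabola_eq {n : ℕ} {u : ℝ} (hu : u ∈ Icc (n : ℝ) (n + 1)) :
    fractParabola u = (u - n) * (1 - (u - n)) := by
  rcases hu.2.lt_or_eq with h | h
  · have : Int.fract u = u - n := by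
      rw [Int.fract_eq_iff]
      exact ⟨by linarith [hu.1], by linarith, n, by push_cast; ring⟩
    rw [fractParabola, this]
  · have : u = ((n + 1 : ℕ) : ℝ) := by push_cast; exact h
    rw [fractParabola, this, Int.fract_natCast]
    push_cast
    ring

/-- The Fourier series of the Bernoulli polynomial B₂, subtracted from its value at 0: B₂(0) - B₂(x)
= x(1 - x). -/
theorem hasSum_one_sub_cos (u : ℝ) :
    HasSum (fun b : ℕ+ => (1 - Real.cos (2 * Real.pi * b * u)) / (Real.pi * b) ^ 2)
      (fractParabola u) := by
  have hp := Real.pi_ne_zero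
  set x := Int.fract u with hx
  have hmem : x ∈ Icc (0 : ℝ) 1 := ⟨Int.fract_nonneg u, (Int.fract_lt_one u).le⟩
  have hB : ∀ y : ℝ, (Polynomial.map (algebraMap ℚ ℝ) (Polynomial.bernoulli 2)).eval y =
      y ^ 2 - y + 1 / 6 := by
    intro y
    have h6 : bernoulli 2 = 1 / 6 := by rw [bernoulli_two]; norm_num
    simp [Polynomial.bernoulli, Finset.sum_range_succ, bernoulli_one, h6]
    ring
  have h1 := hasSum_one_div_nat_pow_mul_cos one_ne_zero hmem
  have h0 := hasSum_one_div_nat_pow_mul_cos one_ne_zero (left_mem_Icc.2 (zero_le_one (α := ℝ)))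
  simp only [mul_one, hB] at h0 h1
  have h2 := ((h0.sub h1).mul_left (1 / Real.pi ^ 2))
  have hs : HasSum (fun n : ℕ => (1 - Real.cos (2 * Real.pi * n * u)) / (Real.pi * n) ^ 2)
      (fractParabola u) := by
    convert! h2 using 1
    · ext n
      have hc : Real.cos (2 * Real.pi * n * x) = Real.cos (2 * Real.pi * n * u) := by
        have : 2 * Real.pi * n * x = 2 * Real.pi * n * u - ((n * ⌊u⌋ : ℤ) : ℝ) * (2 * Real.pi) := by
          rw [hx, Int.fract]
          push_cast
          ring
        rw [this, Real.cos_sub_int_mul_two_pi]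
      rw [hc]
      simp only [mul_zero, Real.cos_zero]
      by_cases hn : (n : ℝ) = 0
      · simp [hn]
      · field_simp
    · rw [fractParabola, ← hx]
      norm_num
      field_simp
      ring
  exact (hasSum_pnat_iff_of_zero (by simp)).2 hs

theorem intervalIntegrable_fractParabola_mul {f : ℝ → ℝ} (hf : Continuous f) (n : ℕ) :
    IntervalIntegrable (fun u => fractParabola u * f u) volume n (n + 1 : ℕ) := by
  refine ContinuousOn.intervalIntegrable ?_
  have hle : (n : ℝ) ≤ (n + 1 : ℕ) := by push_cast; linarith
  rw [uIcc_of_le hle]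
  push_cast
  refine ContinuousOn.congr (f := fun u : ℝ => (u - n) * (1 - (u - n)) * f u)
    (by fun_prop) fun u hu => ?_
  simp only
  rw [fractParabola_eq hu]

/-- Two integrations by parts against v(1 - v), v = u - n, packaged as one primitive ½v(1 - v)G' -
½(1 - 2v)G; its boundary values are the two trapezoidal weights. -/
theorem trapezoid_unit {G G₁ G₂ : ℝ → ℝ} (h₁ : ∀ u, HasDerivAt G (G₁ u) u)
    (h₂ : ∀ u, HasDerivAt G₁ (G₂ u) u) (hc : Continuous G₂) (n : ℕ) :
    (∫ u in (n : ℝ)..(n + 1 : ℕ), G u) + 1 / 2 * ∫ u in (n : ℝ)..(n + 1 : ℕ),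
      fractParabola u * G₂ u = (G n + G (n + 1 : ℕ)) / 2 := by
  have hG : Continuous G := continuous_iff_continuousAt.2 fun u => (h₁ u).continuousAt
  have hle : (n : ℝ) ≤ (n + 1 : ℕ) := by push_cast; linarith
  have hd : ∀ u ∈ uIcc (n : ℝ) (n + 1 : ℕ), HasDerivAt
      (fun u => 1 / 2 * ((u - n) * (1 - (u - n))) * G₁ u - 1 / 2 * (1 - 2 * (u - n)) * G u)
      (G u + 1 / 2 * ((u - n) * (1 - (u - n)) * G₂ u)) u := by
    intro u _
    have hx : HasDerivAt (fun u : ℝ => u - n) 1 u := (hasDerivAt_id u).sub_const _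
    have a1 := ((hx.mul (hx.const_sub 1)).const_mul (1 / 2)).mul (h₂ u)
    have a2 := (((hx.const_mul 2).const_sub 1).const_mul (1 / 2)).mul (h₁ u)
    refine (a1.sub a2).congr_deriv ?_
    simp only [Pi.mul_apply]
    ring
  have hcong : ∫ u in (n : ℝ)..(n + 1 : ℕ), fractParabola u * G₂ u =
      ∫ u in (n : ℝ)..(n + 1 : ℕ), (u - n) * (1 - (u - n)) * G₂ u := by
    refine intervalIntegral.integral_congr fun u hu => ?_
    rw [uIcc_of_le hle] at hu
    push_cast at hu
    rw [fractParabola_eq hu]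
  have hcont : Continuous fun u : ℝ => (u - n) * (1 - (u - n)) * G₂ u := by fun_prop
  have hF := intervalIntegral.integral_eq_sub_of_hasDerivAt hd
    (Continuous.intervalIntegrable (by fun_prop) _ _)
  rw [intervalIntegral.integral_add (hG.intervalIntegrable _ _)
    ((hcont.const_mul _).intervalIntegrable _ _), intervalIntegral.integral_const_mul] at hF
  rw [hcong, hF]
  push_cast
  ring

/-- Adding the unit intervals leaves half weights at the two ends; the one at 0 disappears because
`G 0 = 0`, the one at N is kept explicitly. -/
theorem trapezoid_sum {G G₁ G₂ : ℝ → ℝ} (h₁ : ∀ u, HasDerivAt G (G₁ u) u)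
    (h₂ : ∀ u, HasDerivAt G₁ (G₂ u) u) (hc : Continuous G₂) (h0 : G 0 = 0) (N : ℕ) :
    ∑ n ∈ Finset.range N, G (n + 1 : ℕ) - G N / 2 =
      (∫ u in (0 : ℝ)..N, G u) + 1 / 2 * ∫ u in (0 : ℝ)..N, fractParabola u * G₂ u := by
  have hG : Continuous G := continuous_iff_continuousAt.2 fun u => (h₁ u).continuousAt
  have e1 := intervalIntegral.sum_integral_adjacent_intervals (f := G) (μ := volume)
    (a := fun n : ℕ => (n : ℝ)) (n := N) (fun k _ => hG.intervalIntegrable _ _)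
  have e2 := intervalIntegral.sum_integral_adjacent_intervals
    (f := fun u => fractParabola u * G₂ u) (μ := volume)
    (a := fun n : ℕ => (n : ℝ)) (n := N) (fun k _ => intervalIntegrable_fractParabola_mul hc k)
  simp only [Nat.cast_zero] at e1 e2
  rw [← e1, ← e2, Finset.mul_sum, ← Finset.sum_add_distrib,
    Finset.sum_congr rfl fun n _ => trapezoid_unit h₁ h₂ hc n]
  clear e1 e2
  induction N with
  | zero => simp [h0]
  | succ N ih =>
    rw [Finset.sum_range_succ, Finset.sum_range_succ, ← ih]
    ring

/-! ### The trapezoidal rule applied to e^{-x/u}. -/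

/-- The second derivative of `u ↦ exp (-x / u)`. -/
noncomputable def glueScaled2 (x u : ℝ) : ℝ := x⁻¹ ^ 2 * glueDeriv2 (x⁻¹ * u)

theorem continuous_glueScaled2 (x : ℝ) : Continuous (glueScaled2 x) := by
  have := continuous_glueDeriv2
  unfold glueScaled2
  fun_prop

theorem trapezoid_glue (x : ℝ) (N : ℕ) :
    ∑ n ∈ Finset.range N, expNegInvGlue (x⁻¹ * (n + 1 : ℕ)) - expNegInvGlue (x⁻¹ * N) / 2 =
      (∫ u in (0 : ℝ)..N, expNegInvGlue (x⁻¹ * u)) +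
        1 / 2 * ∫ u in (0 : ℝ)..N, fractParabola u * glueScaled2 x u := by
  refine trapezoid_sum (G := fun u => expNegInvGlue (x⁻¹ * u))
    (G₁ := fun u => x⁻¹ * glueDeriv (x⁻¹ * u)) (G₂ := glueScaled2 x) (fun u => ?_) (fun u => ?_)
    (continuous_glueScaled2 x) (by simp) N
  · have h : HasDerivAt (fun u : ℝ => x⁻¹ * u) x⁻¹ u := by
      simpa using (hasDerivAt_id u).const_mul x⁻¹
    refine (HasDerivAt.comp u (hasDerivAt_expNegInvGlue (x⁻¹ * u)) h).congr_deriv ?_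
    ring
  · have h : HasDerivAt (fun u : ℝ => x⁻¹ * u) x⁻¹ u := by
      simpa using (hasDerivAt_id u).const_mul x⁻¹
    refine ((HasDerivAt.comp u (hasDerivAt_glueDeriv (x⁻¹ * u)) h).const_mul x⁻¹).congr_deriv ?_
    rw [glueScaled2]
    ring

theorem integrableOn_glueScaled2 {x : ℝ} (hx : 0 < x) : IntegrableOn (glueScaled2 x) (Ioi 0) := by
  have h := (integrableOn_Ioi_comp_mul_left_iff glueDeriv2 0 (inv_pos.2 hx)).2
    (by rw [mul_zero]; exact integrableOn_glueDeriv2)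
  exact h.const_mul _

theorem integral_norm_glueScaled2 {x : ℝ} (hx : 0 < x) :
    ∫ u in Ioi (0 : ℝ), ‖glueScaled2 x u‖ = x⁻¹ * ∫ u in Ioi (0 : ℝ), ‖glueDeriv2 u‖ := by
  have h := integral_comp_mul_left_Ioi (fun u => ‖glueDeriv2 u‖) 0 (inv_pos.2 hx)
  rw [mul_zero, inv_inv, smul_eq_mul] at h
  simp only [glueScaled2, norm_mul]
  rw [integral_const_mul, h, Real.norm_of_nonneg (by positivity)]
  field_simp

theorem integrableOn_fractParabola_mul {x : ℝ} (hx : 0 < x) :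
    IntegrableOn (fun u => fractParabola u * glueScaled2 x u) (Ioi 0) := by
  refine Integrable.mono' (integrableOn_glueScaled2 hx).norm
    (measurable_fractParabola.aestronglyMeasurable.mul
      (continuous_glueScaled2 x).aestronglyMeasurable) (Eventually.of_forall fun u => ?_)
  rw [norm_mul, Real.norm_of_nonneg (fractParabola_nonneg u)]
  exact mul_le_of_le_one_left (norm_nonneg _) (fractParabola_le_one u)

/-- The error of the trapezoidal rule for `u ↦ exp (-x / u)` on the half-line. -/
noncomputable def trapError (x : ℝ) : ℝ :=
  1 / 2 * ∫ u in Ioi (0 : ℝ), fractParabola u * glueScaled2 x u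

/-- Scaling u by x costs exactly one factor 1/x in the L¹ norm of the second derivative. Uniformity
in N makes this the majorant for passing to the limit under the sum over multiples of x. -/
theorem norm_trapError_partial_le {x : ℝ} (hx : 0 < x) (N : ℕ) :
    ‖1 / 2 * ∫ u in (0 : ℝ)..N, fractParabola u * glueScaled2 x u‖ ≤
      x⁻¹ * ∫ u in Ioi (0 : ℝ), ‖glueDeriv2 u‖ := by
  rw [intervalIntegral.integral_of_le (Nat.cast_nonneg N), norm_mul, ← integral_norm_glueScaled2 hx]
  have h1 : ‖∫ u in Ioc (0 : ℝ) N, fractParabola u * glueScaled2 x u‖ ≤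
      ∫ u in Ioi (0 : ℝ), ‖glueScaled2 x u‖ := by
    refine (norm_integral_le_integral_norm _).trans ((setIntegral_mono_set
      (integrableOn_fractParabola_mul hx).norm (Eventually.of_forall fun u => norm_nonneg _)
      Ioc_subset_Ioi_self.eventuallyLE).trans ?_)
    refine integral_mono (integrableOn_fractParabola_mul hx).norm
      (integrableOn_glueScaled2 hx).norm fun u => ?_
    simp only [norm_mul]
    rw [Real.norm_of_nonneg (fractParabola_nonneg u)]
    exact mul_le_of_le_one_left (norm_nonneg _) (fractParabola_le_one u)
  have h2 : ‖(1 / 2 : ℝ)‖ ≤ 1 := by norm_num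
  calc _ ≤ 1 * ‖∫ u in Ioc (0 : ℝ) N, fractParabola u * glueScaled2 x u‖ := by gcongr
    _ ≤ _ := by rw [one_mul]; exact h1

theorem tendsto_trapError {x : ℝ} (hx : 0 < x) :
    Tendsto (fun N : ℕ => 1 / 2 * ∫ u in (0 : ℝ)..N, fractParabola u * glueScaled2 x u) atTop
      (𝓝 (trapError x)) :=
  (intervalIntegral_tendsto_integral_Ioi 0 (integrableOn_fractParabola_mul hx)
    tendsto_natCast_atTop_atTop).const_mul _

/-! ### The trapezoidal error as a series of K₁ terms. -/

/-- `Re (e^{-iπ/4} K₁(2 y e^{iπ/4}))`. -/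
noncomputable def besselPhi (y : ℝ) : ℝ :=
  ((starRingEnd ℂ) expQuarter * besselK 1 (2 * y * expQuarter)).re

theorem two_mul_expQuarter_re (y : ℝ) : (2 * y * expQuarter).re = Real.sqrt 2 * y := by
  have := (mul_expQuarter_re_im (2 * y)).1
  rw [mul_comm expQuarter] at this
  rw [this]
  simp
  ring

theorem abs_besselPhi_le {y : ℝ} (hy : 0 < y) {m : ℕ} (hm : 2 ≤ m) :
    |besselPhi y| ≤ 2 * m.factorial / y ^ m := by
  have h2 : 1 ≤ Real.sqrt 2 := Real.one_le_sqrt.2 (by norm_num)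
  have hre : 0 < (2 * y * expQuarter).re := by rw [two_mul_expQuarter_re]; positivity
  refine (Complex.abs_re_le_norm _).trans ?_
  rw [norm_mul, RCLike.norm_conj, norm_expQuarter, one_mul]
  refine (norm_besselK_one_le hre hm).trans ?_
  rw [two_mul_expQuarter_re]
  gcongr
  nlinarith

/-- The real part of the Laplace transform at z = iτ, where √z = √τ e^{iπ/4}. -/
theorem integral_cos_mul_glueDeriv2 {τ : ℝ} (hτ : 0 < τ) :
    ∫ v in Ioi (0 : ℝ), Real.cos (τ * v) * glueDeriv2 v =
      -(2 * τ * Real.sqrt τ * besselPhi (Real.sqrt τ)) := by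
  have hre : 0 ≤ (τ * Complex.I).re := by simp
  have h0 : (τ * Complex.I : ℂ) ≠ 0 := mul_ne_zero (by exact_mod_cast hτ.ne') Complex.I_ne_zero
  have h1 := glueLaplace_eq_besselKLaplace hre h0
  have h2 : ∫ v in Ioi (0 : ℝ), Real.cos (τ * v) * glueDeriv2 v =
      (glueLaplace (τ * Complex.I)).re := by
    rw [glueLaplace, ← RCLike.re_eq_complex_re, ← integral_re (integrableOn_exp_mul_glueDeriv2 hre)]
    congr 1 with v
    rw [show -(τ * Complex.I) * v = ((-(τ * v) : ℝ) : ℂ) * Complex.I by push_cast; ring,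
      RCLike.re_eq_complex_re, Complex.re_mul_ofReal, Complex.exp_ofReal_mul_I_re, Real.cos_neg]
  rw [h2, h1, besselKLaplace, sqrt_ofReal_mul hτ, sqrt_I, besselPhi]
  have e : 2 * (τ * Complex.I) * (Real.sqrt τ * expQuarter) *
      besselK 1 (2 * (Real.sqrt τ * expQuarter)) =
      ((-(2 * τ * Real.sqrt τ) : ℝ) : ℂ) * ((starRingEnd ℂ) expQuarter *
        besselK 1 (2 * Real.sqrt τ * expQuarter)) := by
    -- The prefactor i · e^{iπ/4} = -e^{-iπ/4} is what produces both the sign and the conjugate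
    -- phase.
    have e3 : (starRingEnd ℂ) expQuarter = -(Complex.I * expQuarter) := by
      have h4 : expQuarter ^ 2 * expQuarter ^ 2 = -1 := by
        rw [expQuarter_sq, Complex.I_mul_I]
      rw [← expQuarter_sq]
      refine mul_left_cancel₀ expQuarter_ne_zero ?_
      rw [expQuarter_mul_conj]
      linear_combination h4
    rw [e3, ← mul_assoc (2 : ℂ) (Real.sqrt τ : ℂ) expQuarter]
    push_cast
    ring
  rw [e, Complex.re_ofReal_mul]
  ring

theorem integral_cos_mul_glueScaled2 {x β : ℝ} (hx : 0 < x) (hβ : 0 < β) :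
    ∫ u in Ioi (0 : ℝ), Real.cos (β * u) * glueScaled2 x u =
      -(2 * β * Real.sqrt (β * x) * besselPhi (Real.sqrt (β * x))) := by
  have h := integral_comp_mul_left_Ioi (fun v => Real.cos (β * x * v) * glueDeriv2 v) 0
    (inv_pos.2 hx)
  rw [mul_zero, inv_inv, smul_eq_mul, integral_cos_mul_glueDeriv2 (by positivity)] at h
  have e : ∀ u : ℝ, Real.cos (β * u) * glueScaled2 x u =
      x⁻¹ ^ 2 * (Real.cos (β * x * (x⁻¹ * u)) * glueDeriv2 (x⁻¹ * u)) := by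
    intro u
    rw [show β * x * (x⁻¹ * u) = β * u by field_simp, glueScaled2]
    ring
  simp only [e]
  rw [integral_const_mul, h]
  field_simp

theorem integral_glueScaled2 {x : ℝ} (hx : 0 < x) :
    ∫ u in Ioi (0 : ℝ), glueScaled2 x u = 0 := by
  have h := integral_comp_mul_left_Ioi glueDeriv2 0 (inv_pos.2 hx)
  rw [mul_zero, integral_glueDeriv2, smul_zero] at h
  simp only [glueScaled2]
  rw [integral_const_mul, h, mul_zero]

theorem summable_inv_pi_mul_sq : Summable fun b : ℕ+ => 2 / (Real.pi * b) ^ 2 := by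
  have h : Summable fun b : ℕ+ => 1 / ((b : ℕ) : ℝ) ^ 2 :=
    (Real.summable_one_div_nat_pow.2 one_lt_two).comp_injective PNat.coe_injective
  refine (h.mul_left (2 / Real.pi ^ 2)).congr fun b => ?_
  rw [mul_pow, div_mul_div_comm, mul_one]

/-- Insert the Fourier series of {u}(1 - {u}) and integrate term by term, which Σ 2/(πb)² permits.
The constant parts contribute nothing since the second derivative has integral zero. -/
theorem hasSum_trapError {x : ℝ} (hx : 0 < x) :
    HasSum (fun b : ℕ+ => 2 * Real.sqrt (2 * Real.pi * b * x) / (Real.pi * b) *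
      besselPhi (Real.sqrt (2 * Real.pi * b * x))) (trapError x) := by
  have hcos : ∀ β : ℝ, IntegrableOn (fun u => Real.cos (β * u) * glueScaled2 x u) (Ioi 0) := by
    intro β
    have := continuous_glueScaled2 x
    refine Integrable.mono' (integrableOn_glueScaled2 hx).norm (by fun_prop)
      (Eventually.of_forall fun u => ?_)
    rw [norm_mul]
    exact mul_le_of_le_one_left (norm_nonneg _) (Real.abs_cos_le_one _)
  set F : ℕ+ → ℝ → ℝ := fun b u =>
    (1 - Real.cos (2 * Real.pi * b * u)) / (Real.pi * b) ^ 2 * glueScaled2 x u with hF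
  have hFeq : ∀ b u, F b u = ((Real.pi * b) ^ 2)⁻¹ * (glueScaled2 x u -
      Real.cos (2 * Real.pi * b * u) * glueScaled2 x u) := by
    intro b u
    simp only [hF]
    ring
  have hFint : ∀ b, IntegrableOn (F b) (Ioi 0) := by
    intro b
    simp only [funext (hFeq b)]
    exact ((integrableOn_glueScaled2 hx).sub (hcos _)).const_mul _
  have hFnorm : ∀ b, ∫ u in Ioi (0 : ℝ), ‖F b u‖ ≤
      2 / (Real.pi * b) ^ 2 * ∫ u in Ioi (0 : ℝ), ‖glueScaled2 x u‖ := by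
    intro b
    rw [← integral_const_mul]
    refine integral_mono (hFint b).norm ((integrableOn_glueScaled2 hx).norm.const_mul _) fun u => ?_
    simp only [hF, norm_mul]
    have h1 := Real.cos_le_one (2 * Real.pi * b * u)
    have h2 := Real.neg_one_le_cos (2 * Real.pi * b * u)
    gcongr
    rw [Real.norm_of_nonneg (div_nonneg (by linarith) (by positivity))]
    gcongr
    linarith
  have hsum := hasSum_integral_of_summable_integral_norm hFint
    (Summable.of_nonneg_of_le (fun b => integral_nonneg fun u => norm_nonneg _) hFnorm
      (summable_inv_pi_mul_sq.mul_right _))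
  have htot : ∀ u, ∑' b, F b u = fractParabola u * glueScaled2 x u := fun u =>
    ((hasSum_one_sub_cos u).mul_right (glueScaled2 x u)).tsum_eq
  simp only [htot] at hsum
  refine (hsum.mul_left (1 / 2)).congr_fun fun b => ?_
  have hb : (0 : ℝ) < b := by exact_mod_cast b.pos
  have hpi := Real.pi_pos
  simp only [hFeq]
  rw [integral_const_mul, integral_sub (integrableOn_glueScaled2 hx) (hcos _),
    integral_glueScaled2 hx, integral_cos_mul_glueScaled2 hx (by positivity)]
  field_simp
  ring

/-! ### The asymptotics of `∫_δ^∞ dt / (t (e^t - 1))` -/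

theorem exp_sub_one_pos {t : ℝ} (ht : 0 < t) : 0 < Real.exp t - 1 := by
  have := Real.add_one_lt_exp ht.ne'
  linarith

/-- The Bose function with its singular part at the origin removed. -/
noncomputable def boseReg (t : ℝ) : ℝ :=
  1 / (Real.exp t - 1) - Real.exp (-t) / t - Real.exp (-t) / 2

theorem continuousOn_boseReg : ContinuousOn boseReg (Ioi 0) := by
  intro t ht
  have h1 : t ≠ 0 := (show 0 < t from ht).ne'
  have h2 : Real.exp t - 1 ≠ 0 := (exp_sub_one_pos ht).ne'
  refine ContinuousAt.continuousWithinAt ?_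
  unfold boseReg
  fun_prop (disch := assumption)

/-- Vanishing to first order at 0 is what pushes the half-plane of convergence of the Mellin
transform to Re s > -1, so that s = 0 becomes an interior point. -/
theorem abs_boseReg_le {t : ℝ} (ht : 0 < t) (ht1 : t ≤ 1) : |boseReg t| ≤ t := by
  have h1 := exp_sub_one_pos ht
  have hge : t ≤ Real.exp t - 1 := by linarith [Real.add_one_le_exp t]
  have hb := Real.exp_bound (x := -t) (by rw [abs_neg, abs_of_pos ht]; exact ht1)
    (n := 3) (by norm_num)
  rw [abs_neg, abs_of_pos ht] at hb
  simp only [Finset.sum_range_succ, Finset.sum_range_zero] at hb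
  norm_num [Nat.factorial] at hb
  have hprod : Real.exp t * Real.exp (-t) = 1 := by rw [← Real.exp_add]; simp
  set e := Real.exp (-t) with he
  -- Over this common denominator, which is at least t², the numerator is O(t³) by the quadratic
  -- Taylor polynomial of e^{-t}.
  have hform : boseReg t = (t - (1 - e) * (1 + t / 2)) / (t * (Real.exp t - 1)) := by
    rw [boseReg, ← he]
    field_simp
    linear_combination (-2 - t) * hprod
  obtain ⟨b1, b2⟩ := abs_le.1 hb
  have t3 : 0 < t ^ 3 := by positivity
  have hnum : |t - (1 - e) * (1 + t / 2)| ≤ t ^ 3 := by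
    set ε := e - (1 + -t + t ^ 2 / 2) with hε
    have e1 : t - (1 - e) * (1 + t / 2) = t ^ 3 / 4 + ε * (1 + t / 2) := by
      rw [hε]; ring
    rw [e1, abs_le]
    constructor <;> nlinarith
  rw [hform, abs_div, abs_of_pos (mul_pos ht h1), div_le_iff₀ (mul_pos ht h1)]
  refine hnum.trans ?_
  nlinarith [mul_pos ht ht]

theorem abs_boseReg_le_exp {t : ℝ} (ht : 1 ≤ t) : |boseReg t| ≤ 4 * Real.exp (-t) := by
  have ht0 : 0 < t := by linarith
  have h1 := exp_sub_one_pos ht0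
  have h2 : 2 ≤ Real.exp t := by linarith [Real.add_one_le_exp t]
  have hp := Real.exp_pos (-t)
  have a1 : 1 / (Real.exp t - 1) ≤ 2 * Real.exp (-t) := by
    rw [Real.exp_neg, ← div_eq_mul_inv, div_le_div_iff₀ h1 (by positivity)]
    linarith
  have a2 : Real.exp (-t) / t ≤ Real.exp (-t) := div_le_self hp.le ht
  have a3 : 0 ≤ Real.exp (-t) / t := by positivity
  have a4 : 0 ≤ 1 / (Real.exp t - 1) := by positivity
  rw [boseReg, abs_le]
  constructor <;> linarith

/-- The Bose function `1 / (e^t - 1)`, complex-valued. -/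
noncomputable def boseC (t : ℝ) : ℂ := ((1 / (Real.exp t - 1) : ℝ) : ℂ)

theorem hasSum_bose {t : ℝ} (ht : 0 < t) :
    HasSum (fun n : ℕ+ => Real.exp (-(n : ℝ) * t)) (1 / (Real.exp t - 1)) := by
  have h1 : Real.exp (-t) < 1 := Real.exp_lt_one_iff.2 (by linarith)
  have h := (hasSum_geometric_of_lt_one (Real.exp_pos (-t)).le h1).mul_left (Real.exp (-t))
  have h2 := exp_sub_one_pos ht
  have e1 : Real.exp (-t) * (1 - Real.exp (-t))⁻¹ = 1 / (Real.exp t - 1) := by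
    rw [Real.exp_neg]
    have := Real.exp_pos t
    field_simp
  rw [e1] at h
  rw [← Equiv.pnatEquivNat.symm.hasSum_iff]
  refine h.congr_fun fun n => ?_
  simp only [Function.comp, Equiv.pnatEquivNat_symm_apply, Nat.succPNat_coe]
  rw [← Real.exp_nat_mul, ← Real.exp_add]
  push_cast
  ring_nf

theorem hasSum_riemannZeta {s : ℂ} (hs : 1 < s.re) :
    HasSum (fun n : ℕ+ => 1 / ((n : ℕ) : ℂ) ^ s) (riemannZeta s) := by
  have hs0 : s ≠ 0 := by rintro rfl; simp at hs; linarith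
  rw [hasSum_pnat_iff_of_zero (f := fun n : ℕ => 1 / (n : ℂ) ^ s) (by simp [hs0]),
    zeta_eq_tsum_one_div_nat_cpow hs]
  exact (Complex.summable_one_div_nat_cpow.2 hs).hasSum

/-- Expand 1/(e^t - 1) in powers of e^{-t}; each power contributes Γ(s) n^{-s}. -/
theorem mellin_boseC {s : ℂ} (hs : 1 < s.re) :
    mellin boseC s = Complex.Gamma s * riemannZeta s := by
  have h := hasSum_mellin (a := fun _ : ℕ+ => (1 : ℂ)) (p := fun n : ℕ+ => ((n : ℕ) : ℝ)) (F := boseC)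
    (s := s) (fun n => Or.inr (by exact_mod_cast n.pos)) (by linarith) (fun t ht => ?_) ?_
  · refine h.unique (((hasSum_riemannZeta hs).mul_left (Complex.Gamma s)).congr_fun fun n => ?_)
    push_cast
    ring
  · simp only [one_mul]
    exact Complex.hasSum_ofReal.2 (hasSum_bose ht)
  · simp only [norm_one]
    exact (Real.summable_one_div_nat_rpow.2 hs).comp_injective PNat.coe_injective

theorem mellinConvergent_exp_neg {s : ℂ} (hs : 0 < s.re) :
    MellinConvergent (fun t : ℝ => (Real.exp (-t) : ℂ)) s := by
  have := Complex.GammaIntegral_convergent hs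
  refine this.congr_fun (fun t _ => ?_) measurableSet_Ioi
  simp only [smul_eq_mul]
  rw [mul_comm]

theorem mellin_exp_neg {s : ℂ} (hs : 0 < s.re) :
    mellin (fun t : ℝ => (Real.exp (-t) : ℂ)) s = Complex.Gamma s := by
  rw [Complex.Gamma_eq_integral hs, Complex.GammaIntegral_eq_mellin]

theorem isBigO_boseReg_atTop :
    (fun t => (boseReg t : ℂ)) =O[atTop] fun t : ℝ => Real.exp (-1 * t) := by
  refine Asymptotics.IsBigO.of_bound 4 ?_
  filter_upwards [eventually_ge_atTop 1] with t ht
  rw [Complex.norm_real, Real.norm_eq_abs, Real.norm_of_nonneg (Real.exp_pos _).le, neg_one_mul]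
  exact abs_boseReg_le_exp ht

theorem isBigO_boseReg_zero :
    (fun t => (boseReg t : ℂ)) =O[𝓝[>] 0] fun t : ℝ => t ^ (-(-1) : ℝ) := by
  refine Asymptotics.IsBigO.of_bound 1 ?_
  filter_upwards [Ioc_mem_nhdsGT one_pos] with t ht
  rw [Complex.norm_real, Real.norm_eq_abs, neg_neg, Real.rpow_one, Real.norm_of_nonneg ht.1.le,
    one_mul]
  exact abs_boseReg_le ht.1 ht.2

theorem locallyIntegrableOn_boseReg :
    LocallyIntegrableOn (fun t => (boseReg t : ℂ)) (Ioi 0) :=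
  (Complex.continuous_ofReal.comp_continuousOn continuousOn_boseReg).locallyIntegrableOn
    measurableSet_Ioi

theorem mellinConvergent_boseReg {s : ℂ} (hs : -1 < s.re) :
    MellinConvergent (fun t => (boseReg t : ℂ)) s :=
  mellinConvergent_of_isBigO_rpow_exp one_pos locallyIntegrableOn_boseReg isBigO_boseReg_atTop
    isBigO_boseReg_zero hs

/-- The subtracted terms have Mellin transforms Γ(s - 1) and Γ(s)/2. Multiplying by s(s - 1) clears
all poles, with the entire function `riemannZeta₁` in place of (s - 1)ζ(s), so the identity can be
continued to the left. -/
theorem mellin_boseReg_of_one_lt {s : ℂ} (hs : 1 < s.re) :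
    s * (s - 1) * mellin (fun t => (boseReg t : ℂ)) s =
      Complex.Gamma (s + 1) * (riemannZeta₁ s - 1 - (s - 1) / 2) := by
  have hs1 : s - 1 ≠ 0 := by
    intro h
    rw [sub_eq_zero.1 h] at hs
    simp at hs
  have hs0 : s ≠ 0 := by rintro rfl; simp at hs; linarith
  have c1 := mellinConvergent_boseReg (s := s) (by linarith)
  have c2 := mellinConvergent_exp_neg (s := s) (by linarith)
  have c3 := mellinConvergent_exp_neg (s := s - 1) (by simpa using hs)
  have hb : mellin boseC s = mellin (fun t => (boseReg t : ℂ)) s + Complex.Gamma (s - 1) +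
      Complex.Gamma s / 2 := by
    rw [← mellin_exp_neg (s := s) (by linarith),
      ← mellin_exp_neg (s := s - 1) (by simpa using hs), mellin, mellin, mellin, mellin,
      div_eq_mul_inv, ← integral_mul_const]
    have e1 := integral_add c1 c3
    have e2 := integral_add (c1.add c3) (c2.mul_const 2⁻¹)
    simp only [Pi.add_apply] at e1 e2
    rw [← e1, ← e2]
    refine setIntegral_congr_fun measurableSet_Ioi fun t ht => ?_
    have ht0 : (t : ℂ) ≠ 0 := by exact_mod_cast (show 0 < t from ht).ne'
    simp only [smul_eq_mul, boseC, boseReg]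
    rw [Complex.cpow_sub (s - 1) 1 ht0, Complex.cpow_one]
    push_cast
    field_simp
    ring
  have hz : riemannZeta s = (s - 1)⁻¹ * riemannZeta₁ s :=
    riemannZeta_eq_inv_sub_mul (sub_ne_zero.1 hs1)
  have hg1 : Complex.Gamma (s + 1) = s * Complex.Gamma s := Complex.Gamma_add_one s hs0
  have hg2 : Complex.Gamma s = (s - 1) * Complex.Gamma (s - 1) := by
    have := Complex.Gamma_add_one (s - 1) hs1
    rwa [sub_add_cancel] at this
  rw [mellin_boseC hs, hz] at hb
  have hm : mellin (fun t => (boseReg t : ℂ)) s = Complex.Gamma s * ((s - 1)⁻¹ * riemannZeta₁ s) -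
      Complex.Gamma (s - 1) - Complex.Gamma s / 2 := by rw [hb]; ring
  rw [hm, hg1, hg2]
  field_simp

theorem differentiableAt_mellin_boseReg {s : ℂ} (hs : -1 < s.re) :
    DifferentiableAt ℂ (mellin fun t => (boseReg t : ℂ)) s :=
  mellin_differentiableAt_of_isBigO_rpow_exp one_pos locallyIntegrableOn_boseReg
    isBigO_boseReg_atTop isBigO_boseReg_zero hs

theorem differentiableAt_Gamma_add_one {s : ℂ} (hs : -1 < s.re) :
    DifferentiableAt ℂ (fun s => Complex.Gamma (s + 1)) s := by
  refine DifferentiableAt.comp (g := Complex.Gamma) s (Complex.differentiableAt_Gamma _ ?_)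
    (by fun_prop)
  intro m h
  have := congrArg Complex.re h
  simp at this
  have : (0 : ℝ) ≤ m := Nat.cast_nonneg m
  linarith

theorem mellin_boseReg {s : ℂ} (hs : -1 < s.re) :
    s * (s - 1) * mellin (fun t => (boseReg t : ℂ)) s =
      Complex.Gamma (s + 1) * (riemannZeta₁ s - 1 - (s - 1) / 2) := by
  have hU : IsOpen {z : ℂ | -1 < z.re} := isOpen_lt continuous_const Complex.continuous_re
  have hf : AnalyticOnNhd ℂ (fun s : ℂ => s * (s - 1) * mellin (fun t => (boseReg t : ℂ)) s)
      {z : ℂ | -1 < z.re} :=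
    DifferentiableOn.analyticOnNhd (fun z hz => ((by fun_prop : DifferentiableAt ℂ
      (fun s : ℂ => s * (s - 1)) z).mul
        (differentiableAt_mellin_boseReg hz)).differentiableWithinAt) hU
  have hh : AnalyticOnNhd ℂ (fun s : ℂ => Complex.Gamma (s + 1) *
      (riemannZeta₁ s - 1 - (s - 1) / 2)) {z : ℂ | -1 < z.re} :=
    DifferentiableOn.analyticOnNhd (fun z hz => ((differentiableAt_Gamma_add_one hz).mul
      (by have := differentiable_riemannZeta₁; fun_prop)).differentiableWithinAt) hU
  refine hf.eqOn_of_preconnected_of_eventuallyEq hh (convex_halfSpace_re_gt (-1)).isPreconnected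
    (z₀ := 2) (by simp; norm_num) ?_ hs
  filter_upwards [(isOpen_lt continuous_const Complex.continuous_re).mem_nhds
    (show (1 : ℝ) < (2 : ℂ).re by simp)] with z hz
  exact mellin_boseReg_of_one_lt hz

/-- Both sides of the continued identity vanish at s = 0, so compare derivatives there. The factor
ζ₁(0) - 1 + 1/2 is zero, hence Γ'(1) drops out and only ζ(0) and ζ'(0) enter. -/
theorem mellin_boseReg_zero :
    mellin (fun t => (boseReg t : ℂ)) 0 = ((1 - Real.log (2 * Real.pi) / 2 : ℝ) : ℂ) := by
  have h0 : (-1 : ℝ) < (0 : ℂ).re := by simp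
  have hz0 : HasDerivAt riemannZeta (-Complex.log (2 * Real.pi) / 2) 0 := by
    rw [← deriv_riemannZeta_zero]
    exact (differentiableAt_riemannZeta zero_ne_one).hasDerivAt
  have hd1 : HasDerivAt riemannZeta₁
      (riemannZeta 0 + (0 - 1) * (-Complex.log (2 * Real.pi) / 2)) 0 := by
    have h1 := ((hasDerivAt_id (0 : ℂ)).sub_const 1).mul hz0
    refine HasDerivAt.congr_of_eventuallyEq (h1.congr_deriv (by simp)) ?_
    filter_upwards [isOpen_ne.mem_nhds (zero_ne_one (α := ℂ))] with z hz
    have : z - 1 ≠ 0 := sub_ne_zero.2 hz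
    simp only [Pi.mul_apply, id]
    rw [riemannZeta_eq_inv_sub_mul hz]
    field_simp
  have hz1 : riemannZeta₁ 0 = 1 / 2 := by
    have := riemannZeta_eq_inv_sub_mul (zero_ne_one (α := ℂ))
    rw [riemannZeta_zero] at this
    norm_num at this
    linear_combination (-1 : ℂ) * this
  have hg := (differentiableAt_Gamma_add_one h0).hasDerivAt
  have hR := hg.mul ((hd1.sub_const 1).sub (((hasDerivAt_id (0 : ℂ)).sub_const 1).div_const 2))
  have hL := ((hasDerivAt_id (0 : ℂ)).mul ((hasDerivAt_id (0 : ℂ)).sub_const 1)).mul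
    (differentiableAt_mellin_boseReg h0).hasDerivAt
  have heq := hL.unique (hR.congr_of_eventuallyEq (by
    filter_upwards [(isOpen_lt continuous_const Complex.continuous_re).mem_nhds h0] with z hz
    exact mellin_boseReg hz))
  simp only [id, Pi.mul_apply, Pi.sub_apply, zero_add, Complex.Gamma_one, hz1, riemannZeta_zero,
    zero_sub, zero_mul, add_zero, one_mul, mul_one] at heq
  have hlog : Complex.log (2 * Real.pi) = (Real.log (2 * Real.pi) : ℂ) := by
    rw [Complex.ofReal_log (by positivity)]
    push_cast
    rfl
  rw [hlog] at heq
  push_cast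
  linear_combination (-1 : ℂ) * heq

/-- Differentiate the Mellin transform of e^{-t} at s = 1: the value is Γ'(1) = -γ. This is where
Euler's constant enters the tail integral. -/
theorem integral_exp_neg_mul_log :
    IntegrableOn (fun t => Real.exp (-t) * Real.log t) (Ioi 0) ∧
      ∫ t in Ioi (0 : ℝ), Real.exp (-t) * Real.log t = -Real.eulerMascheroniConstant := by
  have hc : Continuous fun t : ℝ => (Real.exp (-t) : ℂ) := by fun_prop
  have hz : (fun t : ℝ => (Real.exp (-t) : ℂ)) =O[𝓝[>] 0] fun t : ℝ => t ^ (-(0 : ℝ)) := by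
    refine Asymptotics.IsBigO.of_bound 1 ?_
    filter_upwards [self_mem_nhdsWithin] with t ht
    rw [Complex.norm_real, Real.norm_of_nonneg (Real.exp_pos _).le, neg_zero, Real.rpow_zero]
    simpa using (show 0 < t from ht).le
  have ht : (fun t : ℝ => (Real.exp (-t) : ℂ)) =O[atTop] fun t : ℝ => t ^ (-2 : ℝ) := by
    have := (isLittleO_exp_neg_mul_rpow_atTop one_pos (-2)).isBigO
    simp only [neg_one_mul] at this
    exact (Asymptotics.isBigO_norm_left (E' := ℂ)).1
      (((Asymptotics.isBigO_norm_left).2 this).congr_left fun t => by rw [Complex.norm_real, Real.norm_of_nonneg (Real.exp_pos _).le])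
  obtain ⟨h1, h2⟩ := mellin_hasDerivAt_of_isBigO_rpow (s := 1) (a := 2) (b := 0)
    (hc.locallyIntegrable.locallyIntegrableOn _) ht (by simp) hz (by simp)
  have hcongr : ∀ t ∈ Ioi (0 : ℝ), (t : ℂ) ^ ((1 : ℂ) - 1) • (Real.log t • (Real.exp (-t) : ℂ)) =
      ((Real.exp (-t) * Real.log t : ℝ) : ℂ) := by
    intro t _
    rw [sub_self, Complex.cpow_zero, one_smul, Complex.real_smul]
    push_cast
    ring
  have h3 : HasDerivAt (mellin fun t : ℝ => (Real.exp (-t) : ℂ))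
      (-Real.eulerMascheroniConstant : ℂ) 1 := by
    refine Complex.hasDerivAt_Gamma_one.congr_of_eventuallyEq ?_
    filter_upwards [(isOpen_lt continuous_const Complex.continuous_re).mem_nhds
      (show (0 : ℝ) < (1 : ℂ).re by simp)] with z hz
    exact mellin_exp_neg hz
  have h4 := h2.unique h3
  rw [mellin, setIntegral_congr_fun measurableSet_Ioi hcongr, integral_complex_ofReal] at h4
  refine ⟨?_, by exact_mod_cast h4⟩
  have h5 : IntegrableOn (fun t : ℝ => ((Real.exp (-t) * Real.log t : ℝ) : ℂ)) (Ioi 0) :=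
    IntegrableOn.congr_fun h1 hcongr measurableSet_Ioi
  exact h5.re

/-! ### The exponential integral and the tail integral near δ = 0. -/

theorem integrableOn_exp_neg_div_pow {δ : ℝ} (hδ : 0 < δ) (m : ℕ) :
    IntegrableOn (fun t => Real.exp (-t) / t ^ m) (Ioi δ) := by
  have h1 : IntegrableOn (fun t => (δ ^ m)⁻¹ * Real.exp (-t)) (Ioi δ) :=
    (integrableOn_exp_neg_Ioi δ).const_mul _
  refine Integrable.mono' h1 ?_ ?_
  · refine ContinuousOn.aestronglyMeasurable (fun t ht => ?_) measurableSet_Ioi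
    have : t ^ m ≠ 0 := pow_ne_zero _ (hδ.trans ht).ne'
    exact ContinuousAt.continuousWithinAt (by fun_prop (disch := assumption))
  · filter_upwards [ae_restrict_mem measurableSet_Ioi] with t ht
    have ht0 : 0 < t := hδ.trans ht
    rw [Real.norm_of_nonneg (by positivity), div_eq_inv_mul]
    gcongr
    exact (show δ < t from ht).le

theorem integral_exp_neg_div {δ : ℝ} (hδ : 0 < δ) :
    ∫ t in Ioi δ, Real.exp (-t) / t = (∫ t in Ioi δ, Real.exp (-t) * Real.log t) -
      Real.exp (-δ) * Real.log δ := by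
  have i1 := integral_exp_neg_mul_log.1.mono_set (Ioi_subset_Ioi hδ.le)
  have i2 : IntegrableOn (fun t => Real.exp (-t) / t) (Ioi δ) := by
    simpa using integrableOn_exp_neg_div_pow hδ 1
  have h := integral_Ioi_of_hasDerivAt_of_tendsto' (a := δ) (m := 0)
    (f := fun t => -(Real.exp (-t) * Real.log t))
    (f' := fun t => Real.exp (-t) * Real.log t - Real.exp (-t) / t) (fun t ht => ?_) (i1.sub i2) ?_
  · have e := integral_sub i1 i2
    rw [h] at e
    linarith
  · have ht0 : t ≠ 0 := (hδ.trans_le ht).ne'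
    refine ((hasDerivAt_neg t).exp.mul (Real.hasDerivAt_log ht0)).neg.congr_deriv ?_
    ring
  · have h1 := (isLittleO_exp_neg_mul_rpow_atTop one_pos (-1)).mul Real.isLittleO_log_id_atTop
    have h2 : (fun t : ℝ => t ^ (-1 : ℝ) * id t) =ᶠ[atTop] fun _ => (1 : ℝ) := by
      filter_upwards [eventually_gt_atTop 0] with t ht
      rw [Real.rpow_neg_one, id, inv_mul_cancel₀ ht.ne']
    have h3 := ((h1.congr' (Eventually.of_forall fun t => rfl) h2).tendsto_div_nhds_zero).neg
    simpa using h3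

theorem tendsto_integral_exp_neg_div :
    Tendsto (fun δ => (∫ t in Ioi δ, Real.exp (-t) / t) + Real.log δ) (𝓝[>] 0)
      (𝓝 (-Real.eulerMascheroniConstant)) := by
  obtain ⟨h1, h2⟩ := integral_exp_neg_mul_log
  have h3 : Tendsto (fun δ => ∫ t in Ioi δ, Real.exp (-t) * Real.log t) (𝓝[>] 0)
      (𝓝 (-Real.eulerMascheroniConstant)) := by
    rw [← h2]
    exact h1.continuousWithinAt_Ici_primitive_Ioi.mono_left (nhdsWithin_mono 0 Ioi_subset_Ici_self)
  have h4 : Tendsto (fun δ : ℝ => (1 - Real.exp (-δ)) * Real.log δ) (𝓝[>] 0) (𝓝 0) := by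
    have h5 : Tendsto (fun δ : ℝ => Real.log δ * δ) (𝓝[>] 0) (𝓝 0) := by
      simpa using tendsto_log_mul_rpow_nhdsGT_zero one_pos
    refine squeeze_zero_norm' ?_ (tendsto_zero_iff_norm_tendsto_zero.1 h5)
    filter_upwards [self_mem_nhdsWithin] with δ hδ
    have hδ0 : 0 < δ := hδ
    rw [norm_mul, norm_mul, mul_comm]
    refine mul_le_mul_of_nonneg_left ?_ (norm_nonneg _)
    rw [Real.norm_of_nonneg hδ0.le, Real.norm_of_nonneg
      (sub_nonneg.2 (Real.exp_le_one_iff.2 (by linarith)))]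
    linarith [Real.add_one_le_exp (-δ)]
  refine ((h3.add h4).congr' ?_).trans (by simp)
  filter_upwards [self_mem_nhdsWithin] with δ hδ
  rw [integral_exp_neg_div hδ]
  ring

theorem integral_boseReg_div :
    IntegrableOn (fun t => boseReg t / t) (Ioi 0) ∧
      ∫ t in Ioi (0 : ℝ), boseReg t / t = 1 - Real.log (2 * Real.pi) / 2 := by
  have h1 := mellinConvergent_boseReg (s := 0) (by simp)
  have hcongr : ∀ t ∈ Ioi (0 : ℝ), (t : ℂ) ^ ((0 : ℂ) - 1) • (boseReg t : ℂ) =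
      ((boseReg t / t : ℝ) : ℂ) := by
    intro t _
    rw [zero_sub, Complex.cpow_neg_one, smul_eq_mul]
    push_cast
    ring
  have h2 := mellin_boseReg_zero
  rw [mellin, setIntegral_congr_fun measurableSet_Ioi hcongr, integral_complex_ofReal] at h2
  refine ⟨?_, by exact_mod_cast h2⟩
  have h5 : IntegrableOn (fun t : ℝ => ((boseReg t / t : ℝ) : ℂ)) (Ioi 0) :=
    IntegrableOn.congr_fun h1 hcongr measurableSet_Ioi
  exact h5.re

theorem bose_div_eq {t : ℝ} (ht : 0 < t) : 1 / (t * (Real.exp t - 1)) =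
    boseReg t / t + Real.exp (-t) / t ^ 2 + Real.exp (-t) / t / 2 := by
  have := exp_sub_one_pos ht
  rw [boseReg]
  field_simp
  ring

theorem integrableOn_bose_div {δ : ℝ} (hδ : 0 < δ) :
    IntegrableOn (fun t => 1 / (t * (Real.exp t - 1))) (Ioi δ) := by
  have i0 := integral_boseReg_div.1.mono_set (Ioi_subset_Ioi hδ.le)
  have i1 : IntegrableOn (fun t => Real.exp (-t) / t) (Ioi δ) := by
    simpa using integrableOn_exp_neg_div_pow hδ 1
  exact IntegrableOn.congr_fun ((i0.add (integrableOn_exp_neg_div_pow hδ 2)).add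
    (i1.div_const 2)) (fun t ht => (bose_div_eq (hδ.trans ht)).symm) measurableSet_Ioi

/-- The tail integral `∫_δ^∞ dt / (t (e^t - 1))`. -/
noncomputable def boseTail (δ : ℝ) : ℝ := ∫ t in Ioi δ, 1 / (t * (Real.exp t - 1))

/-- Integrating e^{-t}/t² by parts yields e^{-δ}/δ minus the exponential integral; together with the
half already present, the latter ends up with coefficient -1/2. -/
theorem boseTail_eq {δ : ℝ} (hδ : 0 < δ) :
    boseTail δ = (∫ t in Ioi δ, boseReg t / t) + Real.exp (-δ) / δ -
      (∫ t in Ioi δ, Real.exp (-t) / t) / 2 := by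
  have i0 := integral_boseReg_div.1.mono_set (Ioi_subset_Ioi hδ.le)
  have i1 : IntegrableOn (fun t => Real.exp (-t) / t) (Ioi δ) := by
    simpa using integrableOn_exp_neg_div_pow hδ 1
  have i2 := integrableOn_exp_neg_div_pow hδ 2
  have h := integral_Ioi_of_hasDerivAt_of_tendsto' (a := δ) (m := 0)
    (f := fun t => -(Real.exp (-t) / t))
    (f' := fun t => Real.exp (-t) / t + Real.exp (-t) / t ^ 2) (fun t ht => ?_) (i1.add i2) ?_
  · have e := integral_add i1 i2
    rw [h] at e
    have e1 := integral_add i0 i2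
    have e2 := integral_add (i0.add i2) (i1.div_const 2)
    simp only [Pi.add_apply] at e2
    rw [boseTail, setIntegral_congr_fun measurableSet_Ioi
      (fun t ht => bose_div_eq (hδ.trans ht)), e2, e1, integral_div]
    linarith
  · have ht0 : t ≠ 0 := (hδ.trans_le ht).ne'
    refine ((hasDerivAt_neg t).exp.div (hasDerivAt_id t) ht0).neg.congr_deriv ?_
    simp only [id]
    field_simp
    ring
  · have h1 := (Real.tendsto_exp_neg_atTop_nhds_zero.mul tendsto_inv_atTop_zero).neg
    simpa [div_eq_mul_inv] using h1

theorem tendsto_exp_neg_sub_one_div :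
    Tendsto (fun δ => (Real.exp (-δ) - 1) / δ) (𝓝[>] 0) (𝓝 (-1)) := by
  have h := (hasDerivAt_neg (0 : ℝ)).exp
  simp only [neg_zero, Real.exp_zero, one_mul] at h
  refine ((hasDerivAt_iff_tendsto_slope.1 h).mono_left
    (nhdsWithin_mono 0 fun x hx => (show (0 : ℝ) < x from hx).ne')).congr fun δ => ?_
  simp [slope_def_field]

/-- The constant assembles 1 - ½ log 2π from the regular part, -1 from (e^{-δ} - 1)/δ, and γ/2 from
the exponential integral. -/
theorem tendsto_boseTail :
    Tendsto (fun δ => boseTail δ - 1 / δ - Real.log δ / 2) (𝓝[>] 0)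
      (𝓝 (Real.eulerMascheroniConstant / 2 - Real.log (2 * Real.pi) / 2)) := by
  obtain ⟨h1, h2⟩ := integral_boseReg_div
  have h3 : Tendsto (fun δ => ∫ t in Ioi δ, boseReg t / t) (𝓝[>] 0)
      (𝓝 (1 - Real.log (2 * Real.pi) / 2)) := by
    rw [← h2]
    exact h1.continuousWithinAt_Ici_primitive_Ioi.mono_left (nhdsWithin_mono 0 Ioi_subset_Ici_self)
  have h := (h3.add tendsto_exp_neg_sub_one_div).sub (tendsto_integral_exp_neg_div.div_const 2)
  have e : 1 - Real.log (2 * Real.pi) / 2 + -1 - -Real.eulerMascheroniConstant / 2 =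
      Real.eulerMascheroniConstant / 2 - Real.log (2 * Real.pi) / 2 := by ring
  rw [e] at h
  refine h.congr' ?_
  filter_upwards [self_mem_nhdsWithin] with δ hδ
  rw [boseTail_eq hδ]
  ring

theorem tendsto_boseTail_atTop : Tendsto boseTail atTop (𝓝 0) := by
  have h := intervalIntegral_tendsto_integral_Ioi 1 (integrableOn_bose_div one_pos) tendsto_id
  have h2 := (tendsto_const_nhds (x := boseTail 1)).sub h
  rw [← boseTail, sub_self] at h2
  refine h2.congr' ?_
  filter_upwards [eventually_ge_atTop 1] with x hx
  have := intervalIntegral.integral_Ioi_sub_Ioi (integrableOn_bose_div one_pos) hx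
  simp only [id, boseTail]
  linarith

theorem hasDerivAt_boseTail {δ : ℝ} (hδ : 0 < δ) :
    HasDerivAt boseTail (-(1 / (δ * (Real.exp δ - 1)))) δ := by
  have hcont : ContinuousOn (fun t => 1 / (t * (Real.exp t - 1))) (Ioi 0) := by
    intro t ht
    have : t * (Real.exp t - 1) ≠ 0 := (mul_pos ht (exp_sub_one_pos ht)).ne'
    exact ContinuousAt.continuousWithinAt (by fun_prop (disch := assumption))
  have hδ2 : 0 < δ / 2 := by positivity
  have hlt : δ / 2 < δ := by linarith
  have h1 : HasDerivAt (fun x => ∫ t in (δ / 2)..x, 1 / (t * (Real.exp t - 1)))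
      (1 / (δ * (Real.exp δ - 1))) δ := by
    refine intervalIntegral.integral_hasDerivAt_right ?_ ?_
      (hcont.continuousAt (Ioi_mem_nhds hδ))
    · rw [intervalIntegrable_iff_integrableOn_Ioc_of_le hlt.le]
      exact (integrableOn_bose_div hδ2).mono_set Ioc_subset_Ioi_self
    · exact hcont.stronglyMeasurableAtFilter isOpen_Ioi δ hδ
  refine (h1.const_sub (boseTail (δ / 2))).congr_of_eventuallyEq ?_
  filter_upwards [Ioi_mem_nhds hlt] with x hx
  have := intervalIntegral.integral_Ioi_sub_Ioi (integrableOn_bose_div hδ2) (show δ / 2 < x from hx).le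
  simp only [boseTail]
  linarith

/-! ### The sum over the edges of `log (sinh (π s / n) / (π s / n))` -/

/-- `u ↦ -log (1 - e^{-c/u})`. -/
noncomputable def edgePotential (c u : ℝ) : ℝ := -Real.log (1 - Real.exp (-(c / u)))

theorem hasDerivAt_const_div (c : ℝ) {u : ℝ} (hu : u ≠ 0) :
    HasDerivAt (fun u : ℝ => c / u) (-c / u ^ 2) u :=
  ((hasDerivAt_const u c).div (hasDerivAt_id u) hu).congr_deriv (by simp)

theorem exp_neg_div_lt_one {c u : ℝ} (hc : 0 < c) (hu : 0 < u) : Real.exp (-(c / u)) < 1 :=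
  Real.exp_lt_one_iff.2 (by have := div_pos hc hu; linarith)

theorem hasSum_edgePotential {c u : ℝ} (hc : 0 < c) (hu : 0 < u) :
    HasSum (fun a : ℕ+ => 1 / (a : ℝ) * expNegInvGlue ((c * a)⁻¹ * u)) (edgePotential c u) := by
  have h := Real.hasSum_pow_div_log_of_abs_lt_one (x := Real.exp (-(c / u)))
    (by rw [abs_of_pos (Real.exp_pos _)]; exact exp_neg_div_lt_one hc hu)
  rw [← Equiv.pnatEquivNat.symm.hasSum_iff]
  refine h.congr_fun fun n => ?_
  simp only [Function.comp, Equiv.pnatEquivNat_symm_apply, Nat.succPNat_coe]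
  rw [expNegInvGlue_of_pos (by positivity), ← Real.exp_nat_mul]
  push_cast
  rw [div_mul_eq_mul_div, one_mul]
  congr 2
  field_simp

theorem edgePotential_nonneg {c u : ℝ} (hc : 0 < c) (hu : 0 < u) : 0 ≤ edgePotential c u :=
  (hasSum_edgePotential hc hu).nonneg fun a => mul_nonneg (by positivity) (expNegInvGlue.nonneg _)

/-- Monotonicity replaces any analysis near u = 0: it bounds the function on (0, N] by its value at
N. -/
theorem edgePotential_mono {c u v : ℝ} (hc : 0 < c) (hu : 0 < u) (huv : u ≤ v) :
    edgePotential c u ≤ edgePotential c v := by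
  have h1 := exp_neg_div_lt_one hc hu
  have h2 := exp_neg_div_lt_one hc (hu.trans_le huv)
  have h3 : Real.exp (-(c / u)) ≤ Real.exp (-(c / v)) := by
    rw [Real.exp_le_exp, neg_le_neg_iff]
    gcongr
  rw [edgePotential, edgePotential, neg_le_neg_iff]
  exact Real.log_le_log (by linarith) (by linarith)

theorem hasDerivAt_edgePotential {c u : ℝ} (hc : 0 < c) (hu : 0 < u) :
    HasDerivAt (edgePotential c) (c / u ^ 2 / (Real.exp (c / u) - 1)) u := by
  have h1 := exp_neg_div_lt_one hc hu
  have h2 := exp_sub_one_pos (div_pos hc hu)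
  have hd : HasDerivAt (fun u : ℝ => -(c / u)) (c / u ^ 2) u :=
    (hasDerivAt_const_div c hu.ne').neg.congr_deriv (by ring)
  refine ((hd.exp.const_sub 1).log (by linarith)).neg.congr_deriv ?_
  rw [Real.exp_neg] at h1 ⊢
  have h3 : 1 - (Real.exp (c / u))⁻¹ = (Real.exp (c / u) - 1) / Real.exp (c / u) := by
    field_simp
  rw [h3]
  field_simp

theorem intervalIntegrable_edgePotential {c N : ℝ} (hc : 0 < c) (hN : 0 < N) :
    IntervalIntegrable (edgePotential c) volume 0 N := by
  rw [intervalIntegrable_iff_integrableOn_Ioc_of_le hN.le]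
  refine Integrable.mono' (integrableOn_const (C := edgePotential c N) (by simp)) ?_ ?_
  · exact ContinuousOn.aestronglyMeasurable (fun u hu =>
      (hasDerivAt_edgePotential hc hu.1).continuousAt.continuousWithinAt) measurableSet_Ioc
  · filter_upwards [ae_restrict_mem measurableSet_Ioc] with u hu
    rw [Real.norm_of_nonneg (edgePotential_nonneg hc hu.1)]
    exact edgePotential_mono hc hu.1 hu.2

/-- Integration by parts followed by t = c/u gives the primitive u ↦ u·φ(u) - c·`boseTail`(c/u), φ
the integrand, and this tends to 0 as u → 0. -/
theorem integral_edgePotential {c N : ℝ} (hc : 0 < c) (hN : 0 < N) :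
    ∫ u in (0 : ℝ)..N, edgePotential c u = N * edgePotential c N - c * boseTail (c / N) := by
  have hd : ∀ u, 0 < u → HasDerivAt (fun u => u * edgePotential c u - c * boseTail (c / u))
      (edgePotential c u) u := by
    intro u hu
    have h2 := exp_sub_one_pos (div_pos hc hu)
    have h3 := (HasDerivAt.comp u (hasDerivAt_boseTail (div_pos hc hu))
      (hasDerivAt_const_div c hu.ne')).const_mul c
    refine (((hasDerivAt_id u).mul (hasDerivAt_edgePotential hc hu)).sub h3).congr_deriv ?_
    simp only [id]
    field_simp
    ring
  have h := intervalIntegral.integral_eq_sub_of_hasDerivAt_of_tendsto hN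
    (f := fun u => u * edgePotential c u - c * boseTail (c / u)) (fa := 0)
    (fun u hu => hd u hu.1) (intervalIntegrable_edgePotential hc hN) ?_
    ((hd N hN).continuousAt.tendsto.mono_left nhdsWithin_le_nhds)
  · rw [h, sub_zero]
  · have h1 : Tendsto (fun u => u * edgePotential c u) (𝓝[>] 0) (𝓝 0) := by
      have h2 : Tendsto (fun u : ℝ => u * edgePotential c 1) (𝓝[>] 0) (𝓝 0) := by
        have : Tendsto (fun u : ℝ => u * edgePotential c 1) (𝓝 0) (𝓝 (0 * edgePotential c 1)) :=
          tendsto_id.mul_const _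
        rw [zero_mul] at this
        exact this.mono_left nhdsWithin_le_nhds
      refine squeeze_zero' ?_ ?_ h2
      · filter_upwards [self_mem_nhdsWithin] with u hu
        exact mul_nonneg (show 0 < u from hu).le (edgePotential_nonneg hc hu)
      · filter_upwards [Ioc_mem_nhdsGT one_pos] with u hu
        exact mul_le_mul_of_nonneg_left (edgePotential_mono hc hu.1 hu.2) hu.1.le
    have h3 : Tendsto (fun u : ℝ => c / u) (𝓝[>] 0) atTop := by
      simpa [div_eq_mul_inv] using tendsto_inv_nhdsGT_zero.const_mul_atTop hc
    simpa using h1.sub ((tendsto_boseTail_atTop.comp h3).const_mul c)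

theorem hasSum_integral_edgePotential {c N : ℝ} (hc : 0 < c) (hN : 0 < N) :
    HasSum (fun a : ℕ+ => 1 / (a : ℝ) * ∫ u in (0 : ℝ)..N, expNegInvGlue ((c * a)⁻¹ * u))
      (∫ u in (0 : ℝ)..N, edgePotential c u) := by
  have hcont := continuous_expNegInvGlue
  have hbd : ∀ a : ℕ+, ∫ u in (0 : ℝ)..N, ‖1 / (a : ℝ) * expNegInvGlue ((c * a)⁻¹ * u)‖ ≤
      1 / (a : ℝ) * expNegInvGlue ((c * a)⁻¹ * N) * N := by
    intro a
    have ha : (0 : ℝ) < a := by exact_mod_cast a.pos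
    have : ∫ u in (0 : ℝ)..N, 1 / (a : ℝ) * expNegInvGlue ((c * a)⁻¹ * N) =
        1 / (a : ℝ) * expNegInvGlue ((c * a)⁻¹ * N) * N := by simp; ring
    rw [← this]
    refine intervalIntegral.integral_mono_on hN.le
      (Continuous.intervalIntegrable (by fun_prop) _ _) (by simp) fun u hu => ?_
    rw [Real.norm_of_nonneg (mul_nonneg (by positivity) (expNegInvGlue.nonneg _))]
    gcongr
    rcases hu.1.eq_or_lt with h0 | h0
    · rw [← h0, mul_zero, expNegInvGlue.zero]
      exact expNegInvGlue.nonneg _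
    rw [expNegInvGlue_of_pos (by positivity), expNegInvGlue_of_pos (by positivity)]
    gcongr
    exact hu.2
  simp only [← intervalIntegral.integral_const_mul]
  simp only [intervalIntegral.integral_of_le hN.le] at hbd ⊢
  have h := hasSum_integral_of_summable_integral_norm
    (F := fun (a : ℕ+) u => 1 / (a : ℝ) * expNegInvGlue ((c * a)⁻¹ * u))
    (μ := volume.restrict (Ioc 0 N))
    (fun a => (Continuous.integrableOn_Ioc (by fun_prop))) ?_
  · rw [setIntegral_congr_fun (g := edgePotential c) measurableSet_Ioc fun u hu =>
      (hasSum_edgePotential hc hu.1).tsum_eq] at h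
    exact h
  · exact Summable.of_nonneg_of_le (fun a => integral_nonneg fun u => norm_nonneg _) hbd
      ((hasSum_edgePotential hc hN).summable.mul_right N)

theorem summable_one_div_mul_inv {c : ℝ} (C : ℝ) :
    Summable fun a : ℕ+ => 1 / (a : ℝ) * ((c * a)⁻¹ * C) := by
  have h : Summable fun b : ℕ+ => 1 / ((b : ℕ) : ℝ) ^ 2 :=
    (Real.summable_one_div_nat_pow.2 one_lt_two).comp_injective PNat.coe_injective
  refine (h.mul_left (c⁻¹ * C)).congr fun a => ?_
  rw [mul_inv, one_div, one_div, sq, mul_inv]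
  ring

/-- The trapezoidal identity for e^{-ca/u}, divided by a and summed over a: all terms of the
identity resum through the series of -log(1 - e^{-c/u}). -/
theorem sum_edgePotential_sub {c : ℝ} (hc : 0 < c) {N : ℕ} (hN : 0 < N) :
    HasSum (fun a : ℕ+ => 1 / (a : ℝ) *
        (1 / 2 * ∫ u in (0 : ℝ)..N, fractParabola u * glueScaled2 (c * a) u))
      (∑ n ∈ Finset.range N, edgePotential c (n + 1 : ℕ) - edgePotential c N / 2 -
        (N * edgePotential c N - c * boseTail (c / N))) := by
  have hN' : (0 : ℝ) < N := by exact_mod_cast hN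
  rw [← integral_edgePotential hc hN']
  have h1 : HasSum (fun a : ℕ+ => ∑ n ∈ Finset.range N,
      1 / (a : ℝ) * expNegInvGlue ((c * a)⁻¹ * (n + 1 : ℕ)))
      (∑ n ∈ Finset.range N, edgePotential c (n + 1 : ℕ)) :=
    hasSum_sum fun n _ => hasSum_edgePotential hc (by positivity)
  refine ((h1.sub ((hasSum_edgePotential hc hN').div_const 2)).sub
    (hasSum_integral_edgePotential hc hN')).congr_fun fun a => ?_
  have h := trapezoid_glue (c * a) N
  rw [← Finset.mul_sum]
  linear_combination (-(1 / (a : ℝ))) * h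

/-- Dominated convergence for series: the error bound of order 1/(ca), with the weight 1/a, gives a
summable majorant of order a⁻² independent of N. -/
theorem tendsto_sum_edgePotential_sub {c : ℝ} (hc : 0 < c) :
    Tendsto (fun N : ℕ => ∑ n ∈ Finset.range N, edgePotential c (n + 1 : ℕ) -
        edgePotential c N / 2 - (N * edgePotential c N - c * boseTail (c / N))) atTop
      (𝓝 (∑' a : ℕ+, 1 / (a : ℝ) * trapError (c * a))) := by
  set C := ∫ u in Ioi (0 : ℝ), ‖glueDeriv2 u‖
  have hca : ∀ a : ℕ+, 0 < c * a := fun a => mul_pos hc (by exact_mod_cast a.pos)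
  have h := tendsto_tsum_of_dominated_convergence (𝓕 := atTop)
    (f := fun (N : ℕ) (a : ℕ+) => 1 / (a : ℝ) *
        (1 / 2 * ∫ u in (0 : ℝ)..N, fractParabola u * glueScaled2 (c * a) u))
    (g := fun a : ℕ+ => 1 / (a : ℝ) * trapError (c * a))
    (bound := fun a : ℕ+ => 1 / (a : ℝ) * ((c * a)⁻¹ * C))
    (summable_one_div_mul_inv C) (fun a => (tendsto_trapError (hca a)).const_mul _)
    (Eventually.of_forall fun N a => ?_)
  · refine h.congr' ?_
    filter_upwards [eventually_gt_atTop 0] with N hN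
    exact (sum_edgePotential_sub hc hN).tsum_eq
  · rw [norm_mul, Real.norm_of_nonneg (by positivity)]
    exact mul_le_mul_of_nonneg_left (norm_trapError_partial_le (hca a) N) (by positivity)

theorem log_sinh_div {y : ℝ} (hy : 0 < y) :
    Real.log (Real.sinh y / y) = y - Real.log (2 * y) + Real.log (1 - Real.exp (-(2 * y))) := by
  have h1 : Real.exp (-(2 * y)) < 1 := Real.exp_lt_one_iff.2 (by linarith)
  have e : Real.sinh y / y = Real.exp y / (2 * y) * (1 - Real.exp (-(2 * y))) := by
    rw [Real.sinh_eq, show -(2 * y) = -y + -y by ring, Real.exp_add]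
    have : Real.exp y * Real.exp (-y) = 1 := by rw [← Real.exp_add]; simp
    field_simp
    linear_combination Real.exp (-y) * this
  rw [e, Real.log_mul (by positivity) (by linarith), Real.log_div (by positivity) (by positivity),
    Real.log_exp]

/-- By the mean value theorem the quotient is cosh at an intermediate point c, and 1 ≤ cosh c ≤
exp(c²/2). -/
theorem log_sinh_div_mem {y : ℝ} (hy : 0 < y) :
    0 ≤ Real.log (Real.sinh y / y) ∧ Real.log (Real.sinh y / y) ≤ y ^ 2 / 2 := by
  obtain ⟨c, hc, h⟩ := exists_hasDerivAt_eq_slope Real.sinh Real.cosh hy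
    Real.continuous_sinh.continuousOn fun x _ => Real.hasDerivAt_sinh x
  rw [Real.sinh_zero, sub_zero, sub_zero] at h
  rw [← h]
  refine ⟨Real.log_nonneg (Real.one_le_cosh c), ?_⟩
  rw [Real.log_le_iff_le_exp (Real.cosh_pos c)]
  refine (Real.cosh_le_exp_half_sq c).trans (Real.exp_le_exp.2 ?_)
  have := hc.1.le
  have := hc.2.le
  gcongr

/-- The numerator is δ/2 - log(sinh(δ/2)/(δ/2)), and the second term is O(δ²). -/
theorem tendsto_log_one_sub_exp_neg_div :
    Tendsto (fun δ => (-Real.log ((1 - Real.exp (-δ)) / δ)) / δ) (𝓝[>] 0) (𝓝 (1 / 2)) := by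
  have h0 : Tendsto (fun δ : ℝ => Real.log (Real.sinh (δ / 2) / (δ / 2)) / δ) (𝓝[>] 0) (𝓝 0) := by
    have h1 : Tendsto (fun δ : ℝ => δ) (𝓝[>] 0) (𝓝 0) := tendsto_id.mono_left nhdsWithin_le_nhds
    refine squeeze_zero' ?_ ?_ h1
    · filter_upwards [self_mem_nhdsWithin] with δ hδ
      have hδ' : 0 < δ := hδ
      exact div_nonneg (log_sinh_div_mem (by positivity)).1 hδ'.le
    · filter_upwards [self_mem_nhdsWithin] with δ hδ
      have hδ' : 0 < δ := hδ
      rw [div_le_iff₀ hδ']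
      have := (log_sinh_div_mem (half_pos hδ')).2
      nlinarith
  have h2 := h0.const_sub (1 / 2)
  rw [sub_zero] at h2
  refine h2.congr' ?_
  filter_upwards [self_mem_nhdsWithin] with δ hδ
  have hδ' : 0 < δ := hδ
  have h1 : Real.exp (-δ) < 1 := Real.exp_lt_one_iff.2 (by linarith)
  rw [log_sinh_div (half_pos hδ'), mul_div_cancel₀ δ two_ne_zero, Real.log_div (by linarith) hδ'.ne']
  field_simp
  ring

/-- With c = 2πs, each summand is c/(2n) - log c + log n plus log(1 - e^{-c/n}). Summation produces
a harmonic number, log N! and the sum treated by the trapezoidal rule. Euler's constant arises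
twice, from the harmonic number and from the tail integral, whence 2γ. -/
theorem tendsto_sum_log_sinh_div {s : ℝ} (hs : 0 < s) :
    Tendsto (fun N : ℕ => ∑ n ∈ Finset.range N,
        Real.log (Real.sinh (Real.pi * s / (n + 1 : ℕ)) / (Real.pi * s / (n + 1 : ℕ)))) atTop
      (𝓝 (Real.pi * s * Real.log s + (2 * Real.eulerMascheroniConstant - 1) * Real.pi * s +
        Real.log (2 * Real.pi) + Real.log s / 2 -
        ∑' a : ℕ+, 1 / (a : ℝ) * trapError (2 * Real.pi * s * a))) := by
  have hpi := Real.pi_pos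
  set c := 2 * Real.pi * s with hcdef
  have hc : 0 < c := by positivity
  have hδ : Tendsto (fun N : ℕ => c / N) atTop (𝓝[>] 0) := by
    refine tendsto_nhdsWithin_iff.2 ⟨tendsto_const_div_atTop_nhds_zero_nat c, ?_⟩
    filter_upwards [eventually_gt_atTop 0] with N hN
    exact div_pos hc (by exact_mod_cast hN)
  -- Put δ = c/N and write the potential at N as -log δ + r. Then r/δ → 1/2 (`t4`), so r → 0 (`t5`),
  -- while Nr → c/2. The divergent terms in N, N log N and log N cancel between these limits.
  have t1 := Real.tendsto_harmonic_sub_log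
  have t2 := Stirling.tendsto_stirlingSeq_sqrt_pi.log (by positivity)
  have t3 := tendsto_sum_edgePotential_sub hc
  have t4 := tendsto_log_one_sub_exp_neg_div.comp hδ
  have t5 := t4.mul (tendsto_const_div_atTop_nhds_zero_nat c)
  have t6 := tendsto_boseTail.comp hδ
  have t := ((((((t1.const_mul (c / 2)).add t2).sub t3).sub (t5.div_const 2)).sub
    (t4.const_mul c)).add (t6.const_mul c)).add_const
      (Real.log 2 / 2 + Real.log c / 2 + c / 2 * Real.log c)
  have hval : c / 2 * Real.eulerMascheroniConstant + Real.log (Real.sqrt Real.pi) -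
      ∑' a : ℕ+, 1 / (a : ℝ) * trapError (c * a) - 1 / 2 * 0 / 2 - c * (1 / 2) +
      c * (Real.eulerMascheroniConstant / 2 - Real.log (2 * Real.pi) / 2) +
      (Real.log 2 / 2 + Real.log c / 2 + c / 2 * Real.log c) =
      Real.pi * s * Real.log s + (2 * Real.eulerMascheroniConstant - 1) * Real.pi * s +
        Real.log (2 * Real.pi) + Real.log s / 2 - ∑' a : ℕ+, 1 / (a : ℝ) * trapError (c * a) := by
    rw [Real.log_sqrt hpi.le, hcdef, Real.log_mul (by positivity) hs.ne',
      Real.log_mul two_ne_zero hpi.ne']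
    ring
  rw [hval] at t
  refine t.congr' ?_
  filter_upwards [eventually_gt_atTop 0] with N hN
  have hN' : (0 : ℝ) < N := by exact_mod_cast hN
  have hterm : ∀ n : ℕ, Real.log (Real.sinh (Real.pi * s / (n + 1 : ℕ)) /
      (Real.pi * s / (n + 1 : ℕ))) = c / 2 * ((n + 1 : ℕ) : ℝ)⁻¹ - Real.log c +
        Real.log (n + 1 : ℕ) - edgePotential c (n + 1 : ℕ) := by
    intro n
    have hn : (0 : ℝ) < (n + 1 : ℕ) := by positivity
    have e : 2 * (Real.pi * s / (n + 1 : ℕ)) = c / (n + 1 : ℕ) := by rw [hcdef]; ring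
    rw [log_sinh_div (by positivity), e, Real.log_div hc.ne' hn.ne', edgePotential, hcdef]
    ring
  have hharm : (harmonic N : ℝ) = ∑ n ∈ Finset.range N, ((n + 1 : ℕ) : ℝ)⁻¹ := by
    rw [harmonic]
    push_cast
    rfl
  have hfact : Real.log N.factorial = ∑ n ∈ Finset.range N, Real.log (n + 1 : ℕ) := by
    rw [← Finset.prod_range_add_one_eq_factorial, Nat.cast_prod,
      Real.log_prod fun n _ => by positivity]
  have hst := Stirling.log_stirlingSeq_formula N
  rw [Real.log_mul two_ne_zero hN'.ne', Real.log_div hN'.ne' (Real.exp_pos 1).ne', Real.log_exp]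
    at hst
  have hlogδ : Real.log (c / N) = Real.log c - Real.log N := Real.log_div hc.ne' hN'.ne'
  have h1 := exp_neg_div_lt_one hc hN'
  have hφ : edgePotential c N = -Real.log (c / N) + -Real.log ((1 - Real.exp (-(c / N))) / (c / N)) := by
    rw [edgePotential, Real.log_div (sub_pos.2 h1).ne' (div_pos hc hN').ne']
    ring
  simp only [Finset.sum_congr rfl fun n _ => hterm n, Finset.sum_sub_distrib,
    Finset.sum_add_distrib, ← Finset.mul_sum, Finset.sum_const, Finset.card_range, nsmul_eq_mul,
    ← hharm, ← hfact, Function.comp]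
  set r := -Real.log ((1 - Real.exp (-(c / N))) / (c / N))
  have e1 : r / (c / N) * (c / N) = r := div_mul_cancel₀ _ (by positivity)
  have e2 : c * (r / (c / N)) = N * r := by field_simp
  have e3 : c * (1 / (c / N)) = N := by field_simp
  rw [e1, e2, hφ, hst, hlogδ]
  linear_combination (-1 : ℝ) * e3

/-! ### Sums weighted with the number of divisors -/

theorem card_divisorsAntidiagonal (n : ℕ) : n.divisorsAntidiagonal.card = n.divisors.card := by
  rw [← Nat.map_div_right_divisors, Finset.card_map]

/-- Group the pairs by their product; the fibre over n consists of the d(n) factorisations of n. -/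
theorem hasSum_card_divisors_mul {𝕜 : Type*} [NormedField 𝕜] [CompleteSpace 𝕜] {f : ℕ+ → 𝕜} {a : 𝕜}
    (hf : HasSum (fun p : ℕ+ × ℕ+ => f (p.1 * p.2)) a) :
    HasSum (fun n : ℕ+ => ((n : ℕ).divisors.card : 𝕜) * f n) a := by
  rw [← sigmaAntidiagonalEquivProd.hasSum_iff] at hf
  refine (hf.sigma fun n => hasSum_fintype _).congr_fun fun n => ?_
  have h : ∀ x : Nat.divisorsAntidiagonal n,
      f ((sigmaAntidiagonalEquivProd ⟨n, x⟩).1 * (sigmaAntidiagonalEquivProd ⟨n, x⟩).2) = f n := by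
    intro x
    congr 1
    exact PNat.eq (divisorsAntidiagonalFactors_eq x)
  simp only [Function.comp, h, Finset.sum_const, nsmul_eq_mul, Finset.card_univ,
    Fintype.card_coe, card_divisorsAntidiagonal]

theorem summable_one_div_pnat_rpow {r : ℝ} (hr : 1 < r) :
    Summable fun n : ℕ+ => 1 / ((n : ℕ) : ℝ) ^ r :=
  (Real.summable_one_div_nat_rpow.2 hr).comp_injective PNat.coe_injective

/-- Since (ab)^{-r} = a^{-r} b^{-r}, the majorant is a product of two convergent series; no estimate
of d(n) is needed. -/
theorem summable_prod_of_norm_le {𝕜 : Type*} [NormedField 𝕜] [CompleteSpace 𝕜] {f : ℕ+ → 𝕜}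
    {C r : ℝ} (hr : 1 < r) (hf : ∀ n : ℕ+, ‖f n‖ ≤ C * (1 / ((n : ℕ) : ℝ) ^ r)) :
    Summable fun p : ℕ+ × ℕ+ => f (p.1 * p.2) := by
  have h := ((summable_one_div_pnat_rpow hr).mul_of_nonneg (summable_one_div_pnat_rpow hr)
    (fun n => by positivity) (fun n => by positivity)).mul_left C
  refine Summable.of_norm_bounded h fun p => ?_
  refine (hf _).trans_eq ?_
  rw [PNat.mul_coe, Nat.cast_mul, Real.mul_rpow (Nat.cast_nonneg _) (Nat.cast_nonneg _),
    div_mul_div_comm, one_mul]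

theorem summable_card_divisors_mul_rpow {r : ℝ} (hr : 1 < r) :
    Summable fun n : ℕ+ => ((n : ℕ).divisors.card : ℝ) * (1 / ((n : ℕ) : ℝ) ^ r) := by
  set f : ℕ+ → ℝ := fun n => 1 / ((n : ℕ) : ℝ) ^ r with hf
  have h : Summable fun p : ℕ+ × ℕ+ => f (p.1 * p.2) := by
    refine summable_prod_of_norm_le (C := 1) hr fun n => ?_
    have : 0 ≤ f n := by rw [hf]; positivity
    rw [one_mul, Real.norm_of_nonneg this]
  exact (hasSum_card_divisors_mul (f := f) h.hasSum).summable

/-! ### The series over the periodic orbits -/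

theorem expQuarter_mul_re_pos {s : ℂ} (hs : 0 < s.re) : 0 < (expQuarter * s ^ (1 / 2 : ℂ)).re := by
  simpa using expQuarter_mul_sqrt_re_pos hs one_pos

theorem conj_expQuarter_mul_re_pos {s : ℂ} (hs : 0 < s.re) :
    0 < ((starRingEnd ℂ) expQuarter * s ^ (1 / 2 : ℂ)).re := by
  have h := expQuarter_mul_re_pos (s := (starRingEnd ℂ) s) (by simpa using hs)
  have hne : s.arg ≠ Real.pi := by
    rw [Ne, Complex.arg_eq_pi_iff]
    intro h'
    linarith [h'.1]
  have e : (starRingEnd ℂ) s ^ (1 / 2 : ℂ) = (starRingEnd ℂ) (s ^ (1 / 2 : ℂ)) := by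
    rw [Complex.conj_cpow _ _ hne, map_div₀, map_one, Complex.conj_ofNat]
  rw [e, ← Complex.conj_re, map_mul, Complex.conj_conj] at h
  exact h

theorem hasDerivAt_sqrt {s : ℂ} (hs : s ∈ Complex.slitPlane) :
    HasDerivAt (fun s : ℂ => s ^ (1 / 2 : ℂ)) (s ^ (1 / 2 : ℂ) / (2 * s)) s := by
  have h0 := Complex.slitPlane_ne_zero hs
  refine ((hasDerivAt_id s).cpow_const hs).congr_deriv ?_
  simp only [id]
  rw [Complex.cpow_sub _ _ h0, Complex.cpow_one]
  field_simp

/-- `√s ζ̄ K₁(c ζ √s)`. -/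
noncomputable def sqrtMulBesselK (ζ : ℂ) (c : ℝ) (s : ℂ) : ℂ :=
  s ^ (1 / 2 : ℂ) * ((starRingEnd ℂ) ζ * besselK 1 (c * (ζ * s ^ (1 / 2 : ℂ))))

/-- Up to the constant ζ̄/(cζ) the function is v K₁(v) at v = cζ√s, so the chain rule with (vK₁)' =
-vK₀ applies. The condition ζζ̄ = 1 makes the phase disappear from the coefficient. -/
theorem hasDerivAt_sqrtMulBesselK {ζ s : ℂ} {c : ℝ} (hc : 0 < c) (hs : s ∈ Complex.slitPlane)
    (hζ : ζ * (starRingEnd ℂ) ζ = 1) (hre : 0 < (ζ * s ^ (1 / 2 : ℂ)).re) :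
    HasDerivAt (sqrtMulBesselK ζ c) (-(c / 2) * besselK 0 (c * (ζ * s ^ (1 / 2 : ℂ)))) s := by
  have h0 := Complex.slitPlane_ne_zero hs
  have hc' : (c : ℂ) ≠ 0 := by exact_mod_cast hc.ne'
  have hζ0 : ζ ≠ 0 := by rintro rfl; simp at hζ
  have hre' : 0 < ((c : ℂ) * (ζ * s ^ (1 / 2 : ℂ))).re := by
    rw [Complex.re_ofReal_mul]; positivity
  have h1 : HasDerivAt (fun s : ℂ => (c : ℂ) * (ζ * s ^ (1 / 2 : ℂ)))
      (c * (ζ * (s ^ (1 / 2 : ℂ) / (2 * s)))) s := ((hasDerivAt_sqrt hs).const_mul ζ).const_mul _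
  have h2 := (HasDerivAt.comp s (hasDerivAt_mul_besselK_one hre') h1).const_mul
    ((starRingEnd ℂ) ζ / (c * ζ))
  have h3 := h2.congr_deriv (g' := -(c / 2) * besselK 0 (c * (ζ * s ^ (1 / 2 : ℂ)))) ?_
  · refine h3.congr_of_eventuallyEq (Eventually.of_forall fun z => ?_)
    simp only [sqrtMulBesselK, Function.comp]
    field_simp
  · have hsq : s ^ (1 / 2 : ℂ) * s ^ (1 / 2 : ℂ) = s := by
      rw [← Complex.cpow_add _ _ h0]
      norm_num
    generalize besselK 0 (c * (ζ * s ^ (1 / 2 : ℂ))) = K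
    generalize s ^ (1 / 2 : ℂ) = q at hsq
    have e : (starRingEnd ℂ) ζ / (c * ζ) * (-(c * (ζ * q) * K) * (c * (ζ * (q / (2 * s))))) =
        -(c / 2) * K * (ζ * (starRingEnd ℂ) ζ) * (q * q / s) := by
      field_simp
    rw [e, hζ, hsq, div_self h0]
    ring

/-- The `n`-th term of the series over the periodic orbits for `ln Z`. -/
noncomputable def orbitTerm (n : ℕ+) (s : ℂ) : ℂ :=
  -(2 * ((n : ℕ).divisors.card : ℂ) / (Real.sqrt n : ℂ)) *
    (sqrtMulBesselK expQuarter (4 * Real.pi * Real.sqrt n) s +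
      sqrtMulBesselK ((starRingEnd ℂ) expQuarter) (4 * Real.pi * Real.sqrt n) s)

theorem two_pi_rpow_three_halves :
    (2 * Real.pi) ^ (3 / 2 : ℝ) = 2 * Real.pi * Real.sqrt (2 * Real.pi) := by
  have := Real.pi_pos
  rw [Real.sqrt_eq_rpow, show (3 / 2 : ℝ) = 1 + 1 / 2 by norm_num,
    Real.rpow_add (by positivity), Real.rpow_one]

/-- Translation from orbit lengths ℓ = 2π/n: 2(2π)^{3/2}√(s/ℓ) = 4π√n √s and √(2/π)√ℓ = 2/√n. -/
theorem mul_logZTerm_eq_orbitTerm (n : ℕ+) (s : ℂ) :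
    -(Real.sqrt (2 / Real.pi) : ℂ) * s ^ (1 / 2 : ℂ) * logZTerm s n = orbitTerm n s := by
  have hpi := Real.pi_pos
  have hn : (0 : ℝ) < n := by exact_mod_cast n.pos
  have h2pi : (0 : ℝ) < Real.sqrt (2 * Real.pi) := Real.sqrt_pos.2 (by positivity)
  have hw : 2 * (((2 * Real.pi) ^ (3 / 2 : ℝ) : ℝ) : ℂ) * (s / orbitLength n) ^ (1 / 2 : ℂ) =
      ((4 * Real.pi * Real.sqrt n : ℝ) : ℂ) * s ^ (1 / 2 : ℂ) := by
    have e : s / (orbitLength n : ℂ) = (((n : ℝ) / (2 * Real.pi) : ℝ) : ℂ) * s := by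
      rw [orbitLength]
      push_cast
      field_simp
    rw [e, sqrt_ofReal_mul (by positivity), two_pi_rpow_three_halves, Real.sqrt_div hn.le]
    have : (Real.sqrt (2 * Real.pi) : ℂ) ≠ 0 := by exact_mod_cast h2pi.ne'
    push_cast
    field_simp
    ring
  have hc : Real.sqrt (2 / Real.pi) * Real.sqrt (orbitLength n) = 2 / Real.sqrt n := by
    rw [orbitLength, ← Real.sqrt_mul (by positivity),
      show 2 / Real.pi * (2 * Real.pi / n) = 2 ^ 2 / n by field_simp,
      Real.sqrt_div (by norm_num), Real.sqrt_sq (by norm_num)]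
  have hc' : (Real.sqrt (2 / Real.pi) : ℂ) * (Real.sqrt (orbitLength n) : ℂ) =
      2 / (Real.sqrt n : ℂ) := by exact_mod_cast hc
  simp only [logZTerm]
  rw [hw, ← conj_expQuarter, ← expQuarter, orbitTerm, sqrtMulBesselK, sqrtMulBesselK,
    Complex.conj_conj, mul_assoc _ _ expQuarter, mul_assoc _ _ ((starRingEnd ℂ) expQuarter),
    mul_comm _ expQuarter, mul_comm _ ((starRingEnd ℂ) expQuarter)]
  linear_combination (-(((n : ℕ).divisors.card : ℂ)) * s ^ (1 / 2 : ℂ) *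
    ((starRingEnd ℂ) expQuarter * besselK 1 (((4 * Real.pi * Real.sqrt n : ℝ) : ℂ) *
      (expQuarter * s ^ (1 / 2 : ℂ))) + expQuarter * besselK 1
        (((4 * Real.pi * Real.sqrt n : ℝ) : ℂ) *
          ((starRingEnd ℂ) expQuarter * s ^ (1 / 2 : ℂ))))) * hc'

theorem hasDerivAt_orbitTerm (n : ℕ+) {s : ℂ} (hs : 0 < s.re) :
    HasDerivAt (orbitTerm n) (4 * Real.pi * ((n : ℕ).divisors.card : ℂ) *
      (besselK 0 ((4 * Real.pi * Real.sqrt n : ℝ) * (expQuarter * s ^ (1 / 2 : ℂ))) +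
        besselK 0 ((4 * Real.pi * Real.sqrt n : ℝ) *
          ((starRingEnd ℂ) expQuarter * s ^ (1 / 2 : ℂ))))) s := by
  have hpi := Real.pi_pos
  have hn : (0 : ℝ) < Real.sqrt n := Real.sqrt_pos.2 (by exact_mod_cast n.pos)
  have hs' : s ∈ Complex.slitPlane := Or.inl hs
  have h1 := hasDerivAt_sqrtMulBesselK (ζ := expQuarter)
    (c := 4 * Real.pi * Real.sqrt n) (by positivity) hs' expQuarter_mul_conj
    (expQuarter_mul_re_pos hs)
  have h2 := hasDerivAt_sqrtMulBesselK (ζ := (starRingEnd ℂ) expQuarter)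
    (c := 4 * Real.pi * Real.sqrt n) (by positivity) hs'
    (by rw [Complex.conj_conj, mul_comm, expQuarter_mul_conj]) (conj_expQuarter_mul_re_pos hs)
  refine ((h1.add h2).const_mul _).congr_deriv ?_
  have hn' : (Real.sqrt n : ℂ) ≠ 0 := by exact_mod_cast hn.ne'
  push_cast
  field_simp
  ring

theorem norm_sqrtMulBesselK_le {ζ s : ℂ} {c ρ : ℝ} (hc : 0 < c) (hρ : 0 < ρ)
    (hζ : ‖ζ‖ = 1) (hre : ρ ≤ (ζ * s ^ (1 / 2 : ℂ)).re) {m : ℕ} (hm : 2 ≤ m) :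
    ‖sqrtMulBesselK ζ c s‖ ≤ ‖s ^ (1 / 2 : ℂ)‖ * (2 * m.factorial / (c * ρ) ^ m) := by
  have hre' : c * ρ ≤ ((c : ℂ) * (ζ * s ^ (1 / 2 : ℂ))).re := by
    rw [Complex.re_ofReal_mul]
    gcongr
  rw [sqrtMulBesselK, norm_mul, norm_mul, RCLike.norm_conj, hζ, one_mul]
  have hcρ : 0 < c * ρ := by positivity
  gcongr
  refine (norm_besselK_one_le (hcρ.trans_le hre') hm).trans ?_
  gcongr

/-- The inverse fourth power bound on K₁, at an argument of size √n, already gives n⁻² against d(n);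
the exponential decay is not needed. -/
theorem norm_orbitTerm_le (n : ℕ+) {s : ℂ} {ρ : ℝ} (hρ : 0 < ρ)
    (h1 : ρ ≤ (expQuarter * s ^ (1 / 2 : ℂ)).re)
    (h2 : ρ ≤ ((starRingEnd ℂ) expQuarter * s ^ (1 / 2 : ℂ)).re) :
    ‖orbitTerm n s‖ ≤ 192 * ‖s ^ (1 / 2 : ℂ)‖ / ρ ^ 4 *
      (((n : ℕ).divisors.card : ℝ) * (1 / ((n : ℕ) : ℝ) ^ (2 : ℝ))) := by
  have hpi := Real.pi_gt_three
  have hn1 : (1 : ℝ) ≤ n := by exact_mod_cast n.pos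
  have hsn : 1 ≤ Real.sqrt n := Real.one_le_sqrt.2 hn1
  have hsn2 : Real.sqrt n ^ 4 = (n : ℝ) ^ 2 := by
    rw [show 4 = 2 * 2 by norm_num, pow_mul, Real.sq_sqrt (by positivity)]
  have hc : 0 < 4 * Real.pi * Real.sqrt n := by positivity
  have b1 := norm_sqrtMulBesselK_le hc hρ norm_expQuarter h1 (m := 4) (by norm_num)
  have b2 := norm_sqrtMulBesselK_le hc hρ (by rw [RCLike.norm_conj, norm_expQuarter]) h2 (m := 4)
    (by norm_num)
  have e : (2 * (Nat.factorial 4 : ℝ) / (4 * Real.pi * Real.sqrt n * ρ) ^ 4) ≤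
      48 / (ρ ^ 4 * (n : ℝ) ^ 2) := by
    have h3 : (Nat.factorial 4 : ℝ) = 24 := by norm_num [Nat.factorial]
    rw [h3, mul_pow, mul_pow, hsn2, show (2 * 24 : ℝ) = 48 by norm_num]
    have : (1 : ℝ) ≤ (4 * Real.pi) ^ 4 := one_le_pow₀ (by linarith)
    gcongr 48 / ?_
    calc ρ ^ 4 * (n : ℝ) ^ 2 = 1 * (n : ℝ) ^ 2 * ρ ^ 4 := by ring
      _ ≤ _ := by gcongr
  have hS := norm_nonneg (s ^ (1 / 2 : ℂ))
  have hd : ‖(-(2 * ((n : ℕ).divisors.card : ℂ) / (Real.sqrt n : ℂ)))‖ ≤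
      2 * ((n : ℕ).divisors.card : ℝ) := by
    rw [norm_neg, norm_div, norm_mul, Complex.norm_real, Complex.norm_natCast,
      Real.norm_of_nonneg (by positivity)]
    simpa using div_le_self (by positivity) hsn
  rw [orbitTerm, norm_mul, Real.rpow_two]
  calc _ ≤ 2 * ((n : ℕ).divisors.card : ℝ) * (‖s ^ (1 / 2 : ℂ)‖ * (48 / (ρ ^ 4 * (n : ℝ) ^ 2)) +
        ‖s ^ (1 / 2 : ℂ)‖ * (48 / (ρ ^ 4 * (n : ℝ) ^ 2))) := by
        refine mul_le_mul hd ((norm_add_le _ _).trans (add_le_add (b1.trans ?_) (b2.trans ?_)))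
          (norm_nonneg _) (by positivity) <;> gcongr
    _ = _ := by field_simp; ring

/-- The rotated roots stay at distance ρ to the right of the imaginary axis near s, so the termwise
bound is locally uniform and the series may be differentiated term by term. -/
theorem exists_orbitTerm_bound {s : ℂ} (hs : 0 < s.re) :
    ∃ (U : Set ℂ) (C : ℝ), IsOpen U ∧ s ∈ U ∧ U ⊆ {z : ℂ | 0 < z.re} ∧ ∀ (n : ℕ+), ∀ z ∈ U,
      ‖orbitTerm n z‖ ≤ C * (((n : ℕ).divisors.card : ℝ) * (1 / ((n : ℕ) : ℝ) ^ (2 : ℝ))) := by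
  have hq : ContinuousAt (fun z : ℂ => z ^ (1 / 2 : ℂ)) s := (hasDerivAt_sqrt (Or.inl hs)).continuousAt
  obtain ⟨ρ, hρ, hρ1⟩ := exists_between (lt_min (expQuarter_mul_re_pos hs)
    (conj_expQuarter_mul_re_pos hs))
  have c1 : ContinuousAt (fun z : ℂ => (expQuarter * z ^ (1 / 2 : ℂ)).re) s := by fun_prop
  have c2 : ContinuousAt (fun z : ℂ => ((starRingEnd ℂ) expQuarter * z ^ (1 / 2 : ℂ)).re) s := by
    fun_prop
  have hev : ∀ᶠ z in 𝓝 s, 0 < z.re ∧ ρ < (expQuarter * z ^ (1 / 2 : ℂ)).re ∧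
      ρ < ((starRingEnd ℂ) expQuarter * z ^ (1 / 2 : ℂ)).re ∧
        ‖z ^ (1 / 2 : ℂ)‖ < ‖s ^ (1 / 2 : ℂ)‖ + 1 := by
    filter_upwards [(isOpen_lt continuous_const Complex.continuous_re).mem_nhds hs,
      c1.eventually_const_lt (hρ1.trans_le (min_le_left _ _)),
      c2.eventually_const_lt (hρ1.trans_le (min_le_right _ _)),
      hq.norm.eventually_lt_const (lt_add_one _)] with z h1 h2 h3 h4
    exact ⟨h1, h2, h3, h4⟩
  obtain ⟨U, hU, hUo, hsU⟩ := eventually_nhds_iff.1 hev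
  refine ⟨U, 192 * (‖s ^ (1 / 2 : ℂ)‖ + 1) / ρ ^ 4, hUo, hsU, fun z hz => (hU z hz).1,
    fun n z hz => ?_⟩
  obtain ⟨-, h2, h3, h4⟩ := hU z hz
  refine (norm_orbitTerm_le n hρ h2.le h3.le).trans ?_
  gcongr

theorem summable_orbitTerm {s : ℂ} (hs : 0 < s.re) : Summable fun n => orbitTerm n s := by
  obtain ⟨U, C, -, hsU, -, h⟩ := exists_orbitTerm_bound hs
  exact Summable.of_norm_bounded ((summable_card_divisors_mul_rpow one_lt_two).mul_left C)
    fun n => h n s hsU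

/-- The series over the periodic orbits for `ln Z`. -/
noncomputable def orbitSum (s : ℂ) : ℂ := ∑' n, orbitTerm n s

theorem hasSum_deriv_orbitTerm {s : ℂ} (hs : 0 < s.re) :
    DifferentiableAt ℂ orbitSum s ∧
      HasSum (fun n => deriv (orbitTerm n) s) (deriv orbitSum s) := by
  obtain ⟨U, C, hUo, hsU, hU, h⟩ := exists_orbitTerm_bound hs
  have hu := (summable_card_divisors_mul_rpow one_lt_two).mul_left C
  have hd : ∀ n, DifferentiableOn ℂ (orbitTerm n) U := fun n z hz =>
    (hasDerivAt_orbitTerm n (hU hz)).differentiableAt.differentiableWithinAt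
  exact ⟨(Complex.differentiableOn_tsum_of_summable_norm hu hd hUo h).differentiableAt
    (hUo.mem_nhds hsU), Complex.hasSum_deriv_of_summable_norm hu hd hUo h hsU⟩

theorem analyticOnNhd_orbitSum : AnalyticOnNhd ℂ orbitSum {s : ℂ | 0 < s.re} :=
  DifferentiableOn.analyticOnNhd
    (fun _ hs => (hasSum_deriv_orbitTerm hs).1.differentiableWithinAt)
    (isOpen_lt continuous_const Complex.continuous_re)

/-! ### The periodic-orbit term on the positive half-line -/

theorem conj_mul_ofReal_mul (c : ℝ) (ζ : ℂ) (q : ℝ) :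
    (c : ℂ) * ((starRingEnd ℂ) ζ * (q : ℂ)) = (starRingEnd ℂ) (c * (ζ * q)) := by
  rw [map_mul, map_mul, Complex.conj_ofReal, Complex.conj_ofReal]

theorem orbitTerm_ofReal (n : ℕ+) {s : ℝ} (hs : 0 < s) :
    orbitTerm n s = ((-(4 * Real.sqrt s * ((n : ℕ).divisors.card : ℝ) / Real.sqrt n *
      besselPhi (2 * Real.pi * Real.sqrt (n * s))) : ℝ) : ℂ) := by
  have hn : (0 : ℝ) < n := by exact_mod_cast n.pos
  have e1 : sqrtMulBesselK expQuarter (4 * Real.pi * Real.sqrt n) s = (Real.sqrt s : ℂ) *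
      ((starRingEnd ℂ) expQuarter * besselK 1
        (2 * (2 * Real.pi * Real.sqrt (n * s) : ℝ) * expQuarter)) := by
    rw [sqrtMulBesselK, ofReal_sqrt_eq hs.le, Real.sqrt_mul hn.le]
    congr 3
    push_cast
    ring
  have e2 : sqrtMulBesselK ((starRingEnd ℂ) expQuarter) (4 * Real.pi * Real.sqrt n) s =
      (starRingEnd ℂ) (sqrtMulBesselK expQuarter (4 * Real.pi * Real.sqrt n) s) := by
    rw [sqrtMulBesselK, sqrtMulBesselK, ofReal_sqrt_eq hs.le, conj_mul_ofReal_mul,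
      besselK_conj 1 (map_one _), map_mul, map_mul, Complex.conj_ofReal]
  have hn' : (Real.sqrt n : ℂ) ≠ 0 := by exact_mod_cast (Real.sqrt_pos.2 hn).ne'
  rw [orbitTerm, e2, Complex.add_conj, e1, Complex.re_ofReal_mul, ← besselPhi]
  push_cast
  field_simp
  ring

/-- Unfold d(n) into pairs n = ab. For fixed a, the sum over b is the Fourier series of the
trapezoidal error at x = 2πsa. The n⁻² bound makes the double series absolutely summable, so it may
be summed in this order. -/
theorem orbitSum_ofReal {s : ℝ} (hs : 0 < s) :
    orbitSum s = ((-∑' a : ℕ+, 1 / (a : ℝ) * trapError (2 * Real.pi * s * a) : ℝ) : ℂ) := by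
  have hpi := Real.pi_gt_three
  set f : ℕ+ → ℝ := fun n => -(4 * Real.sqrt s / Real.sqrt n *
    besselPhi (2 * Real.pi * Real.sqrt (n * s))) with hf
  have hbound : ∀ n : ℕ+, ‖f n‖ ≤ 4 * Real.sqrt s * (48 / s ^ 2) * (1 / ((n : ℕ) : ℝ) ^ (2 : ℝ)) := by
    intro n
    have hn1 : (1 : ℝ) ≤ n := by exact_mod_cast n.pos
    have hsn : 1 ≤ Real.sqrt n := Real.one_le_sqrt.2 hn1
    have hns : 0 < Real.sqrt (n * s) := Real.sqrt_pos.2 (by positivity)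
    have h := abs_besselPhi_le (y := 2 * Real.pi * Real.sqrt (n * s)) (by positivity) (m := 4)
      (by norm_num)
    have h3 : (Nat.factorial 4 : ℝ) = 24 := by norm_num [Nat.factorial]
    have h4 : Real.sqrt (n * s) ^ 4 = (n : ℝ) ^ 2 * s ^ 2 := by
      rw [show 4 = 2 * 2 by norm_num, pow_mul, Real.sq_sqrt (by positivity), mul_pow]
    have h5 : (1 : ℝ) ≤ (2 * Real.pi) ^ 4 := one_le_pow₀ (by linarith)
    rw [h3, mul_pow, h4] at h
    have h6 : (2 * 24 : ℝ) / ((2 * Real.pi) ^ 4 * ((n : ℝ) ^ 2 * s ^ 2)) ≤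
        48 / (1 * ((n : ℝ) ^ 2 * s ^ 2)) := by
      norm_num only
      gcongr
    have h7 : 4 * Real.sqrt s / Real.sqrt n ≤ 4 * Real.sqrt s :=
      div_le_self (by positivity) hsn
    simp only [hf]
    rw [norm_neg, norm_mul, Real.norm_of_nonneg (by positivity), Real.norm_eq_abs, Real.rpow_two]
    calc _ ≤ 4 * Real.sqrt s * (48 / (1 * ((n : ℝ) ^ 2 * s ^ 2))) :=
          mul_le_mul h7 (h.trans h6) (abs_nonneg _) (by positivity)
      _ = _ := by field_simp
  have hsum := summable_prod_of_norm_le one_lt_two hbound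
  have h1 := hasSum_card_divisors_mul hsum.hasSum
  have h2 : orbitSum s = ((∑' p : ℕ+ × ℕ+, f (p.1 * p.2) : ℝ) : ℂ) := by
    refine HasSum.tsum_eq ((Complex.hasSum_ofReal.2 h1).congr_fun fun n => ?_)
    rw [orbitTerm_ofReal n hs]
    simp only [hf]
    push_cast
    ring
  rw [h2]
  congr 1
  have h3 : ∀ a : ℕ+, HasSum (fun b : ℕ+ => f (a * b))
      (-(1 / (a : ℝ) * trapError (2 * Real.pi * s * a))) := by
    intro a
    have ha : (0 : ℝ) < a := by exact_mod_cast a.pos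
    refine ((hasSum_trapError (x := 2 * Real.pi * s * a) (by positivity)).mul_left
      (1 / (a : ℝ))).neg.congr_fun fun b => ?_
    have hb : (0 : ℝ) < b := by exact_mod_cast b.pos
    have e : Real.sqrt (2 * Real.pi * b * (2 * Real.pi * s * a)) =
        2 * Real.pi * Real.sqrt ((a * b : ℕ+) * s) := by
      rw [show 2 * Real.pi * b * (2 * Real.pi * s * a) =
        (2 * Real.pi) ^ 2 * ((a * b : ℕ+) * s) by push_cast; ring,
        Real.sqrt_mul (by positivity), Real.sqrt_sq (by positivity)]
    simp only [hf]
    rw [e, neg_inj, ← mul_assoc]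
    congr 1
    rw [PNat.mul_coe, Nat.cast_mul, Real.sqrt_mul (by positivity) s]
    have h8 : Real.sqrt (a * b) * Real.sqrt (a * b) = a * b := Real.mul_self_sqrt (by positivity)
    have h9 : 0 < Real.sqrt ((a : ℝ) * b) := Real.sqrt_pos.2 (by positivity)
    field_simp
    linear_combination (-4 : ℝ) * h8
  rw [← tsum_neg]
  exact (hsum.hasSum.prod_fiberwise h3).tsum_eq.symm

theorem poIntegrand_eq (n : ℕ+) (k p : ℝ) :
    poIntegrand n k p = (2 / Real.pi * (besselK 0
      (((4 * Real.pi * Real.sqrt n) * Real.sqrt p : ℝ) : ℂ)).re -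
        besselY0 ((4 * Real.pi * Real.sqrt n) * Real.sqrt p)) / (p ^ 2 + k ^ 2) := by
  rw [poIntegrand, Real.sqrt_mul (Nat.cast_nonneg _), mul_assoc (4 * Real.pi)]

theorem integrableOn_poIntegrand (n : ℕ+) {k : ℝ} (hk : 0 < k) :
    IntegrableOn (poIntegrand n k) (Ioi 0) := by
  have hpi := Real.pi_pos
  have hn : (0 : ℝ) < Real.sqrt n := Real.sqrt_pos.2 (by exact_mod_cast n.pos)
  rw [funext (poIntegrand_eq n k)]
  exact (integral_besselK_sub_besselY (by positivity) hk).1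

theorem poTerm_eq (n : ℕ+) {k : ℝ} (hk : 0 < k) :
    poTerm k n = ((n : ℕ).divisors.card : ℝ) * (2 / k *
      (besselK 0 ((4 * Real.pi * Real.sqrt n : ℝ) * (expQuarter * Real.sqrt k))).re) := by
  have hpi := Real.pi_pos
  have hn : (0 : ℝ) < Real.sqrt n := Real.sqrt_pos.2 (by exact_mod_cast n.pos)
  rw [poTerm, funext (poIntegrand_eq n k), (integral_besselK_sub_besselY (by positivity) hk).2]

theorem deriv_orbitTerm_ofReal (n : ℕ+) {k : ℝ} (hk : 0 < k) :
    deriv (orbitTerm n) k = ((4 * Real.pi * k * poTerm k n : ℝ) : ℂ) := by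
  rw [(hasDerivAt_orbitTerm n (s := k) (by simpa using hk)).deriv, ofReal_sqrt_eq hk.le,
    conj_mul_ofReal_mul, besselK_conj 0 (map_zero _), Complex.add_conj, poTerm_eq n hk]
  have hk' : (k : ℂ) ≠ 0 := by exact_mod_cast hk.ne'
  push_cast
  field_simp

/-- The terms of T^po are the termwise derivatives of the orbit series divided by 4πk, so
convergence and value both come from differentiating that series. -/
theorem hasSum_poTerm {k : ℝ} (hk : 0 < k) :
    Summable (poTerm k) ∧ deriv orbitSum k = ((2 * (k * Tpo k) : ℝ) : ℂ) := by
  have hpi := Real.pi_pos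
  have h := (hasSum_deriv_orbitTerm (s := k) (by simpa using hk)).2
  have h1 : HasSum (fun n => ((4 * Real.pi * k * poTerm k n : ℝ) : ℂ)) (deriv orbitSum k) :=
    h.congr_fun fun n => (deriv_orbitTerm_ofReal n hk).symm
  have hs := Complex.summable_ofReal.1 h1.summable
  have hs2 : Summable (poTerm k) := (summable_mul_left_iff (by positivity)).1 hs
  refine ⟨hs2, ?_⟩
  rw [← h1.tsum_eq, ← Complex.ofReal_tsum, tsum_mul_left, Tpo]
  congr 1
  ring

theorem expQuarter_mul_sqrt_ge {k : ℝ} (hk : 0 < k) :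
    Real.sqrt k / 2 ≤ (expQuarter * (k : ℂ) ^ (1 / 2 : ℂ)).re ∧
      Real.sqrt k / 2 ≤ ((starRingEnd ℂ) expQuarter * (k : ℂ) ^ (1 / 2 : ℂ)).re := by
  have h2 : 1 ≤ Real.sqrt 2 := Real.one_le_sqrt.2 (by norm_num)
  have hk2 := Real.sqrt_nonneg k
  have h1 : (expQuarter * (Real.sqrt k : ℂ)).re = Real.sqrt 2 / 2 * Real.sqrt k := by
    rw [(mul_expQuarter_re_im _).1]
    simp
  have h3 : ((starRingEnd ℂ) expQuarter * (Real.sqrt k : ℂ)).re = Real.sqrt 2 / 2 * Real.sqrt k := by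
    rw [← h1, ← Complex.conj_re, map_mul, Complex.conj_conj, Complex.conj_ofReal]
  rw [ofReal_sqrt_eq hk.le, h1, h3]
  constructor <;> nlinarith

/-- Decay at infinity fixes the constant of integration. The termwise bound with ρ = √k/2 yields
order k^{-3/2}, weakened here to k⁻¹; 3072 = 192 · 2⁴. -/
theorem tendsto_orbitSum : Tendsto (fun k : ℝ => orbitSum k) atTop (𝓝 0) := by
  set S := ∑' n : ℕ+, ((n : ℕ).divisors.card : ℝ) * (1 / ((n : ℕ) : ℝ) ^ (2 : ℝ)) with hS
  have hS0 : 0 ≤ S := tsum_nonneg fun n => by positivity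
  have h0 : Tendsto (fun k : ℝ => 3072 * S * k⁻¹) atTop (𝓝 0) := by
    simpa using tendsto_inv_atTop_zero.const_mul (3072 * S)
  refine squeeze_zero_norm' ?_ h0
  filter_upwards [eventually_ge_atTop 1] with k hk
  have hk0 : 0 < k := by linarith
  obtain ⟨b1, b2⟩ := expQuarter_mul_sqrt_ge hk0
  have hq : 0 < Real.sqrt k := Real.sqrt_pos.2 hk0
  have h := (summable_card_divisors_mul_rpow one_lt_two).hasSum.mul_left
    (192 * ‖(k : ℂ) ^ (1 / 2 : ℂ)‖ / (Real.sqrt k / 2) ^ 4)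
  refine (tsum_of_norm_bounded h fun n => norm_orbitTerm_le n (half_pos hq) b1 b2).trans ?_
  rw [← hS, ofReal_sqrt_eq hk0.le, Complex.norm_real, Real.norm_of_nonneg hq.le]
  have h4 : Real.sqrt k ^ 4 = k ^ 2 := by
    rw [show 4 = 2 * 2 by norm_num, pow_mul, Real.sq_sqrt hk0.le]
  have h5 : Real.sqrt k ≤ k := by
    rw [Real.sqrt_le_left hk0.le]
    nlinarith
  have e : 192 * Real.sqrt k / (Real.sqrt k / 2) ^ 4 * S = 3072 * S * (Real.sqrt k / k ^ 2) := by
    rw [div_pow, h4]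
    field_simp
    ring
  have e2 : k⁻¹ = k / k ^ 2 := by field_simp
  rw [e, e2]
  gcongr

/-- Again the fourth inverse power, now of K₀: it supplies n⁻² for the sum over n and k⁻² for
integrability at infinity. -/
theorem abs_mul_Tpo_le {k : ℝ} (hk : 0 < k) :
    |k * Tpo k| ≤ 4 * Real.pi * (∑' n : ℕ+, ((n : ℕ).divisors.card : ℝ) *
      (1 / ((n : ℕ) : ℝ) ^ (2 : ℝ))) * 48 * k ^ (-2 : ℝ) := by
  have hpi := Real.pi_gt_three
  have h := (summable_card_divisors_mul_rpow one_lt_two).hasSum.mul_left (2 / k * (48 * k ^ (-2 : ℝ)))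
  have hb : ∀ n : ℕ+, ‖poTerm k n‖ ≤ 2 / k * (48 * k ^ (-2 : ℝ)) *
      (((n : ℕ).divisors.card : ℝ) * (1 / ((n : ℕ) : ℝ) ^ (2 : ℝ))) := by
    intro n
    have hn : (0 : ℝ) < n := by exact_mod_cast n.pos
    have b := (expQuarter_mul_sqrt_ge hk).1
    rw [ofReal_sqrt_eq hk.le] at b
    have hre : Real.sqrt n * Real.sqrt k ≤
        (((4 * Real.pi * Real.sqrt n : ℝ) : ℂ) * (expQuarter * Real.sqrt k)).re := by
      rw [Complex.re_ofReal_mul]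
      have hq : 0 ≤ Real.sqrt n * Real.sqrt k := by positivity
      calc Real.sqrt n * Real.sqrt k ≤ 4 * Real.pi * (Real.sqrt n * Real.sqrt k) / 2 := by
            nlinarith
        _ = 4 * Real.pi * Real.sqrt n * (Real.sqrt k / 2) := by ring
        _ ≤ _ := by gcongr
    have hpos : 0 < Real.sqrt n * Real.sqrt k := by positivity
    have hK := norm_besselK_zero_le (hpos.trans_le hre) (m := 4) (by norm_num)
    have h3 : (Nat.factorial 4 : ℝ) = 24 := by norm_num [Nat.factorial]
    have h4 : (Real.sqrt n * Real.sqrt k) ^ 4 = (n : ℝ) ^ 2 * k ^ 2 := by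
      rw [mul_pow, show 4 = 2 * 2 by norm_num, pow_mul, pow_mul, Real.sq_sqrt hn.le,
        Real.sq_sqrt hk.le]
    rw [poTerm_eq n hk, norm_mul, norm_mul, Real.norm_of_nonneg (by positivity),
      Real.norm_of_nonneg (by positivity), Real.rpow_neg hk.le, Real.rpow_two, Real.rpow_two]
    calc _ ≤ ((n : ℕ).divisors.card : ℝ) * (2 / k * (2 * (Nat.factorial 4) /
          (Real.sqrt n * Real.sqrt k) ^ 4)) := by
          gcongr
          refine (Complex.abs_re_le_norm _).trans (hK.trans ?_)
          gcongr
      _ = _ := by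
          rw [h3, h4]
          field_simp
          norm_num
  have hT := tsum_of_norm_bounded h hb
  rw [Tpo, abs_mul, abs_mul, abs_of_pos hk, abs_of_pos (by positivity : 0 < 2 * Real.pi)]
  calc _ ≤ k * (2 * Real.pi * (2 / k * (48 * k ^ (-2 : ℝ)) * ∑' n : ℕ+, ((n : ℕ).divisors.card : ℝ) *
      (1 / ((n : ℕ) : ℝ) ^ (2 : ℝ)))) := by gcongr; exact hT
    _ = _ := by field_simp; ring

theorem integrableOn_mul_Tpo {s : ℝ} (hs : 0 < s) :
    IntegrableOn (fun k : ℝ => k * Tpo k) (Ioi s) := by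
  refine Integrable.mono' ((integrableOn_Ioi_rpow_of_lt (a := -2) (by norm_num) hs).const_mul
    (4 * Real.pi * (∑' n : ℕ+, ((n : ℕ).divisors.card : ℝ) *
      (1 / ((n : ℕ) : ℝ) ^ (2 : ℝ))) * 48)) ?_ ?_
  -- Measurability: kT^po(k) is half the derivative of an analytic function on the half-line, hence
  -- continuous.
  · have h1 : ContinuousOn (fun k : ℝ => (deriv orbitSum k).re / 2) (Ioi s) := by
      intro k hk
      have hk0 : 0 < k := hs.trans hk
      have := (analyticOnNhd_orbitSum.deriv (k : ℂ) (by simpa using hk0)).continuousAt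
      have h2 : ContinuousAt (fun k : ℝ => deriv orbitSum k) k :=
        ContinuousAt.comp (f := fun k : ℝ => (k : ℂ)) this Complex.continuous_ofReal.continuousAt
      exact ((Complex.continuous_re.continuousAt.comp h2).div_const 2).continuousWithinAt
    refine (h1.congr fun k hk => ?_).aestronglyMeasurable measurableSet_Ioi
    rw [(hasSum_poTerm (hs.trans hk)).2, Complex.ofReal_re]
    ring
  · filter_upwards [ae_restrict_mem measurableSet_Ioi] with k hk
    exact abs_mul_Tpo_le (hs.trans hk)

/-- The fundamental theorem of calculus on (s, ∞) for the real part; that the orbit series is real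
there is known from its form as a sum of trapezoidal errors. -/
theorem orbitSum_eq_integral {s : ℝ} (hs : 0 < s) :
    orbitSum s = ((-2 * ∫ k in Ioi s, k * Tpo k : ℝ) : ℂ) := by
  have hre : ∀ k : ℝ, 0 < k → HasDerivAt (fun k : ℝ => (orbitSum k).re) (2 * (k * Tpo k)) k := by
    intro k hk
    have h1 := (hasSum_deriv_orbitTerm (s := k) (by simpa using hk)).1.hasDerivAt.real_of_complex
    rwa [(hasSum_poTerm hk).2, Complex.ofReal_re] at h1
  have h := integral_Ioi_of_hasDerivAt_of_tendsto' (a := s) (m := 0)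
    (fun k hk => hre k (hs.trans_le hk)) ((integrableOn_mul_Tpo hs).const_mul 2)
    ((Complex.continuous_re.tendsto 0).comp tendsto_orbitSum)
  rw [integral_const_mul] at h
  have h2 := orbitSum_ofReal hs
  rw [h2, Complex.ofReal_re] at h
  rw [h2]
  congr 1
  linarith

theorem exp_orbitSum {s : ℝ} (hs : 0 < s) :
    orbitSum s = (Real.log (Zpo s) : ℂ) ∧ Complex.exp (orbitSum s) = (Zpo s : ℂ) := by
  have h : orbitSum s = (Real.log (Zpo s) : ℂ) := by
    rw [Zpo, Real.log_exp, orbitSum_eq_integral hs]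
  refine ⟨h, ?_⟩
  rw [h, ← Complex.ofReal_exp, Real.exp_log (show 0 < Zpo s from Real.exp_pos _)]

/-! ### The functional determinant as an infinite product -/

section QuadraticProduct

variable {ι : Type*} {w : ι → ℂ}

theorem summable_norm_sq_mul (hw : Summable fun i => ‖w i‖) (k : ℂ) :
    Summable fun i => ‖k ^ 2 * w i‖ := by
  simp only [norm_mul]
  exact hw.mul_left _

/-- On each disc |k| < R the factors are dominated by 1 + R²|wᵢ|, so the product converges locally
uniformly. -/
theorem differentiable_tprod_one_add_sq_mul (hw : Summable fun i => ‖w i‖) :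
    Differentiable ℂ fun k : ℂ => ∏' i, (1 + k ^ 2 * w i) := by
  intro k
  have hU : IsOpen (Metric.ball (0 : ℂ) (‖k‖ + 1)) := Metric.isOpen_ball
  have h := Summable.hasProdLocallyUniformlyOn_one_add (f := fun i (k : ℂ) => k ^ 2 * w i) hU
    (hw.mul_left ((‖k‖ + 1) ^ 2)) (Eventually.of_forall fun i z hz => ?_) (fun i => by fun_prop)
  · rw [hasProdLocallyUniformlyOn_iff_tendstoLocallyUniformlyOn] at h
    refine (h.differentiableOn (Eventually.of_forall fun t => ?_) hU).differentiableAt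
      (hU.mem_nhds (by simp))
    exact DifferentiableOn.fun_finsetProd fun i _ => by fun_prop
  · rw [norm_mul, norm_pow]
    have : ‖z‖ < ‖k‖ + 1 := by simpa using hz
    gcongr

theorem tprod_one_add_sq_mul_ne_zero (hw : Summable fun i => ‖w i‖) {k : ℂ}
    (hk : ∀ i, 1 + k ^ 2 * w i ≠ 0) : ∏' i, (1 + k ^ 2 * w i) ≠ 0 :=
  tprod_one_add_ne_zero_of_summable hk (summable_norm_sq_mul hw k)

/-- Isolates the finitely many factors that vanish at a given point; the complementary product
converges by the same criterion. -/
theorem prod_mul_tprod_compl_one_add_sq_mul (hw : Summable fun i => ‖w i‖) (S : Finset ι) (k : ℂ) :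
    ∏' i, (1 + k ^ 2 * w i) =
      (∏ i ∈ S, (1 + k ^ 2 * w i)) * ∏' i : ((S : Set ι)ᶜ : Set ι), (1 + k ^ 2 * w i) := by
  have hm : ∀ T : Set ι, Multipliable fun i : T => 1 + k ^ 2 * w i := fun T =>
    multipliable_one_add_of_summable
      ((summable_norm_sq_mul hw k).comp_injective Subtype.coe_injective)
  rw [← Finset.tprod_subtype' S fun i => 1 + k ^ 2 * w i]
  exact (Multipliable.tprod_mul_tprod_compl (f := fun i => 1 + k ^ 2 * w i) (hm _) (hm _)).symm

end QuadraticProduct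

/-- The reciprocal of the eigenvalue of `-Δ` with index `p`. -/
noncomputable def invEigenvalue (p : ℕ+ × ℕ+) : ℂ := 1 / ((p.1 * p.2 : ℕ+) : ℂ) ^ 2

theorem summable_norm_invEigenvalue : Summable fun p => ‖invEigenvalue p‖ := by
  set f : ℕ+ → ℝ := fun n => ‖1 / ((n : ℕ) : ℂ) ^ 2‖ with hf
  have h : Summable fun p : ℕ+ × ℕ+ => f (p.1 * p.2) := by
    refine summable_prod_of_norm_le (C := 1) one_lt_two fun n => ?_
    rw [hf, norm_norm, norm_div, norm_one, norm_pow, Complex.norm_natCast, Real.rpow_two, one_mul]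
  exact h

/-- The determinant `det(-Δ + k²)`. -/
noncomputable def spectralDet (k : ℂ) : ℂ :=
  1 / (2 * Real.pi) * ∏' p, (1 + k ^ 2 * invEigenvalue p)

theorem differentiable_spectralDet : Differentiable ℂ spectralDet :=
  (differentiable_tprod_one_add_sq_mul summable_norm_invEigenvalue).const_mul _

theorem one_add_sq_mul_inv_sq_eq_zero_iff {m : ℕ+} {k : ℂ} :
    1 + k ^ 2 * (1 / (m : ℂ) ^ 2) = 0 ↔ k = m * Complex.I ∨ k = -(m * Complex.I) := by
  have hm : (m : ℂ) ≠ 0 := by exact_mod_cast m.ne_zero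
  rw [← sq_eq_sq_iff_eq_or_eq_neg, mul_pow, Complex.I_sq]
  field_simp
  constructor <;> intro h <;> linear_combination h

theorem spectralDet_eq_zero_iff {k : ℂ} :
    spectralDet k = 0 ↔ ∃ n : ℕ+, k = n * Complex.I ∨ k = -(n * Complex.I) := by
  have hpi : (1 / (2 * Real.pi) : ℂ) ≠ 0 := by
    have := Real.pi_ne_zero
    exact one_div_ne_zero (mul_ne_zero two_ne_zero (by exact_mod_cast this))
  constructor
  · intro h
    by_contra hne
    refine tprod_one_add_sq_mul_ne_zero summable_norm_invEigenvalue (k := k) (fun p hp => ?_)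
      ((mul_eq_zero.1 h).resolve_left hpi)
    exact hne ⟨p.1 * p.2, one_add_sq_mul_inv_sq_eq_zero_iff.1 hp⟩
  · rintro ⟨n, hn⟩
    rw [spectralDet, prod_mul_tprod_compl_one_add_sq_mul summable_norm_invEigenvalue {(n, 1)},
      Finset.prod_singleton]
    have h := one_add_sq_mul_inv_sq_eq_zero_iff.2 hn
    rw [invEigenvalue, mul_one, h, zero_mul, mul_zero]

/-- The factorisations of `m` into two factors. -/
noncomputable def factorPairs (m : ℕ+) : Finset (ℕ+ × ℕ+) :=
  Finset.univ.map ⟨fun x : Nat.divisorsAntidiagonal m => sigmaAntidiagonalEquivProd ⟨m, x⟩,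
    fun x y h => by simpa using sigmaAntidiagonalEquivProd.injective h⟩

theorem card_factorPairs (m : ℕ+) : (factorPairs m).card = (m : ℕ).divisors.card := by
  rw [factorPairs, Finset.card_map, Finset.card_univ, Fintype.card_coe, card_divisorsAntidiagonal]

theorem mem_factorPairs {m : ℕ+} {p : ℕ+ × ℕ+} : p ∈ factorPairs m ↔ p.1 * p.2 = m := by
  rw [factorPairs, Finset.mem_map]
  constructor
  · rintro ⟨x, -, rfl⟩
    exact PNat.eq (divisorsAntidiagonalFactors_eq x)
  · rintro rfl
    exact ⟨(sigmaAntidiagonalEquivProd.symm p).2, Finset.mem_univ _,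
      sigmaAntidiagonalEquivProd.apply_symm_apply p⟩

/-- Exactly the factors with ab = m vanish at z. There are d(m) of them, each equal to (k - z)(k +
z)/m², with a simple zero because z ≠ 0. -/
theorem analyticOrderAt_spectralDet (m : ℕ+) {z : ℂ} (hz : z = m * Complex.I ∨ z = -(m * Complex.I)) :
    analyticOrderAt spectralDet z = ((m : ℕ).divisors.card : ℕ∞) := by
  have hpi : (1 / (2 * Real.pi) : ℂ) ≠ 0 := by
    have := Real.pi_ne_zero
    exact one_div_ne_zero (mul_ne_zero two_ne_zero (by exact_mod_cast this))
  have hm : (m : ℂ) ≠ 0 := by exact_mod_cast m.ne_zero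
  have hzz : z ^ 2 = -(m : ℂ) ^ 2 := by
    rcases hz with rfl | rfl <;> linear_combination (m : ℂ) ^ 2 * Complex.I_sq
  have hz0 : z ≠ 0 := by
    rintro rfl
    simp at hzz
  set T : Set (ℕ+ × ℕ+) := ((factorPairs m : Set (ℕ+ × ℕ+)))ᶜ with hT
  have hwT : Summable fun p : T => ‖invEigenvalue p‖ :=
    summable_norm_invEigenvalue.comp_injective Subtype.coe_injective
  -- The cofactor left after extracting (k - z)^{d(m)}.
  set g : ℂ → ℂ := fun k => 1 / (2 * Real.pi) * ((k + z) / (m : ℂ) ^ 2) ^ (m : ℕ).divisors.card *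
    ∏' p : T, (1 + k ^ 2 * invEigenvalue p) with hg
  have hgd : Differentiable ℂ g :=
    Differentiable.mul (by fun_prop) (differentiable_tprod_one_add_sq_mul hwT)
  refine (((differentiable_spectralDet.analyticAt z)).analyticOrderAt_eq_natCast).2
    ⟨g, hgd.analyticAt z, ?_, Eventually.of_forall fun k => ?_⟩
  · refine mul_ne_zero (mul_ne_zero hpi (pow_ne_zero _ (div_ne_zero ?_ (pow_ne_zero _ hm))))
      (tprod_one_add_sq_mul_ne_zero hwT fun p hp => ?_)
    · rw [← two_mul]
      exact mul_ne_zero two_ne_zero hz0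
    · have hp' : ((p : ℕ+ × ℕ+).1 * (p : ℕ+ × ℕ+).2) ≠ m := fun h =>
        p.2 (Finset.mem_coe.2 (mem_factorPairs.2 h))
      have hpm : (((p : ℕ+ × ℕ+).1 * (p : ℕ+ × ℕ+).2 : ℕ+) : ℂ) ≠ 0 := by
        exact_mod_cast PNat.ne_zero _
      rw [hzz, invEigenvalue] at hp
      refine hp' (PNat.eq ?_)
      field_simp at hp
      have h2 : (((p : ℕ+ × ℕ+).1 * (p : ℕ+ × ℕ+).2 : ℕ+) : ℂ) ^ 2 = (m : ℂ) ^ 2 := by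
        linear_combination hp
      have h3 : ((p : ℕ+ × ℕ+).1 * (p : ℕ+ × ℕ+).2 : ℕ+).val ^ 2 = m.val ^ 2 := by
        exact_mod_cast h2
      exact Nat.pow_left_injective two_ne_zero h3
  · have hfac : ∀ p ∈ factorPairs m, 1 + k ^ 2 * invEigenvalue p = (k - z) * ((k + z) / (m : ℂ) ^ 2) := by
      intro p hp
      rw [invEigenvalue, mem_factorPairs.1 hp]
      field_simp
      linear_combination hzz
    rw [spectralDet, prod_mul_tprod_compl_one_add_sq_mul summable_norm_invEigenvalue (factorPairs m),
      Finset.prod_congr rfl hfac, Finset.prod_const, card_factorPairs, mul_pow, smul_eq_mul]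
    simp only [hg]
    ring

/-! ### The determinant on the positive half-line -/

/-- Euler's product for the sine, evaluated at the imaginary point ix; all logarithms are
nonnegative, so convergence of partial sums is summability. -/
theorem sinh_pi_mul_div_eq_tsum_log {x : ℝ} (hx : 0 < x) :
    HasSum (fun b : ℕ+ => Real.log (1 + x ^ 2 / (b : ℝ) ^ 2))
      (Real.log (Real.sinh (Real.pi * x) / (Real.pi * x))) := by
  have hpi := Real.pi_pos
  have h := Complex.tendsto_euler_sin_prod (x * Complex.I)
  have hsin : Complex.sin (Real.pi * (x * Complex.I)) =
      ((Real.sinh (Real.pi * x) : ℝ) : ℂ) * Complex.I := by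
    rw [← mul_assoc, Complex.sin_mul_I]
    push_cast
    rfl
  rw [hsin] at h
  have h2 : Tendsto (fun n : ℕ => ∏ j ∈ Finset.range n, (1 + x ^ 2 / ((j + 1 : ℕ) : ℝ) ^ 2)) atTop
      (𝓝 (Real.sinh (Real.pi * x) / (Real.pi * x))) := by
    have h3 := (h.div_const (Complex.I * (Real.pi * x)))
    have hne : (Complex.I * (Real.pi * x) : ℂ) ≠ 0 :=
      mul_ne_zero Complex.I_ne_zero (by exact_mod_cast (mul_pos hpi hx).ne')
    have h4 := (Complex.continuous_re.tendsto _).comp h3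
    have e1 : ((Real.sinh (Real.pi * x) : ℝ) : ℂ) * Complex.I / (Complex.I * (Real.pi * x)) =
        ((Real.sinh (Real.pi * x) / (Real.pi * x) : ℝ) : ℂ) := by
      have : (Real.pi * x : ℂ) ≠ 0 := by exact_mod_cast (mul_pos hpi hx).ne'
      rw [Complex.ofReal_div, mul_comm, mul_div_mul_left _ _ Complex.I_ne_zero]
      push_cast
      rfl
    rw [e1, Complex.ofReal_re] at h4
    refine h4.congr fun n => ?_
    have e2 : (Real.pi * (x * Complex.I) *
        ∏ j ∈ Finset.range n, ((1 : ℂ) - (x * Complex.I) ^ 2 / ((j : ℂ) + 1) ^ 2)) /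
          (Complex.I * (Real.pi * x)) =
        ((∏ j ∈ Finset.range n, (1 + x ^ 2 / ((j + 1 : ℕ) : ℝ) ^ 2) : ℝ) : ℂ) := by
      rw [mul_div_right_comm, show (Real.pi * (x * Complex.I) : ℂ) = Complex.I * (Real.pi * x) by ring,
        div_self hne, one_mul]
      push_cast
      refine Finset.prod_congr rfl fun j _ => ?_
      rw [mul_pow, Complex.I_sq]
      ring
    simp only [Function.comp]
    rw [e2, Complex.ofReal_re]
  have hs : HasSum (fun n : ℕ => Real.log (1 + x ^ 2 / ((n + 1 : ℕ) : ℝ) ^ 2))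
      (Real.log (Real.sinh (Real.pi * x) / (Real.pi * x))) := by
    refine (hasSum_iff_tendsto_nat_of_nonneg (fun n => Real.log_nonneg ?_) _).2 ?_
    · have : 0 ≤ x ^ 2 / ((n + 1 : ℕ) : ℝ) ^ 2 := by positivity
      linarith
    · have hsinh : 0 < Real.sinh (Real.pi * x) := Real.sinh_pos_iff.2 (by positivity)
      refine (h2.log (by positivity)).congr fun n => ?_
      rw [Real.log_prod fun j _ => by positivity]
  rw [← Equiv.pnatEquivNat.symm.hasSum_iff]
  exact hs

/-- Sum over b first, by Euler's product, and then over a; the outer sum is identified by the limit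
of its partial sums. -/
theorem hasSum_log_one_add_sq {s : ℝ} (hs : 0 < s) :
    HasSum (fun p : ℕ+ × ℕ+ => Real.log (1 + s ^ 2 / ((p.1 * p.2 : ℕ+) : ℝ) ^ 2))
      (Real.pi * s * Real.log s + (2 * Real.eulerMascheroniConstant - 1) * Real.pi * s +
        Real.log (2 * Real.pi) + Real.log s / 2 -
        ∑' a : ℕ+, 1 / (a : ℝ) * trapError (2 * Real.pi * s * a)) := by
  have hsum : Summable fun p : ℕ+ × ℕ+ => Real.log (1 + s ^ 2 / ((p.1 * p.2 : ℕ+) : ℝ) ^ 2) := by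
    refine Real.summable_log_one_add_of_summable ?_
    refine (summable_norm_invEigenvalue.mul_left (s ^ 2)).congr fun p => ?_
    rw [invEigenvalue, norm_div, norm_one, norm_pow, Complex.norm_natCast]
    ring
  have h1 := hsum.hasSum.prod_fiberwise
    (g := fun a : ℕ+ => Real.log (Real.sinh (Real.pi * s / a) / (Real.pi * s / a))) fun a => ?_
  · rw [← Equiv.pnatEquivNat.symm.hasSum_iff] at h1
    have h2 := tendsto_nhds_unique h1.tendsto_sum_nat (tendsto_sum_log_sinh_div hs)
    rw [← h2]
    exact hsum.hasSum
  · have ha : (0 : ℝ) < a := by exact_mod_cast a.pos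
    rw [mul_div_assoc]
    refine (sinh_pi_mul_div_eq_tsum_log (div_pos hs ha)).congr_fun fun b => ?_
    rw [div_pow, div_div, PNat.mul_coe, Nat.cast_mul, mul_pow]

/-- The elementary factor cancels the growth terms, the 1/(2π) of the determinant cancels log 2π,
and 1/√s cancels ½ log s; the trapezoidal errors remain. -/
theorem spectralDet_ofReal {s : ℝ} (hs : 0 < s) :
    1 / (s : ℂ) ^ (1 / 2 : ℂ) * Complex.exp (-(Real.pi : ℂ) * s * Complex.log s -
      (2 * (Real.eulerMascheroniConstant : ℂ) - 1) * Real.pi * s) * spectralDet s =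
      Complex.exp (orbitSum s) := by
  have hpi := Real.pi_pos
  have h := hasSum_log_one_add_sq hs
  have hpos : ∀ p : ℕ+ × ℕ+, 0 < 1 + s ^ 2 / ((p.1 * p.2 : ℕ+) : ℝ) ^ 2 := fun p => by positivity
  have h1 := Real.hasProd_of_hasSum_log hpos h
  have h2 : ∏' p, (1 + (s : ℂ) ^ 2 * invEigenvalue p) =
      ((Real.exp (Real.pi * s * Real.log s + (2 * Real.eulerMascheroniConstant - 1) * Real.pi * s +
        Real.log (2 * Real.pi) + Real.log s / 2 -
        ∑' a : ℕ+, 1 / (a : ℝ) * trapError (2 * Real.pi * s * a)) : ℝ) : ℂ) := by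
    refine HasProd.tprod_eq ((h1.map Complex.ofRealHom Complex.continuous_ofReal).congr_fun
      fun p => ?_)
    simp only [Function.comp, Complex.ofRealHom_eq_coe, invEigenvalue]
    push_cast
    ring
  rw [spectralDet, h2, orbitSum_ofReal hs, ofReal_sqrt_eq hs.le, ← Complex.ofReal_log hs.le]
  set W := ∑' a : ℕ+, 1 / (a : ℝ) * trapError (2 * Real.pi * s * a)
  have e : Real.exp (Real.log (2 * Real.pi) + Real.log s / 2) = 2 * Real.pi * Real.sqrt s := by
    rw [Real.exp_add, Real.exp_log (by positivity), Real.exp_half, Real.exp_log hs]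
  have hq : (Real.sqrt s : ℂ) ≠ 0 := by exact_mod_cast (Real.sqrt_pos.2 hs).ne'
  have hpi' : (Real.pi : ℂ) ≠ 0 := by exact_mod_cast hpi.ne'
  rw [show Real.pi * s * Real.log s + (2 * Real.eulerMascheroniConstant - 1) * Real.pi * s +
    Real.log (2 * Real.pi) + Real.log s / 2 - W = (Real.pi * s * Real.log s +
      (2 * Real.eulerMascheroniConstant - 1) * Real.pi * s - W) +
        (Real.log (2 * Real.pi) + Real.log s / 2) by ring, Real.exp_add, e]
  push_cast
  field_simp
  rw [← Complex.exp_add]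
  ring_nf

/-! ### The spectral zeta function -/

/-- The generalized binomial coefficient `(-s choose j)`. -/
noncomputable def negBinom : ℕ → ℂ → ℂ
  | 0, _ => 1
  | j + 1, s => -s / (j + 1) * negBinom j (s + 1)

theorem differentiable_negBinom (j : ℕ) : Differentiable ℂ (negBinom j) := by
  induction j with
  | zero => exact differentiable_const 1
  | succ j ih =>
    have h : Differentiable ℂ fun s : ℂ => negBinom j (s + 1) :=
      ih.comp (differentiable_id.add_const 1)
    exact Differentiable.mul (by fun_prop) h

/-- The remainder of the binomial series of `(1 + x)^{-s}`. -/
noncomputable def binomRemainder (J : ℕ) (s x : ℂ) : ℂ :=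
  (1 + x) ^ (-s) - ∑ j ∈ Finset.range J, negBinom j s * x ^ j

theorem binomRemainder_succ (J : ℕ) (s x : ℂ) :
    binomRemainder J s x = binomRemainder (J + 1) s x + negBinom J s * x ^ J := by
  rw [binomRemainder, binomRemainder, Finset.sum_range_succ]
  ring

theorem binomRemainder_succ_zero (J : ℕ) (s : ℂ) : binomRemainder (J + 1) s 0 = 0 := by
  rw [binomRemainder, Finset.sum_range_succ']
  simp [negBinom]

/-- The recursion for the coefficients is chosen so that differentiating in x lowers the order by
one and shifts s to s + 1, reproducing a remainder of the same kind. -/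
theorem hasDerivAt_binomRemainder (J : ℕ) (s : ℂ) {x : ℂ} (hx : 1 + x ∈ Complex.slitPlane) :
    HasDerivAt (binomRemainder (J + 1) s) (-s * binomRemainder J (s + 1) x) x := by
  have h1 : HasDerivAt (fun x : ℂ => (1 + x) ^ (-s)) (-s * (1 + x) ^ (-s - 1)) x :=
    (((hasDerivAt_id x).const_add 1).cpow_const hx).congr_deriv (by simp)
  have h2 : HasDerivAt (fun x : ℂ => ∑ j ∈ Finset.range (J + 1), negBinom j s * x ^ j)
      (∑ j ∈ Finset.range (J + 1), negBinom j s * (j * x ^ (j - 1))) x :=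
    HasDerivAt.fun_sum fun j _ => (hasDerivAt_pow j x).const_mul _
  refine (h1.sub h2).congr_deriv ?_
  rw [Finset.sum_range_succ', binomRemainder, mul_sub, Finset.mul_sum]
  have e : -s - 1 = -(s + 1) := by ring
  rw [e]
  simp only [Nat.cast_zero, zero_mul, mul_zero, add_zero, Nat.add_sub_cancel]
  congr 1
  refine Finset.sum_congr rfl fun j _ => ?_
  have hj : (j : ℂ) + 1 ≠ 0 := Nat.cast_add_one_ne_zero j
  rw [negBinom]
  push_cast
  field_simp

/-- Induction on the order: compactness for order 0, then the mean value inequality along [0, x].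
The shift of s enlarges the radius by 1, hence the quantifier over R inside the induction. -/
theorem exists_norm_binomRemainder_le {δ A : ℝ} (hδ : 0 < δ) (hδ1 : δ ≤ 1) (J : ℕ) :
    ∀ R : ℝ, 0 ≤ R → ∃ C : ℝ, 0 ≤ C ∧ ∀ s x : ℂ, ‖s‖ ≤ R → δ ≤ (1 + x).re → ‖x‖ ≤ A →
      ‖binomRemainder J s x‖ ≤ C * ‖x‖ ^ J := by
  induction J with
  | zero =>
    intro R _
    have hcompact : IsCompact ((Metric.closedBall (0 : ℂ) R) ×ˢ
        ({x : ℂ | δ ≤ (1 + x).re} ∩ Metric.closedBall 0 A)) :=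
      (isCompact_closedBall _ _).prod ((isCompact_closedBall _ _).inter_left
        (isClosed_le continuous_const (by fun_prop)))
    have hcont : ContinuousOn (fun p : ℂ × ℂ => (1 + p.2) ^ (-p.1)) ((Metric.closedBall (0 : ℂ) R) ×ˢ
        ({x : ℂ | δ ≤ (1 + x).re} ∩ Metric.closedBall 0 A)) := by
      refine ContinuousOn.cpow (by fun_prop) (by fun_prop) fun p hp => Or.inl ?_
      exact hδ.trans_le hp.2.1
    obtain ⟨C, hC⟩ := hcompact.exists_bound_of_continuousOn hcont
    refine ⟨max C 0, le_max_right _ _, fun s x hs hx hxA => ?_⟩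
    have h := hC (s, x) ⟨by simpa using hs, hx, by simpa using hxA⟩
    simpa [binomRemainder] using Or.inl h
  | succ J ih =>
    intro R hR
    obtain ⟨C, hC0, hC⟩ := ih (R + 1) (by linarith)
    refine ⟨R * C, by positivity, fun s x hs hx hxA => ?_⟩
    -- The region is star-shaped about 0; this is the use of δ ≤ 1.
    have hseg : ∀ y ∈ segment ℝ 0 x, δ ≤ (1 + y).re ∧ ‖y‖ ≤ ‖x‖ := by
      rintro y ⟨a, b, ha, hb, hab, rfl⟩
      have hre : (1 + x).re = 1 + x.re := by simp
      rw [hre] at hx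
      have hre2 : (1 + (a • (0 : ℂ) + b • x)).re = 1 + b * x.re := by simp
      rw [hre2]
      constructor
      · nlinarith
      · rw [smul_zero, zero_add, norm_smul, Real.norm_of_nonneg hb]
        exact mul_le_of_le_one_left (norm_nonneg _) (by linarith)
    have h := Convex.norm_image_sub_le_of_norm_hasDerivWithin_le (f := binomRemainder (J + 1) s)
      (f' := fun y => -s * binomRemainder J (s + 1) y) (C := R * (C * ‖x‖ ^ J))
      (fun y hy => (hasDerivAt_binomRemainder J s
        (Or.inl (hδ.trans_le (hseg y hy).1))).hasDerivWithinAt) (fun y hy => ?_)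
      (convex_segment 0 x) (left_mem_segment ℝ 0 x) (right_mem_segment ℝ 0 x)
    · rw [binomRemainder_succ_zero, sub_zero, sub_zero] at h
      refine h.trans_eq ?_
      rw [pow_succ]
      ring
    · obtain ⟨h1, h2⟩ := hseg y hy
      rw [norm_mul, norm_neg]
      refine mul_le_mul hs ((hC _ _ ?_ h1 (h2.trans hxA)).trans ?_) (norm_nonneg _) hR
      · refine (norm_add_le _ _).trans ?_
        rw [norm_one]
        linarith
      · gcongr

/-- The Dirichlet series of d(n) is a double sum of (ab)^{-w}, which factors. These squares of ζ
carry the poles of the continued spectral zeta function. -/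
theorem hasSum_card_divisors_mul_cpow {w : ℂ} (hw : 1 < w.re) :
    HasSum (fun n : ℕ+ => ((n : ℕ).divisors.card : ℂ) * (1 / ((n : ℕ) : ℂ) ^ w))
      (riemannZeta w ^ 2) := by
  set f : ℕ+ → ℂ := fun n => 1 / ((n : ℕ) : ℂ) ^ w with hf
  have hmul : ∀ p : ℕ+ × ℕ+, f (p.1 * p.2) = f p.1 * f p.2 := by
    intro p
    simp only [hf]
    rw [PNat.mul_coe, Nat.cast_mul, Complex.natCast_mul_natCast_cpow, one_div_mul_one_div]
  have hs : Summable fun p : ℕ+ × ℕ+ => f (p.1 * p.2) := by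
    refine summable_prod_of_norm_le (C := 1) hw fun n => ?_
    rw [hf, norm_div, norm_one, Complex.norm_natCast_cpow_of_pos n.pos, one_mul]
  refine hasSum_card_divisors_mul (f := f) ?_
  rw [sq]
  refine ((hasSum_riemannZeta hw).mul (hasSum_riemannZeta hw) ?_).congr_fun hmul
  exact hs.congr hmul

/-! ### Continuation of Σ d(m)(m² + a)^{-s} by subtracting binomial terms. -/

/-- The `m`-th term of the regularized spectral zeta function. -/
noncomputable def spectralZetaTerm (a : ℂ) (J : ℕ) (m : ℕ+) (s : ℂ) : ℂ :=
  ((m : ℕ).divisors.card : ℂ) * (1 / ((m : ℕ) : ℂ) ^ (2 * s) *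
    binomRemainder J s (a / ((m : ℕ) : ℂ) ^ 2))

/-- Dividing a by m² ≥ 1 only moves 1 + a towards 1. The bound is uniform in m, so the remainder
estimate applies with one constant for all terms. -/
theorem one_add_div_sq_re (a : ℂ) (m : ℕ+) :
    min 1 (1 + a.re) ≤ (1 + a / ((m : ℕ) : ℂ) ^ 2).re := by
  have hm : (1 : ℝ) ≤ (m : ℕ) := by exact_mod_cast m.pos
  have hm2 : (1 : ℝ) ≤ ((m : ℕ) : ℝ) ^ 2 := one_le_pow₀ hm
  have e : (1 + a / ((m : ℕ) : ℂ) ^ 2).re = 1 + a.re / ((m : ℕ) : ℝ) ^ 2 := by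
    rw [Complex.add_re, Complex.one_re, ← Complex.ofReal_natCast, ← Complex.ofReal_pow,
      Complex.div_ofReal_re]
  rw [e]
  rcases le_or_gt 0 a.re with h | h
  · exact (min_le_left _ _).trans (by have : 0 ≤ a.re / ((m : ℕ) : ℝ) ^ 2 := by positivity
                                      linarith)
  · refine (min_le_right _ _).trans ?_
    have : a.re ≤ a.re / ((m : ℕ) : ℝ) ^ 2 := by
      rw [le_div_iff₀ (by positivity)]
      nlinarith
    linarith

theorem one_add_div_sq_mem_slitPlane {a : ℂ} (ha : -1 < a.re) (m : ℕ+) :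
    1 + a / ((m : ℕ) : ℂ) ^ 2 ∈ Complex.slitPlane :=
  Or.inl ((lt_min one_pos (by linarith)).trans_le (one_add_div_sq_re a m))

theorem differentiable_spectralZetaTerm {a : ℂ} (ha : -1 < a.re) (J : ℕ) (m : ℕ+) :
    Differentiable ℂ (spectralZetaTerm a J m) := by
  have h0 := Complex.slitPlane_ne_zero (one_add_div_sq_mem_slitPlane ha m)
  have hm : ((m : ℕ) : ℂ) ≠ 0 := by exact_mod_cast m.ne_zero
  have h1 : ∀ j, Differentiable ℂ (negBinom j) := differentiable_negBinom
  have h2 : Differentiable ℂ fun s : ℂ => ((m : ℕ) : ℂ) ^ (2 * s) :=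
    Differentiable.const_cpow (by fun_prop) (Or.inl hm)
  have h3 : Differentiable ℂ fun s : ℂ => (1 + a / ((m : ℕ) : ℂ) ^ 2) ^ (-s) :=
    Differentiable.const_cpow (by fun_prop) (Or.inl h0)
  have h4 : ∀ s : ℂ, ((m : ℕ) : ℂ) ^ (2 * s) ≠ 0 := fun s => by simp [Complex.cpow_eq_zero_iff, hm]
  have h5 : Differentiable ℂ fun s : ℂ => ∑ j ∈ Finset.range J, negBinom j s *
      (a / ((m : ℕ) : ℂ) ^ 2) ^ j :=
    Differentiable.fun_sum fun j _ => (h1 j).mul_const _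
  exact (((differentiable_const _).div h2 h4).mul (h3.sub h5)).const_mul _

/-- After J subtractions the terms gain m^{-2J}, so they are summable as soon as 2 Re s + 2J > 1,
locally uniformly in s. -/
theorem exists_spectralZetaTerm_bound {a : ℂ} (ha : -1 < a.re) (J : ℕ) {s : ℂ}
    (hs : 1 / 2 - J < s.re) : ∃ (U : Set ℂ) (C ρ : ℝ), IsOpen U ∧ s ∈ U ∧ 1 < ρ ∧ ∀ (m : ℕ+),
      ∀ z ∈ U, ‖spectralZetaTerm a J m z‖ ≤
        C * (((m : ℕ).divisors.card : ℝ) * (1 / ((m : ℕ) : ℝ) ^ ρ)) := by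
  obtain ⟨C, hC0, hC⟩ := exists_norm_binomRemainder_le (δ := min 1 (1 + a.re))
    (lt_min one_pos (by linarith)) (min_le_left _ _) (A := ‖a‖) J (‖s‖ + 1) (by positivity)
  obtain ⟨σ, hσ1, hσ2⟩ := exists_between hs
  refine ⟨{z | σ < z.re} ∩ Metric.ball s 1, C * ‖a‖ ^ J, 2 * σ + 2 * J,
    (isOpen_lt continuous_const Complex.continuous_re).inter Metric.isOpen_ball,
    ⟨hσ2, by simp⟩, by linarith, fun m z hz => ?_⟩
  have hm : (1 : ℝ) ≤ (m : ℕ) := by exact_mod_cast m.pos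
  have hm0 : (0 : ℝ) < (m : ℕ) := by linarith
  have hzn : ‖z‖ ≤ ‖s‖ + 1 := by
    have h1 := hz.2
    rw [Metric.mem_ball, dist_eq_norm] at h1
    have := norm_le_norm_add_norm_sub' z s
    linarith
  have hx : ‖a / ((m : ℕ) : ℂ) ^ 2‖ = ‖a‖ / ((m : ℕ) : ℝ) ^ 2 := by
    rw [norm_div, norm_pow, Complex.norm_natCast]
  have hb := hC z _ hzn (one_add_div_sq_re a m)
    (by rw [hx]; exact div_le_self (norm_nonneg a) (one_le_pow₀ hm))
  rw [hx] at hb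
  rw [spectralZetaTerm, norm_mul, Complex.norm_natCast, norm_mul, norm_div, norm_one,
    Complex.norm_natCast_cpow_of_pos m.pos]
  have hre : (2 * z).re = 2 * z.re := by simp
  rw [hre]
  calc _ ≤ ((m : ℕ).divisors.card : ℝ) * (1 / ((m : ℕ) : ℝ) ^ (2 * σ) *
        (C * (‖a‖ / ((m : ℕ) : ℝ) ^ 2) ^ J)) := by
        gcongr
        exact hz.1.le
    _ = _ := by
        have e : ((m : ℕ) : ℝ) ^ (2 * σ + 2 * J) = ((m : ℕ) : ℝ) ^ (2 * σ) * (((m : ℕ) : ℝ) ^ 2) ^ J := by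
          rw [Real.rpow_add hm0, ← pow_mul]
          congr 1
          exact_mod_cast Real.rpow_natCast ((m : ℕ) : ℝ) (2 * J)
        rw [e, div_pow]
        field_simp

theorem summable_spectralZetaTerm {a : ℂ} (ha : -1 < a.re) (J : ℕ) {s : ℂ}
    (hs : 1 / 2 - J < s.re) : Summable fun m => spectralZetaTerm a J m s := by
  obtain ⟨U, C, ρ, -, hsU, hρ, h⟩ := exists_spectralZetaTerm_bound ha J hs
  exact Summable.of_norm_bounded ((summable_card_divisors_mul_rpow hρ).mul_left C)
    fun n => h n s hsU

theorem hasSum_deriv_spectralZetaTerm {a : ℂ} (ha : -1 < a.re) (J : ℕ) {s : ℂ}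
    (hs : 1 / 2 - J < s.re) :
    AnalyticAt ℂ (fun s => ∑' m, spectralZetaTerm a J m s) s ∧
      HasSum (fun m => deriv (spectralZetaTerm a J m) s)
        (deriv (fun s => ∑' m, spectralZetaTerm a J m s) s) := by
  obtain ⟨U, C, ρ, hUo, hsU, hρ, h⟩ := exists_spectralZetaTerm_bound ha J hs
  have hu := (summable_card_divisors_mul_rpow hρ).mul_left C
  have hd : ∀ m, DifferentiableOn ℂ (spectralZetaTerm a J m) U := fun m =>
    (differentiable_spectralZetaTerm ha J m).differentiableOn
  exact ⟨(Complex.differentiableOn_tsum_of_summable_norm hu hd hUo h).analyticAt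
    (hUo.mem_nhds hsU), Complex.hasSum_deriv_of_summable_norm hu hd hUo h hsU⟩

/-- The spectral zeta function on the half-plane `1 / 2 - J < Re s`. -/
noncomputable def spectralZetaAux (a : ℂ) (J : ℕ) (s : ℂ) : ℂ :=
  ∑' m, spectralZetaTerm a J m s +
    ∑ j ∈ Finset.range J, negBinom j s * a ^ j * riemannZeta (2 * s + 2 * j) ^ 2

/-- Where the order J already converges, the next subtracted term may be summed separately, and its
sum is precisely the ζ² term added back. -/
theorem spectralZetaAux_succ {a : ℂ} (ha : -1 < a.re) (J : ℕ) {s : ℂ} (hs : 1 / 2 - J < s.re) :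
    spectralZetaAux a (J + 1) s = spectralZetaAux a J s := by
  have hs' : 1 / 2 - ((J + 1 : ℕ) : ℝ) < s.re := by push_cast; linarith
  have hw : 1 < (2 * s + 2 * J : ℂ).re := by
    have : (2 * s + 2 * J : ℂ).re = 2 * s.re + 2 * J := by simp
    rw [this]
    linarith
  have h1 := (summable_spectralZetaTerm ha (J + 1) hs').hasSum
  have h2 := (hasSum_card_divisors_mul_cpow hw).mul_left (negBinom J s * a ^ J)
  have h3 : HasSum (fun m => spectralZetaTerm a J m s) _ := (h1.add h2).congr_fun fun m => by
    have hm : ((m : ℕ) : ℂ) ≠ 0 := by exact_mod_cast m.ne_zero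
    have e : ((m : ℕ) : ℂ) ^ (2 * s + 2 * J) = ((m : ℕ) : ℂ) ^ (2 * s) * (((m : ℕ) : ℂ) ^ 2) ^ J := by
      rw [Complex.cpow_add _ _ hm, ← pow_mul]
      congr 1
      exact_mod_cast Complex.cpow_natCast ((m : ℕ) : ℂ) (2 * J)
    rw [spectralZetaTerm, spectralZetaTerm, binomRemainder_succ J, e, div_pow]
    field_simp
  rw [spectralZetaAux, spectralZetaAux, h3.tsum_eq, Finset.sum_range_succ]
  ring

theorem spectralZetaAux_eq_of_le {a : ℂ} (ha : -1 < a.re) {J J' : ℕ} (hJ : J ≤ J') {s : ℂ}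
    (hs : 1 / 2 - J < s.re) : spectralZetaAux a J' s = spectralZetaAux a J s := by
  induction J', hJ using Nat.le_induction with
  | base => rfl
  | succ N hN ih =>
    rw [spectralZetaAux_succ ha N, ih]
    have : (J : ℝ) ≤ N := by exact_mod_cast hN
    linarith

/-- The meromorphic continuation of the spectral zeta function. -/
noncomputable def spectralZeta (a s : ℂ) : ℂ := spectralZetaAux a (⌈‖s‖⌉₊ + 1) s

/-- The order chosen in the definition exceeds 1/2 - Re s, and any two admissible orders agree; so
near a given point a fixed order may be used. -/
theorem spectralZeta_eq_aux {a : ℂ} (ha : -1 < a.re) (J : ℕ) {s : ℂ} (hs : 1 / 2 - J < s.re) :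
    spectralZeta a s = spectralZetaAux a J s := by
  have h1 : 1 / 2 - ((⌈‖s‖⌉₊ + 1 : ℕ) : ℝ) < s.re := by
    have h2 := Nat.le_ceil ‖s‖
    have h3 := (abs_le.1 (Complex.abs_re_le_norm s)).1
    push_cast
    linarith
  rcases le_total J (⌈‖s‖⌉₊ + 1) with h | h
  · exact spectralZetaAux_eq_of_le ha h hs
  · exact (spectralZetaAux_eq_of_le ha h h1).symm

theorem meromorphicAt_riemannZeta_two_mul (j : ℕ) (s : ℂ) :
    MeromorphicAt (fun s : ℂ => riemannZeta (2 * s + 2 * j)) s := by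
  have h1 : Differentiable ℂ fun s : ℂ => riemannZeta₁ (2 * s + 2 * j) :=
    differentiable_riemannZeta₁.comp (by fun_prop)
  have h2 : Differentiable ℂ fun s : ℂ => 2 * s + 2 * j - 1 := by fun_prop
  refine ((h2.analyticAt s).meromorphicAt.inv.mul (h1.analyticAt s).meromorphicAt).congr ?_
  have hne : ∀ᶠ z in 𝓝[≠] s, 2 * z + 2 * j ≠ (1 : ℂ) := by
    by_cases hs : 2 * s + 2 * j = (1 : ℂ)
    · filter_upwards [self_mem_nhdsWithin] with z hz h
      exact hz (show z = s by linear_combination (h - hs) / 2)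
    · have hc : ContinuousAt (fun z : ℂ => 2 * z + 2 * j) s := by fun_prop
      exact (hc.eventually_ne hs).filter_mono nhdsWithin_le_nhds
  filter_upwards [hne] with z hz
  simp only [Pi.mul_apply, Pi.inv_apply]
  rw [riemannZeta_eq_inv_sub_mul hz]

theorem meromorphicOn_spectralZeta {a : ℂ} (ha : -1 < a.re) :
    MeromorphicOn (spectralZeta a) univ := by
  intro s _
  obtain ⟨J, hJ⟩ := exists_nat_gt (1 / 2 - s.re)
  have hs : 1 / 2 - (J : ℝ) < s.re := by linarith
  have h1 : MeromorphicAt (spectralZetaAux a J) s := by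
    refine (hasSum_deriv_spectralZetaTerm ha J hs).1.meromorphicAt.add
      (MeromorphicAt.fun_sum fun j _ => ?_)
    exact (((differentiable_negBinom j).analyticAt s).meromorphicAt.mul
      (MeromorphicAt.const _ _)).mul ((meromorphicAt_riemannZeta_two_mul j s).pow 2)
  refine h1.congr (Eventually.filter_mono nhdsWithin_le_nhds ?_)
  filter_upwards [(isOpen_lt continuous_const Complex.continuous_re).mem_nhds hs] with z hz
  exact (spectralZeta_eq_aux ha J hz).symm

theorem ofReal_mul_cpow {p : ℝ} (hp : 0 < p) {z : ℂ} (hz : z ≠ 0) (w : ℂ) :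
    ((p : ℂ) * z) ^ w = (p : ℂ) ^ w * z ^ w := by
  have hp' : (p : ℂ) ≠ 0 := by exact_mod_cast hp.ne'
  rw [Complex.cpow_def_of_ne_zero (mul_ne_zero hp' hz), Complex.cpow_def_of_ne_zero hp',
    Complex.cpow_def_of_ne_zero hz, Complex.log_ofReal_mul hp hz, ← Complex.exp_add,
    Complex.ofReal_log hp.le]
  ring_nf

theorem sq_add_cpow_neg {a : ℂ} (ha : -1 < a.re) (m : ℕ+) (s : ℂ) :
    (((m : ℕ) : ℂ) ^ 2 + a) ^ (-s) = 1 / ((m : ℕ) : ℂ) ^ (2 * s) *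
      (1 + a / ((m : ℕ) : ℂ) ^ 2) ^ (-s) := by
  have hm : ((m : ℕ) : ℂ) ≠ 0 := by exact_mod_cast m.ne_zero
  have hm0 : (0 : ℝ) < (m : ℕ) := by exact_mod_cast m.pos
  have e : ((m : ℕ) : ℂ) ^ 2 + a = ((((m : ℕ) : ℝ) ^ 2 : ℝ) : ℂ) * (1 + a / ((m : ℕ) : ℂ) ^ 2) := by
    push_cast
    field_simp
  rw [e, ofReal_mul_cpow (by positivity)
    (Complex.slitPlane_ne_zero (one_add_div_sq_mem_slitPlane ha m)), one_div, ← Complex.cpow_neg]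
  congr 1
  push_cast
  rw [sq, Complex.natCast_mul_natCast_cpow, ← Complex.cpow_add _ _ hm]
  ring_nf

theorem hasSum_spectralZeta {a : ℂ} (ha : -1 < a.re) {s : ℂ} (hs : 1 / 2 < s.re) :
    HasSum (fun m : ℕ+ => ((m : ℕ).divisors.card : ℂ) * (((m : ℕ) : ℂ) ^ 2 + a) ^ (-s))
      (spectralZeta a s) := by
  have hs' : 1 / 2 - ((0 : ℕ) : ℝ) < s.re := by simpa using hs
  rw [spectralZeta_eq_aux ha 0 hs', spectralZetaAux, Finset.range_zero, Finset.sum_empty, add_zero]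
  refine (summable_spectralZetaTerm ha 0 hs').hasSum.congr_fun fun m => ?_
  rw [sq_add_cpow_neg ha, spectralZetaTerm, binomRemainder, Finset.range_zero, Finset.sum_empty,
    sub_zero]

/-- The ζ(2s)² term contributes 4ζ(0)ζ'(0) = log 2π to the derivative at 0; differentiating the
remaining series term by term gives the logarithms. -/
theorem spectralZeta_at_zero {a : ℂ} (ha : -1 < a.re) :
    AnalyticAt ℂ (spectralZeta a) 0 ∧ HasSum (fun m : ℕ+ => ((m : ℕ).divisors.card : ℂ) *
      Complex.log (1 + a / ((m : ℕ) : ℂ) ^ 2)) (Real.log (2 * Real.pi) - deriv (spectralZeta a) 0) := by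
  -- One subtraction suffices near s = 0, where ζ(2s) is analytic.
  have h0 : 1 / 2 - ((1 : ℕ) : ℝ) < (0 : ℂ).re := by norm_num
  obtain ⟨h1, h2⟩ := hasSum_deriv_spectralZetaTerm ha 1 h0
  have hz0 : HasDerivAt riemannZeta (-Complex.log (2 * Real.pi) / 2) 0 := by
    rw [← deriv_riemannZeta_zero]
    exact (differentiableAt_riemannZeta zero_ne_one).hasDerivAt
  have hzeta : HasDerivAt (fun s : ℂ => riemannZeta (2 * s) ^ 2) (Real.log (2 * Real.pi) : ℂ) 0 := by
    have h3 : HasDerivAt (fun s : ℂ => 2 * s) 2 0 := by simpa using (hasDerivAt_id (0 : ℂ)).const_mul 2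
    have hz0' : HasDerivAt riemannZeta (-Complex.log (2 * Real.pi) / 2) (2 * 0) := by
      rwa [mul_zero]
    refine ((HasDerivAt.comp (0 : ℂ) hz0' h3).pow 2).congr_deriv ?_
    have hlog : Complex.log (2 * Real.pi) = (Real.log (2 * Real.pi) : ℂ) := by
      rw [Complex.ofReal_log (by have := Real.pi_pos; positivity)]
      push_cast
      rfl
    simp only [Function.comp, mul_zero, riemannZeta_zero, hlog]
    norm_num
  have heq : spectralZeta a =ᶠ[𝓝 0] fun s => ∑' m, spectralZetaTerm a 1 m s + riemannZeta (2 * s) ^ 2 := by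
    filter_upwards [(isOpen_lt continuous_const Complex.continuous_re).mem_nhds h0] with z hz
    rw [spectralZeta_eq_aux ha 1 hz, spectralZetaAux]
    simp [negBinom]
  have hzan : AnalyticAt ℂ (fun s : ℂ => riemannZeta (2 * s) ^ 2) 0 := by
    have hd : DifferentiableOn ℂ (fun s : ℂ => riemannZeta (2 * s) ^ 2) {s : ℂ | 2 * s ≠ 1} := by
      intro s hs
      have hr : DifferentiableAt ℂ (fun s : ℂ => riemannZeta (2 * s)) s :=
        DifferentiableAt.comp s (differentiableAt_riemannZeta hs) (by fun_prop)
      exact (hr.pow 2).differentiableWithinAt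
    exact hd.analyticAt ((isOpen_ne_fun (by fun_prop) continuous_const).mem_nhds (by simp))
  refine ⟨(h1.add hzan).congr heq.symm, ?_⟩
  have hderiv := (h1.differentiableAt.hasDerivAt.add hzeta).congr_of_eventuallyEq heq
  rw [hderiv.deriv]
  have e : (Real.log (2 * Real.pi) : ℂ) - (deriv (fun s => ∑' m, spectralZetaTerm a 1 m s) 0 +
      (Real.log (2 * Real.pi) : ℂ)) = -deriv (fun s => ∑' m, spectralZetaTerm a 1 m s) 0 := by ring
  rw [e]
  refine h2.neg.congr_fun fun m => ?_
  have hm : ((m : ℕ) : ℂ) ≠ 0 := by exact_mod_cast m.ne_zero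
  have hx := Complex.slitPlane_ne_zero (one_add_div_sq_mem_slitPlane ha m)
  have d1 : HasDerivAt (fun s : ℂ => binomRemainder 1 s (a / ((m : ℕ) : ℂ) ^ 2))
      (-Complex.log (1 + a / ((m : ℕ) : ℂ) ^ 2)) 0 := by
    have := ((hasDerivAt_neg (0 : ℂ)).const_cpow (c := 1 + a / ((m : ℕ) : ℂ) ^ 2)
      (Or.inl hx)).sub_const 1
    refine (this.congr_deriv (by simp)).congr_of_eventuallyEq (Eventually.of_forall fun s => ?_)
    simp [binomRemainder, negBinom]
  have d2 : DifferentiableAt ℂ (fun s : ℂ => 1 / ((m : ℕ) : ℂ) ^ (2 * s)) 0 := by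
    have h2 : Differentiable ℂ fun s : ℂ => ((m : ℕ) : ℂ) ^ (2 * s) :=
      Differentiable.const_cpow (by fun_prop) (Or.inl hm)
    exact (differentiableAt_const _).div (h2 0) (by simp)
  -- The remainder is zero at s = 0, so the derivative of m^{-2s} plays no role.
  have d3 := ((d2.hasDerivAt.mul d1).const_mul ((m : ℕ).divisors.card : ℂ))
  have e3 : deriv (spectralZetaTerm a 1 m) 0 = _ := d3.deriv
  rw [e3]
  simp [binomRemainder, negBinom]

/-- Exponentiating makes the branches of the logarithms irrelevant; the sum weighted by d(m) unfolds
into the double product, and log 2π becomes the factor 1/(2π). -/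
theorem spectralDet_eq_exp {k : ℂ} (ha : -1 < (k ^ 2).re) :
    spectralDet k = Complex.exp (-deriv (spectralZeta (k ^ 2)) 0) := by
  have hpi := Real.pi_pos
  obtain ⟨-, h⟩ := spectralZeta_at_zero ha
  set f : ℕ+ → ℂ := fun m => Complex.log (1 + k ^ 2 / ((m : ℕ) : ℂ) ^ 2) with hf
  have e : ∀ p : ℕ+ × ℕ+, f (p.1 * p.2) = Complex.log (1 + k ^ 2 * invEigenvalue p) := by
    intro p
    simp only [hf, invEigenvalue]
    rw [mul_one_div]
  have hs : Summable fun p : ℕ+ × ℕ+ => Complex.log (1 + k ^ 2 * invEigenvalue p) :=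
    Complex.summable_log_one_add_of_summable (summable_norm_sq_mul summable_norm_invEigenvalue k).of_norm
  have hs2 : HasSum (fun p : ℕ+ × ℕ+ => f (p.1 * p.2))
      (∑' p : ℕ+ × ℕ+, Complex.log (1 + k ^ 2 * invEigenvalue p)) := hs.hasSum.congr_fun e
  have h3 := (hasSum_card_divisors_mul hs2).unique h
  have hne : ∀ p : ℕ+ × ℕ+, 1 + k ^ 2 * invEigenvalue p ≠ 0 := by
    intro p
    have := Complex.slitPlane_ne_zero (one_add_div_sq_mem_slitPlane ha (p.1 * p.2))
    rwa [← mul_one_div] at this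
  rw [spectralDet, ← Complex.cexp_tsum_eq_tprod hne hs, h3, sub_eq_add_neg, Complex.exp_add,
    ← Complex.ofReal_exp, Real.exp_log (by positivity)]
  have : (Real.pi : ℂ) ≠ 0 := by exact_mod_cast hpi.ne'
  push_cast
  field_simp

/-! ### The eigenspaces of the Dirichlet Laplacian -/

theorem edge_length_pos (n : ℕ+) : 0 < Real.pi / (n : ℝ) :=
  div_pos Real.pi_pos (by exact_mod_cast n.pos)

theorem hasDerivAt_of_eq_add_integral {L x : ℝ} {F f : ℝ → ℂ}
    (hf : ContinuousOn f (Icc 0 L)) (hF : ∀ x ∈ Icc (0 : ℝ) L, F x = F 0 + ∫ y in (0 : ℝ)..x, f y)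
    (hx : x ∈ Ioo 0 L) : HasDerivAt F (f x) x := by
  have hcont : ContinuousAt f x := hf.continuousAt (Icc_mem_nhds hx.1 hx.2)
  have hint : IntervalIntegrable f volume 0 x := by
    refine ContinuousOn.intervalIntegrable (hf.mono ?_)
    rw [uIcc_of_le hx.1.le]
    exact Icc_subset_Icc le_rfl hx.2.le
  have hmeas : StronglyMeasurableAtFilter f (𝓝 x) volume :=
    (hf.mono Ioo_subset_Icc_self).stronglyMeasurableAtFilter isOpen_Ioo x hx
  refine ((intervalIntegral.integral_hasDerivAt_right hint hmeas hcont).const_add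
    (F 0)).congr_of_eventuallyEq ?_
  filter_upwards [Ioo_mem_nhds hx.1 hx.2] with y hy
  exact hF y ⟨hy.1.le, hy.2.le⟩

theorem eq_of_hasDerivAt_zero {L : ℝ} {F : ℝ → ℂ} (hF : ContinuousOn F (Icc 0 L))
    (hd : ∀ x ∈ Ioo (0 : ℝ) L, HasDerivAt F 0 x) {x : ℝ} (hx : x ∈ Icc 0 L) : F x = F 0 := by
  have h := intervalIntegral.integral_eq_sub_of_hasDerivAt_of_le hx.1
    (hF.mono (Icc_subset_Icc le_rfl hx.2)) (f' := fun _ => 0)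
    (fun y hy => hd y ⟨hy.1, hy.2.trans_le hx.2⟩) (by simp)
  rw [intervalIntegral.integral_zero] at h
  exact (sub_eq_zero.1 h.symm)

/-- The solutions of the eigenvalue problem on an edge. -/
theorem IsEdgeNegLaplacian.eigenfunction {n : ℕ+} {f : EdgeSpace n} {κ : ℂ}
    (h : IsEdgeNegLaplacian n f (κ ^ 2 • f)) :
    ∃ (u : ℝ → ℂ) (b : ℂ), (f =ᵐ[(volume : Measure ℝ).restrict (Icc 0 (Real.pi / (n : ℝ)))] u) ∧
      u (Real.pi / (n : ℝ)) = 0 ∧ ∀ x ∈ Icc (0 : ℝ) (Real.pi / (n : ℝ)),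
        u x * κ = b * Complex.sin (κ * x) ∧ (κ = 0 → u x = b * x) := by
  obtain ⟨u, v, e, h0, hL, hx⟩ := h
  set L := Real.pi / (n : ℝ) with hLdef
  have hv : ContinuousOn v (Icc 0 L) := edge_continuousOn n _ fun x h => (hx x h).2
  have hu : ContinuousOn u (Icc 0 L) := by
    have hvi : IntervalIntegrable v volume 0 L := by
      refine ContinuousOn.intervalIntegrable ?_
      rwa [uIcc_of_le (edge_length_pos n).le]
    have h2 := intervalIntegral.continuousOn_primitive_interval' hvi left_mem_uIcc
    rw [uIcc_of_le (edge_length_pos n).le] at h2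
    exact (continuousOn_const.add h2).congr fun x h => (hx x h).1
  have hv2 : ∀ x ∈ Icc (0 : ℝ) L, v x = v 0 + ∫ y in (0 : ℝ)..x, -(κ ^ 2 * u y) := by
    intro x hxI
    rw [(hx x hxI).2, intervalIntegral.integral_neg, sub_eq_add_neg]
    congr 2
    rw [intervalIntegral.integral_of_le hxI.1, intervalIntegral.integral_of_le hxI.1]
    refine integral_congr_ae ?_
    refine ae_restrict_of_ae_restrict_of_subset (t := Icc 0 L)
      (fun y (hy : y ∈ Ioc 0 x) => ⟨hy.1.le, hy.2.trans hxI.2⟩) ?_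
    filter_upwards [e, Lp.coeFn_smul (κ ^ 2) f] with y h1 h2
    rw [h2, Pi.smul_apply, h1, smul_eq_mul]
  have du : ∀ x ∈ Ioo (0 : ℝ) L, HasDerivAt u (v x) x := fun x hxI =>
    hasDerivAt_of_eq_add_integral hv (fun y hy => (hx y hy).1) hxI
  have dv : ∀ x ∈ Ioo (0 : ℝ) L, HasDerivAt v (-(κ ^ 2 * u x)) x := fun x hxI =>
    hasDerivAt_of_eq_add_integral (by fun_prop) hv2 hxI
  have dlin : ∀ x : ℝ, HasDerivAt (fun x : ℝ => κ * (x : ℂ)) κ x := fun x => by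
    simpa using (Complex.ofRealCLM.hasDerivAt (x := x)).const_mul κ
  have dsin : ∀ x : ℝ, HasDerivAt (fun x : ℝ => Complex.sin (κ * x)) (Complex.cos (κ * x) * κ) x :=
    fun x => (Complex.hasDerivAt_sin _).comp x (dlin x)
  have dcos : ∀ x : ℝ, HasDerivAt (fun x : ℝ => Complex.cos (κ * x)) (-Complex.sin (κ * x) * κ) x :=
    fun x => (Complex.hasDerivAt_cos _).comp x (dlin x)
  refine ⟨u, v 0, e, hL, fun x hxI => ⟨?_, ?_⟩⟩
  -- Both uκ cos κx - v sin κx and uκ sin κx + v cos κx are constant along the edge, with values 0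
  -- and v(0) since u(0) = 0. Combining them eliminates v without dividing by κ.
  · have hA := eq_of_hasDerivAt_zero
      (F := fun x => u x * κ * Complex.cos (κ * x) - v x * Complex.sin (κ * x)) (L := L)
      (by fun_prop) (fun y hy => ?_) hxI
    · have hB := eq_of_hasDerivAt_zero
        (F := fun x => u x * κ * Complex.sin (κ * x) + v x * Complex.cos (κ * x)) (L := L)
        (by fun_prop) (fun y hy => ?_) hxI
      · simp only [h0, Complex.ofReal_zero, mul_zero, Complex.sin_zero, Complex.cos_zero,
          zero_mul, sub_zero, mul_one, zero_add] at hA hB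
        have := Complex.sin_sq_add_cos_sq (κ * x)
        linear_combination Complex.cos (κ * x) * hA + Complex.sin (κ * x) * hB - u x * κ * this
      · refine ((((du y hy).mul_const κ).mul (dsin y)).add ((dv y hy).mul (dcos y))).congr_deriv ?_
        ring
    · refine ((((du y hy).mul_const κ).mul (dcos y)).sub ((dv y hy).mul (dsin y))).congr_deriv ?_
      ring
  · rintro rfl
    rw [(hx x hxI).1, h0, zero_add]
    have hvc : ∀ y ∈ uIcc 0 x, v y = v 0 := by
      intro y hy
      rw [uIcc_of_le hxI.1] at hy
      rw [hv2 y ⟨hy.1, hy.2.trans hxI.2⟩]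
      simp
    rw [intervalIntegral.integral_congr hvc]
    simp
    ring

/-! ### The eigenfunctions sin(mx) on the edges and their span. -/

theorem memLp_sin (m n : ℕ+) : MemLp (fun x : ℝ => Complex.sin ((m : ℂ) * x)) 2
    ((volume : Measure ℝ).restrict (Icc 0 (Real.pi / (n : ℝ)))) := by
  refine MemLp.of_bound (Continuous.aestronglyMeasurable (by fun_prop)) 1
    (Eventually.of_forall fun x => ?_)
  have e : Complex.sin ((m : ℂ) * x) = ((Real.sin (m * x) : ℝ) : ℂ) := by
    push_cast
    rfl
  rw [e, Complex.norm_real]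
  exact Real.abs_sin_le_one _

/-- The function `sin (m x)` on the `n`-th edge. -/
noncomputable def sinEdge (m n : ℕ+) : EdgeSpace n :=
  MemLp.toLp (fun x : ℝ => Complex.sin ((m : ℂ) * x)) (memLp_sin m n)

theorem coeFn_sinEdge (m n : ℕ+) :
    sinEdge m n =ᵐ[(volume : Measure ℝ).restrict (Icc 0 (Real.pi / (n : ℝ)))]
      fun x : ℝ => Complex.sin ((m : ℂ) * x) :=
  MemLp.coeFn_toLp _

theorem sinEdge_ne_zero {m n : ℕ+} (h : n ∣ m) : sinEdge m n ≠ 0 := by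
  intro h0
  have hm : (0 : ℝ) < m := by exact_mod_cast m.pos
  have hn : (0 : ℝ) < n := by exact_mod_cast n.pos
  have hpi := Real.pi_pos
  have hle : (n : ℝ) ≤ m := by exact_mod_cast PNat.le_of_dvd h
  have hz : EqOn (fun x : ℝ => Complex.sin ((m : ℂ) * x)) 0 (Icc 0 (Real.pi / (n : ℝ))) := by
    refine Measure.eqOn_Icc_of_ae_eq volume (edge_length_pos n).ne ?_ (by fun_prop) continuousOn_const
    filter_upwards [coeFn_sinEdge m n, Lp.eq_zero_iff_ae_eq_zero.1 h0] with x h1 h2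
    rw [← h1, h2]
  -- The first maximum of sin(mx) lies on the edge because n ≤ m.
  have hx : Real.pi / 2 / m ∈ Icc 0 (Real.pi / (n : ℝ)) := by
    refine ⟨by positivity, ?_⟩
    gcongr
    linarith
  have h1 := hz hx
  have e : (m : ℂ) * ((Real.pi / 2 / m : ℝ) : ℂ) = Real.pi / 2 := by
    have : (m : ℂ) ≠ 0 := by exact_mod_cast hm.ne'
    push_cast
    field_simp
  simp only [e, Complex.sin_pi_div_two, Pi.zero_apply] at h1
  exact one_ne_zero h1

theorem isEdgeNegLaplacian_sinEdge {m n : ℕ+} (h : n ∣ m) :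
    IsEdgeNegLaplacian n (sinEdge m n) ((m : ℂ) ^ 2 • sinEdge m n) := by
  have hn : (n : ℂ) ≠ 0 := by exact_mod_cast n.ne_zero
  have dlin : ∀ x : ℝ, HasDerivAt (fun x : ℝ => (m : ℂ) * (x : ℂ)) m x := fun x => by
    simpa using (Complex.ofRealCLM.hasDerivAt (x := x)).const_mul (m : ℂ)
  have dsin : ∀ x : ℝ, HasDerivAt (fun x : ℝ => Complex.sin (m * x)) (Complex.cos (m * x) * m) x :=
    fun x => (Complex.hasDerivAt_sin _).comp x (dlin x)
  have dcos : ∀ x : ℝ, HasDerivAt (fun x : ℝ => Complex.cos (m * x) * m)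
      (-((m : ℂ) ^ 2 * Complex.sin (m * x))) x := fun x =>
    (((Complex.hasDerivAt_cos _).comp x (dlin x)).mul_const (m : ℂ)).congr_deriv (by ring)
  refine ⟨fun x => Complex.sin (m * x), fun x => Complex.cos (m * x) * m, coeFn_sinEdge m n,
    by simp, ?_, fun x hx => ⟨?_, ?_⟩⟩
  · obtain ⟨j, rfl⟩ := h
    have e : ((n * j : ℕ+) : ℂ) * ((Real.pi / n : ℝ) : ℂ) = (j : ℕ) * Real.pi := by
      push_cast
      field_simp
    simp only [e, Complex.sin_nat_mul_pi]
  · rw [intervalIntegral.integral_eq_sub_of_hasDerivAt (fun y _ => dsin y)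
      (Continuous.intervalIntegrable (by fun_prop) _ _)]
    ring
  · have hg : ∫ y in (0 : ℝ)..x, ((m : ℂ) ^ 2 • sinEdge m n : EdgeSpace n) y =
        ∫ y in (0 : ℝ)..x, (m : ℂ) ^ 2 * Complex.sin (m * y) := by
      rw [intervalIntegral.integral_of_le hx.1, intervalIntegral.integral_of_le hx.1]
      refine integral_congr_ae ?_
      refine ae_restrict_of_ae_restrict_of_subset (t := Icc 0 (Real.pi / (n : ℝ)))
        (fun y (hy : y ∈ Ioc 0 x) => ⟨hy.1.le, hy.2.trans hx.2⟩) ?_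
      filter_upwards [coeFn_sinEdge m n, Lp.coeFn_smul ((m : ℂ) ^ 2) (sinEdge m n)] with y h1 h2
      rw [h2, Pi.smul_apply, h1, smul_eq_mul]
    have hI := intervalIntegral.integral_eq_sub_of_hasDerivAt (a := 0) (b := x) (fun y _ => dcos y)
      (Continuous.intervalIntegrable (by fun_prop) _ _)
    rw [intervalIntegral.integral_neg] at hI
    rw [hg]
    linear_combination -hI

/-- Write μ = κ² with any complex root κ. The Dirichlet condition at the far end forces sin(κπ/n) =
0, so κ is a nonzero integer multiple of n; no positivity of the operator is needed to exclude other
μ. -/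
theorem exists_eq_sq_of_ne_zero {n : ℕ+} {f : EdgeSpace n} {μ : ℂ}
    (h : IsEdgeNegLaplacian n f (μ • f)) (hf : f ≠ 0) : ∃ m : ℕ+, n ∣ m ∧ μ = (m : ℂ) ^ 2 := by
  obtain ⟨κ, rfl⟩ : ∃ κ : ℂ, μ = κ ^ 2 :=
    ⟨_, (Complex.cpow_nat_inv_pow μ two_ne_zero).symm⟩
  obtain ⟨u, b, e, hL, hx⟩ := h.eigenfunction
  have hpi : (Real.pi : ℂ) ≠ 0 := by exact_mod_cast Real.pi_ne_zero
  have hn : (n : ℂ) ≠ 0 := by exact_mod_cast n.ne_zero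
  have hLm : Real.pi / (n : ℝ) ∈ Icc 0 (Real.pi / (n : ℝ)) := ⟨(edge_length_pos n).le, le_rfl⟩
  have hu : ¬ ∀ x ∈ Icc (0 : ℝ) (Real.pi / (n : ℝ)), u x = 0 := by
    intro hall
    refine hf (Lp.eq_zero_iff_ae_eq_zero.2 ?_)
    filter_upwards [e, ae_restrict_mem measurableSet_Icc] with x h1 h2
    rw [h1, hall x h2]
    rfl
  by_cases hκ : κ = 0
  · exfalso
    refine hu fun x hxI => ?_
    have h1 := (hx _ hLm).2 hκ
    rw [hL] at h1
    have hb : b = 0 := by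
      refine (mul_eq_zero.1 h1.symm).resolve_right ?_
      exact_mod_cast (edge_length_pos n).ne'
    rw [(hx x hxI).2 hκ, hb, zero_mul]
  · have hb : b ≠ 0 := by
      rintro rfl
      refine hu fun x hxI => ?_
      have := (hx x hxI).1
      rw [zero_mul] at this
      exact (mul_eq_zero.1 this).resolve_right hκ
    have h1 := (hx _ hLm).1
    rw [hL, zero_mul] at h1
    obtain ⟨j, hj⟩ := Complex.sin_eq_zero_iff.1 ((mul_eq_zero.1 h1.symm).resolve_left hb)
    have hκj : κ = j * n := by
      push_cast at hj
      field_simp at hj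
      linear_combination hj
    have hj0 : j ≠ 0 := by
      rintro rfl
      exact hκ (by simp [hκj])
    obtain ⟨q, hq⟩ : ∃ q : ℕ+, (q : ℕ) = j.natAbs := ⟨⟨j.natAbs, Int.natAbs_pos.2 hj0⟩, rfl⟩
    have hsq : ((q : ℕ) : ℂ) ^ 2 = (j : ℂ) ^ 2 := by
      rw [hq, ← Int.cast_natCast (R := ℂ), ← Int.cast_pow, Int.natAbs_sq, Int.cast_pow]
    refine ⟨q * n, Dvd.intro_left _ rfl, ?_⟩
    rw [hκj, PNat.mul_coe, Nat.cast_mul, mul_pow, mul_pow, hsq]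

theorem exists_eq_smul_sinEdge {m n : ℕ+} {f : EdgeSpace n}
    (h : IsEdgeNegLaplacian n f ((m : ℂ) ^ 2 • f)) : ∃ c : ℂ, f = c • sinEdge m n := by
  obtain ⟨u, b, e, -, hx⟩ := h.eigenfunction
  have hm : (m : ℂ) ≠ 0 := by exact_mod_cast m.ne_zero
  refine ⟨b / m, Lp.ext ?_⟩
  filter_upwards [e, ae_restrict_mem measurableSet_Icc, coeFn_sinEdge m n,
    Lp.coeFn_smul (b / (m : ℂ)) (sinEdge m n)] with x h1 h2 h3 h4
  rw [h1, h4, Pi.smul_apply, h3, smul_eq_mul]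
  have := (hx x h2).1
  field_simp
  linear_combination this

theorem mem_negLaplacianEigenspace {μ : ℂ} {ψ : GraphSpace} :
    ψ ∈ negLaplacianEigenspace μ ↔ ∀ n, IsEdgeNegLaplacian n (ψ n) (μ • ψ n) := by
  rw [negLaplacianEigenspace, graph_negLaplacian]
  rfl

/-- The eigenfunction of `-Δ` for the eigenvalue `m²` that is supported on the `n`-th edge. -/
noncomputable def edgeEigenfunction (m n : ℕ+) : GraphSpace := lp.single 2 n (sinEdge m n)

theorem edgeEigenfunction_mem {m n : ℕ+} (h : n ∣ m) :
    edgeEigenfunction m n ∈ negLaplacianEigenspace ((m : ℂ) ^ 2) := by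
  rw [mem_negLaplacianEigenspace]
  intro i
  by_cases hi : i = n
  · subst hi
    rw [edgeEigenfunction, lp.single_apply_self]
    exact isEdgeNegLaplacian_sinEdge h
  · rw [edgeEigenfunction, lp.single_apply_ne _ _ _ hi, smul_zero]
    have := (isEdgeNegLaplacian_sinEdge (dvd_refl i)).smul 0
    simpa using this

/-- A divisor of `m` as a positive natural number. -/
def divisorPNat (m : ℕ+) (d : (m : ℕ).divisors) : ℕ+ := ⟨d, Nat.pos_of_mem_divisors d.2⟩

theorem divisorPNat_dvd (m : ℕ+) (d : (m : ℕ).divisors) : divisorPNat m d ∣ m :=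
  PNat.dvd_iff.2 (Nat.dvd_of_mem_divisors d.2)

theorem divisorPNat_injective (m : ℕ+) : Function.Injective (divisorPNat m) := fun _ _ h =>
  Subtype.ext (congrArg PNat.val h)

theorem sum_smul_edgeEigenfunction_apply (m : ℕ+) (g : (m : ℕ).divisors → ℂ)
    (d : (m : ℕ).divisors) :
    (∑ i, g i • edgeEigenfunction m (divisorPNat m i)) (divisorPNat m d) =
      g d • sinEdge m (divisorPNat m d) := by
  rw [lp.coeFn_sum, Finset.sum_apply, Finset.sum_eq_single d]
  · rw [lp.coeFn_smul, Pi.smul_apply, edgeEigenfunction, lp.single_apply_self]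
  · intro i _ hi
    rw [lp.coeFn_smul, Pi.smul_apply, edgeEigenfunction, lp.single_apply_ne, smul_zero]
    exact fun h => hi (divisorPNat_injective m h).symm
  · simp

theorem linearIndependent_edgeEigenfunction (m : ℕ+) :
    LinearIndependent ℂ fun d : (m : ℕ).divisors => edgeEigenfunction m (divisorPNat m d) := by
  rw [Fintype.linearIndependent_iff]
  intro g hg d
  have h := sum_smul_edgeEigenfunction_apply m g d
  rw [hg] at h
  exact (smul_eq_zero.1 h.symm).resolve_right (sinEdge_ne_zero (divisorPNat_dvd m d))

/-- Components on different edges are independent: on an edge n dividing m only multiples of sin(mx)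
occur, and on every other edge the component vanishes. So one basis vector per divisor of m
suffices. -/
theorem span_edgeEigenfunction (m : ℕ+) :
    Submodule.span ℂ (range fun d : (m : ℕ).divisors => edgeEigenfunction m (divisorPNat m d)) =
      negLaplacianEigenspace ((m : ℂ) ^ 2) := by
  refine le_antisymm (Submodule.span_le.2 ?_) fun ψ hψ => ?_
  · rintro _ ⟨d, rfl⟩
    exact edgeEigenfunction_mem (divisorPNat_dvd m d)
  · rw [mem_negLaplacianEigenspace] at hψ
    choose c hc using fun n => exists_eq_smul_sinEdge (hψ n)
    have e : ψ = ∑ i : (m : ℕ).divisors, c (divisorPNat m i) • edgeEigenfunction m (divisorPNat m i) := by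
      refine lp.ext (funext fun n => ?_)
      by_cases hn : n ∣ m
      · have hd : (n : ℕ) ∈ (m : ℕ).divisors :=
          Nat.mem_divisors.2 ⟨PNat.dvd_iff.1 hn, m.ne_zero⟩
        have := sum_smul_edgeEigenfunction_apply m (fun i => c (divisorPNat m i)) ⟨n, hd⟩
        have hdn : divisorPNat m ⟨n, hd⟩ = n := rfl
        rw [hdn] at this
        rw [this, hc n]
      · have h0 : ψ n = 0 := by
          by_contra hne
          obtain ⟨m', h1, h2⟩ := exists_eq_sq_of_ne_zero (hψ n) hne
          have h3 : (m : ℕ) ^ 2 = (m' : ℕ) ^ 2 := by exact_mod_cast h2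
          rw [PNat.eq (Nat.pow_left_injective two_ne_zero h3)] at hn
          exact hn h1
        rw [h0, lp.coeFn_sum, Finset.sum_apply]
        refine (Finset.sum_eq_zero fun i _ => ?_).symm
        rw [lp.coeFn_smul, Pi.smul_apply, edgeEigenfunction, lp.single_apply_ne, smul_zero]
        rintro rfl
        exact hn (divisorPNat_dvd m i)
    rw [e]
    exact Submodule.sum_mem _ fun i _ => Submodule.smul_mem _ _ (Submodule.subset_span ⟨i, rfl⟩)

theorem eigenMult_sq (m : ℕ+) : eigenMult ((m : ℂ) ^ 2) = (m : ℕ).divisors.card := by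
  rw [eigenMult, ← span_edgeEigenfunction,
    finrank_span_eq_card (linearIndependent_edgeEigenfunction m), Fintype.card_coe]

theorem negLaplacianEigenspace_ne_bot_iff {μ : ℂ} :
    negLaplacianEigenspace μ ≠ ⊥ ↔ ∃ m : ℕ+, μ = (m : ℂ) ^ 2 := by
  constructor
  · intro h
    obtain ⟨ψ, hψ, h0⟩ := Submodule.exists_mem_ne_zero_of_ne_bot h
    rw [mem_negLaplacianEigenspace] at hψ
    obtain ⟨n, hn⟩ : ∃ n, ψ n ≠ 0 := by
      by_contra! hall
      exact h0 (lp.ext (funext hall))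
    obtain ⟨m, -, hm⟩ := exists_eq_sq_of_ne_zero (hψ n) hn
    exact ⟨m, hm⟩
  · rintro ⟨m, rfl⟩ h
    have := eigenMult_sq m
    rw [eigenMult, h, finrank_bot] at this
    exact (Finset.card_pos.2 ⟨1, by simp⟩).ne this

theorem eigenMult_eq_zero {μ : ℂ} (h : ¬ ∃ m : ℕ+, μ = (m : ℂ) ^ 2) : eigenMult μ = 0 := by
  rw [← negLaplacianEigenspace_ne_bot_iff, not_not] at h
  rw [eigenMult, h, finrank_bot]

/-- The trace is a sum over all complex μ; the multiplicity vanishes off the squares and m ↦ m² is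
injective, so it reduces to the sum over m ≥ 1. -/
theorem isSpectralZeta_spectralZeta {k : ℂ} (ha : -1 < (k ^ 2).re) :
    IsSpectralZeta k (spectralZeta (k ^ 2)) := by
  refine ⟨meromorphicOn_spectralZeta ha, fun s hs => ?_⟩
  have hinj : Function.Injective fun m : ℕ+ => ((m : ℕ) : ℂ) ^ 2 := by
    intro m m' h
    have h' : ((m : ℕ) : ℂ) ^ 2 = ((m' : ℕ) : ℂ) ^ 2 := h
    have h3 : (m : ℕ) ^ 2 = (m' : ℕ) ^ 2 := by exact_mod_cast h'
    exact PNat.eq (Nat.pow_left_injective two_ne_zero h3)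
  rw [← hinj.hasSum_iff]
  · refine (hasSum_spectralZeta ha hs).congr_fun fun m => ?_
    simp only [Function.comp]
    rw [eigenMult_sq]
  · intro μ hμ
    rw [eigenMult_eq_zero fun ⟨m, hm⟩ => hμ ⟨m, hm.symm⟩, Nat.cast_zero, zero_mul]

theorem isSpectralDet_spectralDet : IsSpectralDet spectralDet := by
  refine ⟨differentiable_spectralDet, fun k hk => ?_⟩
  -- The region |Im k| < √(1 + (Re k)²) is exactly Re k² > -1, which keeps every m² + k² in the
  -- right half-plane.
  have ha : -1 < (k ^ 2).re := by
    rw [Real.lt_sqrt (abs_nonneg _), sq_abs] at hk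
    rw [sq, Complex.mul_re]
    nlinarith
  exact ⟨spectralZeta (k ^ 2), isSpectralZeta_spectralZeta ha, (spectralZeta_at_zero ha).1,
    spectralDet_eq_exp ha⟩

/-! ### The periodic-orbit zeta function on the slit plane -/

/-- The elementary factor relating the zeta function to the determinant. -/
noncomputable def zetaFactor (s : ℂ) : ℂ :=
  1 / s ^ (1 / 2 : ℂ) * Complex.exp (-(Real.pi : ℂ) * s * Complex.log s -
    (2 * (Real.eulerMascheroniConstant : ℂ) - 1) * Real.pi * s)

theorem zetaFactor_ne_zero {s : ℂ} (hs : s ≠ 0) : zetaFactor s ≠ 0 := by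
  refine mul_ne_zero (one_div_ne_zero ?_) (Complex.exp_ne_zero _)
  rw [Ne, Complex.cpow_eq_zero_iff]
  exact fun h => hs h.1

theorem analyticOnNhd_zetaFactor : AnalyticOnNhd ℂ zetaFactor Complex.slitPlane := by
  refine DifferentiableOn.analyticOnNhd (fun s hs => ?_) Complex.isOpen_slitPlane
  have h1 := (hasDerivAt_sqrt hs).differentiableAt
  have h2 := (Complex.hasDerivAt_log hs).differentiableAt
  have h3 : s ^ (1 / 2 : ℂ) ≠ 0 := by
    rw [Ne, Complex.cpow_eq_zero_iff]
    exact fun h => Complex.slitPlane_ne_zero hs h.1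
  exact (((differentiableAt_const _).div h1 h3).mul
    (DifferentiableAt.cexp (by fun_prop))).differentiableWithinAt

/-- The analytic continuation of the periodic-orbit zeta function to the slit plane. -/
noncomputable def zetaSlit (s : ℂ) : ℂ := zetaFactor s * spectralDet s

theorem analyticOnNhd_zetaSlit : AnalyticOnNhd ℂ zetaSlit Complex.slitPlane := fun s hs =>
  (analyticOnNhd_zetaFactor s hs).mul (differentiable_spectralDet.analyticAt s)

theorem zetaSlit_eq_zero_iff {s : ℂ} (hs : s ∈ Complex.slitPlane) :
    zetaSlit s = 0 ↔ ∃ n : ℕ+, s = n * Complex.I ∨ s = -(n * Complex.I) := by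
  rw [zetaSlit, mul_eq_zero, or_iff_right (zetaFactor_ne_zero (Complex.slitPlane_ne_zero hs)),
    spectralDet_eq_zero_iff]

theorem natCast_mul_I_mem_slitPlane (n : ℕ+) :
    (n : ℂ) * Complex.I ∈ Complex.slitPlane ∧ -((n : ℂ) * Complex.I) ∈ Complex.slitPlane := by
  constructor <;> refine Or.inr ?_ <;> simp

theorem analyticOrderAt_zetaSlit (n : ℕ+) {z : ℂ} (hs : z ∈ Complex.slitPlane)
    (hz : z = n * Complex.I ∨ z = -(n * Complex.I)) :
    analyticOrderAt zetaSlit z = ((n : ℕ).divisors.card : ℕ∞) := by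
  have h1 := analyticOnNhd_zetaFactor z hs
  have h := analyticOrderAt_mul h1 (differentiable_spectralDet.analyticAt z)
  rw [h1.analyticOrderAt_eq_zero.2 (zetaFactor_ne_zero (Complex.slitPlane_ne_zero hs)), zero_add,
    analyticOrderAt_spectralDet n hz] at h
  exact h

/-- Known on the positive axis by comparing the determinant with the trapezoidal errors; both sides
are analytic on the right half-plane. -/
theorem exp_orbitSum_eq_zetaSlit {s : ℂ} (hs : 0 < s.re) :
    Complex.exp (orbitSum s) = zetaSlit s := by
  refine eqOn_re_pos_of_eq_ofReal (f := fun s => Complex.exp (orbitSum s)) (h := zetaSlit) (fun z hz => ?_)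
    (fun z hz => ?_) (fun x hx => ?_) hs
  · exact (analyticOnNhd_orbitSum z hz).cexp.differentiableAt
  · exact (analyticOnNhd_zetaSlit z (Or.inl hz)).differentiableAt
  · exact (spectralDet_ofReal hx).symm

/-- Analytic continuation, determinant formula, zeros and logarithm of the periodic-orbit zeta
function. `D k` is `det(-Δ + k²)`, `Z` is the analytic continuation of `Zpo` from the positive
half-line to `ℂ ∖ ℝ_{≤ 0}`, `L` is the branch of `ln Z` on `Re s > 0` that is real on the positive
half-line. -/
theorem theorem10 :
    -- the series and the integrals that define `Tpo` and `Zpo` converge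
    (∀ k : ℝ, 0 < k →
      (∀ n : ℕ+, IntegrableOn (poIntegrand n k) (Ioi 0)) ∧ Summable (poTerm k)) ∧
    (∀ s : ℝ, 0 < s → IntegrableOn (fun k : ℝ => k * Tpo k) (Ioi s)) ∧
    ∃ D Z L : ℂ → ℂ,
      IsSpectralDet D ∧
      -- analytic continuation of `Zpo` to the slit plane
      AnalyticOnNhd ℂ Z Complex.slitPlane ∧
      (∀ s : ℝ, 0 < s → Z s = Zpo s) ∧
      -- the determinant formula
      (∀ s ∈ Complex.slitPlane,
        Z s = 1 / s ^ (1 / 2 : ℂ) *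
          Complex.exp (-(Real.pi : ℂ) * s * Complex.log s -
            (2 * (Real.eulerMascheroniConstant : ℂ) - 1) * Real.pi * s) * D s) ∧
      -- the zeros, all of them on the imaginary axis
      (∀ s ∈ Complex.slitPlane,
        Z s = 0 ↔ ∃ n : ℕ+, s = (n : ℂ) * Complex.I ∨ s = -((n : ℂ) * Complex.I)) ∧
      (∀ s ∈ Complex.slitPlane, Z s = 0 → s.re = 0) ∧
      -- these zeros are the `±i k` for the wavenumbers `k > 0`, i.e. `k²` is an eigenvalue of `-Δ`
      (∀ k : ℝ, 0 < k →
        (negLaplacianEigenspace ((k : ℂ) ^ 2) ≠ ⊥ ↔ ∃ n : ℕ+, k = (n : ℝ))) ∧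
      -- their orders are `d(n)`, the multiplicity of the eigenvalue `n²` of `-Δ`
      (∀ n : ℕ+,
        analyticOrderAt Z ((n : ℂ) * Complex.I) = ((n : ℕ).divisors.card : ℕ∞) ∧
        analyticOrderAt Z (-((n : ℂ) * Complex.I)) = ((n : ℕ).divisors.card : ℕ∞) ∧
        eigenMult ((n : ℂ) ^ 2) = (n : ℕ).divisors.card) ∧
      -- the logarithm of `Z` on the right half-plane as a series over periodic orbits
      AnalyticOnNhd ℂ L {s : ℂ | 0 < s.re} ∧
      (∀ s : ℝ, 0 < s → L s = Real.log (Zpo s)) ∧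
      (∀ s : ℂ, 0 < s.re → Complex.exp (L s) = Z s) ∧
      (∀ s : ℂ, 0 < s.re →
        HasSum (fun n : ℕ+ => -(Real.sqrt (2 / Real.pi) : ℂ) * s ^ (1 / 2 : ℂ) * logZTerm s n)
          (L s)) := by
  -- The continuation is defined by the determinant formula, so that clause holds by `rfl`; the
  -- content is its agreement with `Zpo` on s > 0, which passes through the orbit series taken as
  -- `L`.
  refine ⟨fun k hk => ⟨fun n => integrableOn_poIntegrand n hk, (hasSum_poTerm hk).1⟩,
    fun s hs => integrableOn_mul_Tpo hs, spectralDet, zetaSlit, orbitSum,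
    isSpectralDet_spectralDet, analyticOnNhd_zetaSlit, fun s hs => ?_, fun s _ => rfl,
    fun s hs => zetaSlit_eq_zero_iff hs, fun s hs h => ?_, fun k hk => ?_, fun n => ?_,
    analyticOnNhd_orbitSum, fun s hs => (exp_orbitSum hs).1,
    fun s hs => exp_orbitSum_eq_zetaSlit hs, fun s hs => ?_⟩
  · rw [← exp_orbitSum_eq_zetaSlit (by simpa using hs), (exp_orbitSum hs).2]
  · obtain ⟨n, rfl | rfl⟩ := (zetaSlit_eq_zero_iff hs).1 h <;> simp
  · rw [negLaplacianEigenspace_ne_bot_iff]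
    refine exists_congr fun m => ?_
    have hm : (0 : ℝ) ≤ m := Nat.cast_nonneg _
    rw [← sq_eq_sq₀ hk.le hm]
    norm_cast
  · obtain ⟨h1, h2⟩ := natCast_mul_I_mem_slitPlane n
    exact ⟨analyticOrderAt_zetaSlit n h1 (Or.inl rfl), analyticOrderAt_zetaSlit n h2 (Or.inr rfl),
      eigenMult_sq n⟩
  · exact (summable_orbitTerm hs).hasSum.congr_fun fun n => mul_logZTerm_eq_orbitTerm n s
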